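/- **Setting.** Fix constants: an integer $K\ge 3$, feature strengths $\phi_1,\dots,\phi_K>0$, a mean $\mu\neq 0$ with $1+\mu^2>\phi_1^2$, and a learning rate $\eta>0$. A learning problem consists of integers $d\ge K$, $n,m\ge 1$, $p\ge 3$, reals $\sigma_0>0$, $\sigma_\xi\ge 0$, an orthonormal basis $v_1,\dots,v_d$ of $\mathbb R^d$, and attributes $(y_i,y_{\mathrm{sub},i},k_i,\rho_i)\in\{-1,1\}\times\{-1,1\}\times\{3,\dots,K\}\times\{-1,1\}$, $i=1,\dots,n$, in which every value occurs equally often (balanced dataset). *Data.* An example of the distribution $\mathcal D_{\mathrm{orig}}$ is $x=u+\xi$ with $$u=y\phi_1v_1+(y_{\mathrm{sub}}\phi_2+\mu)v_2+\rho\,\phi_kv_k ,$$ where $y,y_{\mathrm{sub}},\rho$ are uniform on $\{-1,1\}$, $k$ is uniform on $\{3,\dots,K\}$, $\xi$ is uniform on $\{\sigma_\xi v_1,\dots,\sigma_\xi v_d\}$, all independent. The training set consists of the $mn$ vectors $x_{ij}=u_i+\xi_{ij}$ ($i\le n$, $j\le m$), where $u_i$ is the signal with the attributes of the $i$-th example and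 the $\xi_{ij}$ are independent copies of $\xi$. *Training.* For $\Theta=[W\ b]\in\mathbb R^{p\times(d+1)}$ let $f_\Theta(x)=Wx+b$ and let $$\mathcal L_{\mathrm{SCL}}(\Theta)=-2\,\hat{\mathbb E}_{c\in\{-1,1\},\,x,x^+\in\mathcal S_c}\big[f_\Theta(x)^\top f_\Theta(x^+)\big]+\hat{\mathbb E}_{x,x^-}\big[(f_\Theta(x)^\top f_\Theta(x^-))^2\big],$$ where $\hat{\mathbb E}$ are averages over the training set and $\mathcal S_c$ is the set of training vectors with class label $c$. The entries of $\Theta_0$ are independent $\mathcal N(0,\sigma_0^2/d)$ variables, independent of the $\xi_{ij}$, and $\Theta_{t}=\Theta_{t-1}-\eta\nabla\mathcal L_{\mathrm{SCL}}(\Theta_{t-1})$, $\Theta_t=[W_t\ b_t]$. **Theorem.** There are constants $c,A>0$ and $C_q$ ($q\in\mathbb N$), depending only on $K,\phi_1,\dots,\phi_K,\mu,\eta$ (and $C_q$ also on $q$), such that the following holds. For every sequence of learning problems (indexed by $N\to\infty$, with all of $d,n,m,p,\sigma_0,\sigma_\xi$, the basis and the attributes depending on $N$) such that $$\sigma_0\sqrt{p/d}=o(1),\qquad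 \sigma_\xi=o(1),\qquad m^2n^2/d=o(1),$$ there is a sequence $\varepsilon=\varepsilon_N\to 0$ such that, for every $q\in\mathbb N$ and all sufficiently large $N$, with probability at least $1-C_q\left(\frac{m^2n^2}{d}+\frac1{p^q}\right)$ over the training noise and the initialization: * $\|W_0v_2\|\le\varepsilon$, and * there is an integer $0\le t\le A\ln\!\big(\tfrac1{\sigma_0}\sqrt{d/p}\big)$ such that $\|W_tv_2\|\ge c$ and such that the subclasses are linearly separable in the embedding at time $t$, in the following sense, where $\Pr$ refers to a fresh example $(x,y,y_{\mathrm{sub}})\sim\mathcal D_{\mathrm{orig}}$: * there is $\beta\in\mathbb R^p$ with $\Pr\big(y_{\mathrm{sub}}\,\beta^\top (W_tx+b_t)>0\mid y\big)\ge 1-\varepsilon$ for both values of $y$; * for each value of $y$ there is $\beta\in\mathbb R^p$ with $\Pr\big(y_{\mathrm{sub}}\,\beta^\top W_tx>0\mid y\big)\ge 1-\varepsilon$; * if $|\mu|<\phi_2$, then there is $\beta\in\mathbb R^p$ with $\Pr\big(y_{\mathrm{sub}}\,\beta^\top W_tx>0\mid y\big)\ge 1-\varepsilon$ for both values of $y$.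 If moreover $p\to\infty$, then the probability that all of this holds (with this $\varepsilon$) tends to $1$. -/

import Mathlib

open Filter Topology MeasureTheory ProbabilityTheory
open scoped BigOperators RealInnerProductSpace

noncomputable section

/-- `ℝ^k` with its Euclidean norm. -/
abbrev Vec (k : ℕ) : Type := EuclideanSpace ℝ (Fin k)

/-- The parameter `Θ = [W b] ∈ ℝ^{p × (d+1)}`, with the Frobenius inner product. The columns with
index in `Fin d` are the weights `W`, the last column is the bias `b`. -/
abbrev Param (p d : ℕ) : Type := EuclideanSpace ℝ (Fin p × Fin (d + 1))

namespace Param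

variable {p d : ℕ}

/-- The weight matrix `W ∈ ℝ^{p × d}` of `Θ = [W b]`. -/
def weight (Θ : Param p d) : Matrix (Fin p) (Fin d) ℝ :=
  Matrix.of fun i j => Θ (i, j.castSucc)

/-- The bias `b ∈ ℝ^p` of `Θ = [W b]`. -/
def bias (Θ : Param p d) : Vec p :=
  WithLp.toLp 2 fun i => Θ (i, Fin.last d)

/-- The linear part `x ↦ W x`. -/
def linear (Θ : Param p d) (x : Vec d) : Vec p :=
  WithLp.toLp 2 (Matrix.mulVec Θ.weight x.ofLp)

/-- The model `f_Θ(x) = W x + b`. -/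
def model (Θ : Param p d) (x : Vec d) : Vec p :=
  Θ.linear x + Θ.bias

end Param

/-- Gradient descent with constant learning rate `η` on the loss `L`, started at `Θ₀`. -/
def gradientDescent {E : Type*} [NormedAddCommGroup E] [InnerProductSpace ℝ E] [CompleteSpace E]
    (η : ℝ) (L : E → ℝ) (Θ₀ : E) : ℕ → E
  | 0 => Θ₀
  | t + 1 => gradientDescent η L Θ₀ t - η • gradient L (gradientDescent η L Θ₀ t)

/-- The discrete attributes `(y, y_sub, k, ρ)` of an example: class label, subclass label, index of
the irrelevant feature that is present (one of the features `3, …, K`; features are numbered from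
`0` here) and its sign. The type `ℤˣ` is `{-1, 1}`. -/
structure Attr (K : ℕ) where
  y : ℤˣ
  ysub : ℤˣ
  k : {k : Fin K // 2 ≤ (k : ℕ)}
  ρ : ℤˣ
deriving DecidableEq, Fintype

instance (K : ℕ) : MeasurableSpace (Attr K) := ⊤

instance (K : ℕ) : DiscreteMeasurableSpace (Attr K) := ⟨fun _ => trivial⟩

/-- The quantities that stay constant in the asymptotic regime: the number `K` of features, their
strengths `φ₁, …, φ_K`, the mean `μ` of the subclass feature (the other features have mean zero)
and the learning rate `η`. -/
structure Constants where
  K : ℕ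
  three_le_K : 3 ≤ K
  φ : Fin K → ℝ
  φ_pos : ∀ k, 0 < φ k
  μ : ℝ
  η : ℝ
  η_pos : 0 < η

namespace Constants

/-- The index of the class feature `v₁`. -/
def cls (κ : Constants) : Fin κ.K := ⟨0, by have := κ.three_le_K; omega⟩

/-- The index of the subclass feature `v₂`. -/
def sub (κ : Constants) : Fin κ.K := ⟨1, by have := κ.three_le_K; omega⟩

end Constants

/-- A learning problem: ambient dimension `d`, number `n` of original examples,
number `m` of augmentations per example, output dimension `p`, noise scale `σ_ξ`, initialization
scale `σ₀`, an orthonormal basis `v₁, …, v_d` of `ℝ^d` whose first `K` members are the features, and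
the attributes of the `n` original examples, which form a balanced dataset. -/
structure Problem (κ : Constants) where
  d : ℕ
  n : ℕ
  m : ℕ
  p : ℕ
  K_le_d : κ.K ≤ d
  n_pos : 0 < n
  m_pos : 0 < m
  three_le_p : 3 ≤ p
  σξ : ℝ
  σξ_nonneg : 0 ≤ σξ
  σ₀ : ℝ
  σ₀_pos : 0 < σ₀
  v : OrthonormalBasis (Fin d) ℝ (Vec d)
  attr : Fin n → Attr κ.K
  balanced : ∀ a a' : Attr κ.K,
    (Finset.univ.filter fun i => attr i = a).card = (Finset.univ.filter fun i => attr i = a').card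

namespace Problem

variable {κ : Constants} (S : Problem κ)

/-- The `k`-th feature vector. -/
def feature (k : Fin κ.K) : Vec S.d := S.v (Fin.castLE S.K_le_d k)

/-- The subclass feature `v₂`. -/
def v₂ : Vec S.d := S.feature κ.sub

/-- The noiseless part `u = y φ₁ v₁ + (y_sub φ₂ + μ) v₂ + ρ φ_k v_k` of an example. -/
def signal (a : Attr κ.K) : Vec S.d :=
  (((a.y : ℤ) : ℝ) * κ.φ κ.cls) • S.feature κ.cls
    + (((a.ysub : ℤ) : ℝ) * κ.φ κ.sub + κ.μ) • S.feature κ.sub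
    + (((a.ρ : ℤ) : ℝ) * κ.φ a.k) • S.feature a.k

/-- An example `x = u + ξ` with noise `ξ = σ_ξ v_j`. -/
def dataPoint (a : Attr κ.K) (j : Fin S.d) : Vec S.d :=
  S.signal a + S.σξ • S.v j

/-- The data distribution, as the joint law of the attributes and of the index of the noise vector:
they are independent and uniform. -/
def dataLaw : Measure (Attr κ.K × Fin S.d) := uniformOn Set.univ

/-- `Pr(y_sub βᵀ g(x) > 0 | y = c)` for a fresh example `(x, y, y_sub)` of the data distribution,
where `g` is an embedding map. -/
def subclassAccuracy (g : Vec S.d → Vec S.p) (β : Vec S.p) (c : ℤˣ) : ℝ :=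
  (ProbabilityTheory.cond S.dataLaw {z | z.1.y = c}).real
    {z | 0 < ((z.1.ysub : ℤ) : ℝ) * ⟪β, g (S.dataPoint z.1 z.2)⟫}

/-- The noise indices of the augmentations: `ξ (i, j)` is the index of the noise vector of the
`j`-th augmentation of the `i`-th original example. -/
abbrev Noise : Type := Fin S.n × Fin S.m → Fin S.d

/-- The augmented training example with index `a = (i, j)`. An augmentation keeps the signal of the
original example and replaces its noise by fresh noise. -/
def trainExample (ξ : S.Noise) (a : Fin S.n × Fin S.m) : Vec S.d :=
  S.dataPoint (S.attr a.1) (ξ a)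

/-- The indices of the augmented examples with class label `c`. -/
def classIdx (c : ℤˣ) : Finset (Fin S.n × Fin S.m) :=
  Finset.univ.filter fun a => (S.attr a.1).y = c

/-- The supervised (spectral) contrastive loss; `𝔼` denotes averages over finite sets. -/
def lossSCL (ξ : S.Noise) (Θ : Param S.p S.d) : ℝ :=
  -2 * (𝔼 c : ℤˣ, 𝔼 a ∈ S.classIdx c, 𝔼 b ∈ S.classIdx c,
      ⟪Θ.model (S.trainExample ξ a), Θ.model (S.trainExample ξ b)⟫)
    + 𝔼 a : Fin S.n × Fin S.m, 𝔼 b : Fin S.n × Fin S.m,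
      ⟪Θ.model (S.trainExample ξ a), Θ.model (S.trainExample ξ b)⟫ ^ 2

/-- The sample space of the training procedure: the noise of the augmentations and the entries of
the initial parameter. -/
abbrev Sample : Type := S.Noise × (Fin S.p × Fin (S.d + 1) → ℝ)

/-- The law of the training procedure: all noise indices are uniform, all entries of the initial
parameter are Gaussian with mean `0` and variance `σ₀² / d`, and everything is independent. -/
def law : Measure S.Sample :=
  (Measure.pi fun _ : Fin S.n × Fin S.m => (uniformOn Set.univ : Measure (Fin S.d))).prod
    (Measure.pi fun _ : Fin S.p × Fin (S.d + 1) =>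
      gaussianReal 0 (Real.toNNReal (S.σ₀ ^ 2 / (S.d : ℝ))))

/-- The parameter `Θ_t` after `t` steps of gradient descent on the supervised contrastive loss. -/
def iterate (ω : S.Sample) (t : ℕ) : Param S.p S.d :=
  gradientDescent κ.η (S.lossSCL ω.1) (WithLp.toLp 2 ω.2) t

/-- The subclasses are linearly separable up to error probability `ε` in the embedding given by
`Θ = [W b]`:
* one linear classifier `β` on the embeddings `W x + b` works for both classes `y`;
* for each class `y`, some `β` works for the embeddings `W x` without the bias;
* one `β` works for both classes without the bias, provided that `|μ| < φ₂`, so that the sign of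
  the `v₂`-coordinate `y_sub φ₂ + μ` of the signal is that of `y_sub`. -/
def Separates (Θ : Param S.p S.d) (ε : ℝ) : Prop :=
  (∃ β : Vec S.p, ∀ c : ℤˣ, 1 - ε ≤ S.subclassAccuracy Θ.model β c) ∧
  (∀ c : ℤˣ, ∃ β : Vec S.p, 1 - ε ≤ S.subclassAccuracy Θ.linear β c) ∧
  (|κ.μ| < κ.φ κ.sub →
    ∃ β : Vec S.p, ∀ c : ℤˣ, 1 - ε ≤ S.subclassAccuracy Θ.linear β c)

/-- The event that `‖W₀ v₂‖ ≤ ε` and that at some time `t ≤ A ln((1/σ₀) √(d/p))` one has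
`‖W_t v₂‖ ≥ c` and the subclasses are linearly separable up to error probability `ε`. -/
def LearnsSubclassEarly (c A ε : ℝ) (ω : S.Sample) : Prop :=
  ‖(S.iterate ω 0).linear S.v₂‖ ≤ ε ∧
  ∃ t : ℕ, (t : ℝ) ≤ A * Real.log (1 / S.σ₀ * √((S.d : ℝ) / (S.p : ℝ))) ∧
    c ≤ ‖(S.iterate ω t).linear S.v₂‖ ∧
    S.Separates (S.iterate ω t) ε

end Problem

end

/-! Writing a parameter as one linear map `Θ.act` on extended inputs `(x, 1)`, a gradient step is a
linear term plus a cubic one. The linear term replaces `Θ` by `Θ (1 + 4η (u uᵀ + r rᵀ))`, where `u`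
and `r` are half the sum and half the difference of the two class means. Up to noise, `u` is `μ v₂`
plus the bias direction and `r` is `φ₁ v₁`. The two are orthogonal, and the assumption `φ₁² < 1 +
μ²` says that `u` is the longer one. Hence a small initialization of scale `s = σ₀ √(p/d)` grows
along `u` at the fastest rate `λ = 1 + 4η ‖u‖²`. Since `μ ≠ 0`, the subclass feature has a component
along `u` and is amplified together with the bias.

While `y = s λ ^ t` is below a small constant, the cubic term is a relative perturbation of order
`y²` per step; as `y` grows geometrically, the accumulated error is again `O(y²)`. So `Θ v₂` reaches
constant size after about `log (1/s) / log λ` steps (`growth`, `norm_top_ge`, `norm_kernel_le`,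
`exists_time`).

At that time `Θ` is still injective at scale `s` on the span of the features, the bias and the
averaged noise (`norm_ge`): nearly all of the update multiplies `Θ` on the right by a positive
perturbation of the identity. Therefore every functional of these coordinates is `⟪β, Θ ·⟫` for some
`β` of norm `O(1/s)` (`exists_inner_eq_of_antilipschitz`). A fresh noise direction is, outside a
small exceptional set, orthogonal to the training inputs, so `Θ` still acts on it as at
initialization, with size `O(s)` for most directions. Its effect on the classifier is `O(σ_ξ)`, and
explicit functionals of `v₁`, `v₂` and the bias separate the subclasses.

Training noise is handled by splitting each noise direction into the average over examples with
equal attributes and a centred remainder. By balancedness all cross terms cancel, and the dynamics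
closes on a coordinate space of fixed dimension together with the images of the centred noise
(`reducedDynamics`). This requires distinct noise directions away from the features, a birthday-type
event of probability `1 - O(m²n²/d)`. The Gaussian initialization is well conditioned on the
fixed-dimensional space by chi-square tails, exponentially small in `p`. -/

noncomputable section

/-! ### Mean squares and second moment operators. -/

section MeanSq

variable {ι Y : Type*} [Fintype ι] [NormedAddCommGroup Y]

/-- The mean square norm of a finite family. -/
def meanSq (f : ι → Y) : ℝ := (Fintype.card ι : ℝ)⁻¹ * ∑ i, ‖f i‖ ^ 2

lemma meanSq_nonneg (f : ι → Y) : 0 ≤ meanSq f := by unfold meanSq; positivity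

lemma meanSq_le {f : ι → Y} {c : ℝ} (h : ∀ i, ‖f i‖ ≤ c) : meanSq f ≤ c ^ 2 := by
  unfold meanSq
  rcases isEmpty_or_nonempty ι with hι | hι
  · simp; positivity
  have hcard : (0 : ℝ) < Fintype.card ι := by exact_mod_cast Fintype.card_pos
  rw [inv_mul_le_iff₀ hcard]
  calc ∑ i, ‖f i‖ ^ 2 ≤ ∑ _i : ι, c ^ 2 := Finset.sum_le_sum fun i _ => by gcongr; exact h i
    _ = _ := by simp

lemma meanSq_le_mul {f g : ι → Y} {c : ℝ} (h : ∀ i, ‖f i‖ ≤ c * ‖g i‖) :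
    meanSq f ≤ c ^ 2 * meanSq g := by
  unfold meanSq
  rw [mul_left_comm]
  have key : ∑ i, ‖f i‖ ^ 2 ≤ c ^ 2 * ∑ i, ‖g i‖ ^ 2 := by
    rw [Finset.mul_sum]
    refine Finset.sum_le_sum fun i _ => ?_
    rw [← mul_pow]
    exact pow_le_pow_left₀ (norm_nonneg _) (h i) 2
  have hcard : (0 : ℝ) ≤ (Fintype.card ι : ℝ)⁻¹ := by positivity
  exact mul_le_mul_of_nonneg_left key hcard

end MeanSq

section SecondMoment

variable {ι H Y : Type*} [Fintype ι]
  [NormedAddCommGroup H] [InnerProductSpace ℝ H] [NormedAddCommGroup Y] [InnerProductSpace ℝ Y]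

/-- The empirical second moment operator `y ↦ avg_i ⟪f i, y⟫ f i`. -/
def secondMoment (f : ι → Y) (y : Y) : Y :=
  (Fintype.card ι : ℝ)⁻¹ • ∑ i, ⟪f i, y⟫ • f i

lemma norm_secondMoment_le (f : ι → Y) (y : Y) : ‖secondMoment f y‖ ≤ meanSq f * ‖y‖ := by
  unfold secondMoment meanSq
  rw [norm_smul, Real.norm_of_nonneg (by positivity), mul_assoc]
  gcongr
  rw [Finset.sum_mul]
  refine (norm_sum_le _ _).trans (Finset.sum_le_sum fun i _ => ?_)
  rw [norm_smul]
  have := norm_inner_le_norm (𝕜 := ℝ) (f i) y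
  nlinarith [norm_nonneg (f i), norm_nonneg y]

/-- Moves a second moment from the output side to the input side of `T`. This is what lets
`norm_step_ge` treat the signal part of the cubic term as a right multiplication. -/
lemma secondMoment_map (T : H →L[ℝ] Y) (q : ι → H) (y : Y) :
    secondMoment (fun i => T (q i)) y
      = T ((Fintype.card ι : ℝ)⁻¹ • ∑ i, ⟪T (q i), y⟫ • q i) := by
  simp [secondMoment, map_sum]

end SecondMoment

/-! ### One step of the reduced dynamics. -/

/-- The two sequences `T`, `N` follow the gradient descent dynamics on the span of the signals and
of the averaged noise (`T`) and on the centred noise (`N`). -/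
structure ReducedDynamics {ι I H Y : Type*} [Fintype ι] [Fintype I]
    [NormedAddCommGroup H] [InnerProductSpace ℝ H] [NormedAddCommGroup Y] [InnerProductSpace ℝ Y]
    (a σ : ℝ) (q : ι → H) (u r : H) (T : ℕ → H →L[ℝ] Y) (N : ℕ → I → Y) : Prop where
  step_T : ∀ t h, T (t + 1) h = T t h + a • T t (⟪u, h⟫ • u + ⟪r, h⟫ • r)
    - a • (secondMoment (fun i => T t (q i)) (T t (secondMoment q h))
      + σ ^ 2 • secondMoment (N t) (T t (secondMoment q h)))
  step_N : ∀ t i, N (t + 1) i = N t i - (a * (σ ^ 2 / Fintype.card I)) •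
    (secondMoment (fun i => T t (q i)) (N t i) + σ ^ 2 • secondMoment (N t) (N t i))

section RankTwo

variable {H : Type*} [NormedAddCommGroup H] [InnerProductSpace ℝ H]

/-- For orthogonal `u`, `r` the larger eigenvalue of `u uᵀ + r rᵀ` on their span is `‖u‖²`. The
proof compares `‖z‖²` with `‖u‖² ⟪z, h⟫`. -/
lemma norm_rankTwo_le {u r : H} (hur : ⟪u, r⟫ = 0) (hr : ‖r‖ ≤ ‖u‖) (h : H) :
    ‖⟪u, h⟫ • u + ⟪r, h⟫ • r‖ ≤ ‖u‖ ^ 2 * ‖h‖ := by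
  set z := ⟪u, h⟫ • u + ⟪r, h⟫ • r with hz
  have hru : ⟪r, u⟫ = 0 := by rw [real_inner_comm]; exact hur
  have h1 : ‖z‖ ^ 2 = ⟪u, h⟫ ^ 2 * ‖u‖ ^ 2 + ⟪r, h⟫ ^ 2 * ‖r‖ ^ 2 := by
    rw [← real_inner_self_eq_norm_sq, hz]
    simp only [inner_add_left, inner_add_right, real_inner_smul_left, real_inner_smul_right, hur,
      hru, real_inner_self_eq_norm_sq, norm_smul, mul_pow, Real.norm_eq_abs, sq_abs]
    ring
  have h2 : ⟪z, h⟫ = ⟪u, h⟫ ^ 2 + ⟪r, h⟫ ^ 2 := by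
    rw [hz]; simp only [inner_add_left, real_inner_smul_left]; ring
  have h3 : ⟪z, h⟫ ≤ ‖z‖ * ‖h‖ := real_inner_le_norm z h
  have h4 : ‖r‖ ^ 2 ≤ ‖u‖ ^ 2 := by gcongr
  have h5 : ‖z‖ ^ 2 ≤ ‖u‖ ^ 2 * (‖z‖ * ‖h‖) := by
    nlinarith [sq_nonneg ⟪r, h⟫, mul_le_mul_of_nonneg_left h4 (sq_nonneg ⟪r, h⟫),
      mul_le_mul_of_nonneg_left h3 (sq_nonneg ‖u‖)]
  rcases (norm_nonneg z).eq_or_lt with h0 | h0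
  · rw [← h0]; positivity
  · nlinarith

/-- The identity plus a positive semidefinite operator does not shrink vectors, by Cauchy–Schwarz
applied to `⟪z, h⟫ ≥ ‖h‖²`. -/
lemma norm_add_rankTwo_ge {a : ℝ} (ha : 0 ≤ a) (u r h : H) :
    ‖h‖ ≤ ‖h + a • (⟪u, h⟫ • u + ⟪r, h⟫ • r)‖ := by
  set z := h + a • (⟪u, h⟫ • u + ⟪r, h⟫ • r) with hz
  have h2 : ⟪z, h⟫ = ‖h‖ ^ 2 + a * (⟪u, h⟫ ^ 2 + ⟪r, h⟫ ^ 2) := by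
    rw [hz]
    simp only [inner_add_left, real_inner_smul_left, real_inner_self_eq_norm_sq]; ring
  have h3 : ⟪z, h⟫ ≤ ‖z‖ * ‖h‖ := real_inner_le_norm z h
  rcases (norm_nonneg h).eq_or_lt with h0 | h0
  · rw [← h0]; positivity
  · have : 0 ≤ a * (⟪u, h⟫ ^ 2 + ⟪r, h⟫ ^ 2) := by positivity
    nlinarith

end RankTwo

namespace ReducedDynamics

variable {ι I H Y : Type*} [Fintype ι] [Fintype I]
  [NormedAddCommGroup H] [InnerProductSpace ℝ H] [NormedAddCommGroup Y] [InnerProductSpace ℝ Y]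
  {a σ Q : ℝ} {q : ι → H} {u r : H} {T : ℕ → H →L[ℝ] Y} {N : ℕ → I → Y}

/-- A bound for the size of the nonlinear part of one gradient step. -/
def nonlin (a Q : ℝ) (T : H →L[ℝ] Y) (N : I → Y) : ℝ := a * (Q ^ 2 * ‖T‖ ^ 2 + meanSq N)

lemma nonlin_nonneg (ha : 0 ≤ a) (T : H →L[ℝ] Y) (N : I → Y) : 0 ≤ nonlin a Q T N := by
  have := meanSq_nonneg N
  unfold nonlin; positivity

lemma norm_gram_le (ha : 0 ≤ a) (hσ : 0 ≤ σ) (hσ1 : σ ≤ 1) (hq : ∀ i, ‖q i‖ ≤ Q)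
    (T : H →L[ℝ] Y) (N : I → Y) (y : Y) :
    a * ‖secondMoment (fun i => T (q i)) y + σ ^ 2 • secondMoment N y‖
      ≤ nonlin a Q T N * ‖y‖ := by
  unfold nonlin
  rw [mul_assoc]
  gcongr
  have h1 := norm_secondMoment_le (fun i => T (q i)) y
  have h2 := norm_secondMoment_le N y
  have h3 : meanSq (fun i => T (q i)) ≤ (‖T‖ * Q) ^ 2 :=
    meanSq_le fun i => (T.le_opNorm _).trans (by gcongr; exact hq i)
  have h4 : ‖σ ^ 2 • secondMoment N y‖ ≤ meanSq N * ‖y‖ := by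
    rw [norm_smul, Real.norm_of_nonneg (by positivity)]
    have : σ ^ 2 ≤ 1 := pow_le_one₀ hσ hσ1
    nlinarith [norm_nonneg (secondMoment N y)]
  calc _ ≤ _ := norm_add_le _ _
    _ ≤ (‖T‖ * Q) ^ 2 * ‖y‖ + meanSq N * ‖y‖ := by
        gcongr
        exact h1.trans (by gcongr)
    _ = _ := by ring

lemma norm_secondMoment_signal_le (hq : ∀ i, ‖q i‖ ≤ Q) (h : H) :
    ‖secondMoment q h‖ ≤ Q ^ 2 * ‖h‖ :=
  (norm_secondMoment_le q h).trans (by gcongr; exact meanSq_le hq)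

/-- The deviation from the linearized step is cubic in the size of `(T, N)`: `nonlin` is quadratic
and is multiplied by one more factor `‖T t‖`. -/
lemma norm_step_sub_le (hd : ReducedDynamics a σ q u r T N) (ha : 0 ≤ a) (hσ : 0 ≤ σ) (hσ1 : σ ≤ 1)
    (hq : ∀ i, ‖q i‖ ≤ Q) (t : ℕ) (h : H) :
    ‖T (t + 1) h - (T t h + a • T t (⟪u, h⟫ • u + ⟪r, h⟫ • r))‖
      ≤ Q ^ 2 * nonlin a Q (T t) (N t) * ‖T t‖ * ‖h‖ := by
  rw [hd.step_T, sub_sub_cancel_left, norm_neg, norm_smul, Real.norm_of_nonneg ha]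
  refine (norm_gram_le ha hσ hσ1 hq _ _ _).trans ?_
  have h0 : 0 ≤ nonlin a Q (T t) (N t) := nonlin_nonneg ha _ _
  calc _ ≤ nonlin a Q (T t) (N t) * (‖T t‖ * (Q ^ 2 * ‖h‖)) := by
        gcongr
        exact ((T t).le_opNorm _).trans (by gcongr; exact norm_secondMoment_signal_le hq h)
    _ = _ := by ring

lemma opNorm_step_le (hd : ReducedDynamics a σ q u r T N) (ha : 0 ≤ a) (hσ : 0 ≤ σ) (hσ1 : σ ≤ 1)
    (hq : ∀ i, ‖q i‖ ≤ Q) (hur : ⟪u, r⟫ = 0) (hr : ‖r‖ ≤ ‖u‖) (t : ℕ) :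
    ‖T (t + 1)‖ ≤ (1 + a * ‖u‖ ^ 2 + Q ^ 2 * nonlin a Q (T t) (N t)) * ‖T t‖ := by
  have h0 : 0 ≤ nonlin a Q (T t) (N t) := nonlin_nonneg ha _ _
  refine ContinuousLinearMap.opNorm_le_bound _ (by positivity) fun h => ?_
  have h1 := hd.norm_step_sub_le ha hσ hσ1 hq t h
  have h2 : ‖T t h + a • T t (⟪u, h⟫ • u + ⟪r, h⟫ • r)‖ ≤ ‖T t‖ * ‖h‖
      + a * (‖T t‖ * (‖u‖ ^ 2 * ‖h‖)) := by
    refine (norm_add_le _ _).trans ?_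
    rw [norm_smul, Real.norm_of_nonneg ha]
    gcongr
    · exact (T t).le_opNorm _
    · exact ((T t).le_opNorm _).trans (by gcongr; exact norm_rankTwo_le hur hr h)
  have h3 := norm_le_norm_add_norm_sub' (T (t + 1) h) (T t h + a • T t (⟪u, h⟫ • u + ⟪r, h⟫ • r))
  linarith

/-- Centred noise is orthogonal to both class means, so the linear term does not act on it: the
growth factor is that of `opNorm_step_le` without `a * ‖u‖ ^ 2`. -/
lemma meanSq_step_le (hd : ReducedDynamics a σ q u r T N) (ha : 0 ≤ a) (hσ : 0 ≤ σ) (hσ1 : σ ≤ 1) (hQ : 1 ≤ Q)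
    (hq : ∀ i, ‖q i‖ ≤ Q) (t : ℕ) :
    √(meanSq (N (t + 1))) ≤ (1 + Q ^ 2 * nonlin a Q (T t) (N t)) * √(meanSq (N t)) := by
  have h0 : 0 ≤ nonlin a Q (T t) (N t) := nonlin_nonneg ha _ _
  have key : ∀ i, ‖N (t + 1) i‖ ≤ (1 + Q ^ 2 * nonlin a Q (T t) (N t)) * ‖N t i‖ := by
    intro i
    rw [hd.step_N]
    refine (norm_sub_le _ _).trans ?_
    rw [add_mul, one_mul]
    gcongr
    have hI : (1 : ℝ) ≤ Fintype.card I := by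
      exact_mod_cast Fintype.card_pos_iff.mpr ⟨i⟩
    have h1 : σ ^ 2 / Fintype.card I ≤ 1 :=
      (div_le_one (by linarith)).mpr ((pow_le_one₀ hσ hσ1).trans hI)
    have h2 := norm_gram_le ha hσ hσ1 hq (T t) (N t) (N t i)
    rw [norm_smul, Real.norm_of_nonneg (by positivity)]
    have h3 : 1 ≤ Q ^ 2 := one_le_pow₀ hQ
    set G := ‖secondMoment (fun i => T t (q i)) (N t i) + σ ^ 2 • secondMoment (N t) (N t i)‖
    have hG : 0 ≤ a * G := mul_nonneg ha (norm_nonneg _)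
    have hg : 0 ≤ nonlin a Q (T t) (N t) * ‖N t i‖ := by positivity
    calc a * (σ ^ 2 / Fintype.card I) * G = (σ ^ 2 / Fintype.card I) * (a * G) := by ring
      _ ≤ 1 * (a * G) := by gcongr
      _ ≤ _ := by nlinarith
  have h1 := meanSq_le_mul key
  calc _ ≤ √((1 + Q ^ 2 * nonlin a Q (T t) (N t)) ^ 2 * meanSq (N t)) := Real.sqrt_le_sqrt h1
    _ = _ := by rw [Real.sqrt_mul (by positivity), Real.sqrt_sq (by positivity)]

/-- A direct bound would lose a cubic error compared with the small constant `m`, which is fatal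
once `T t` has constant size. Instead, the linear term and the signal part of the cubic term are
written as `T t` applied to a vector not much shorter than `h`, which costs only a factor of `m`.
Only the part from the centred noise is a true additive error, and it carries the small factor
`meanSq (N t)`. -/
lemma norm_step_ge (hd : ReducedDynamics a σ q u r T N) (ha : 0 ≤ a) (hσ : 0 ≤ σ) (hσ1 : σ ≤ 1) (hQ : 0 ≤ Q)
    (hq : ∀ i, ‖q i‖ ≤ Q) {m : ℝ} (hm : 0 ≤ m) (t : ℕ) (hT : ∀ h, m * ‖h‖ ≤ ‖T t h‖) (h : H) :
    (m * (1 - Q ^ 2 * nonlin a Q (T t) (N t)) - a * meanSq (N t) * ‖T t‖ * Q ^ 2) * ‖h‖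
      ≤ ‖T (t + 1) h‖ := by
  set b := T t (secondMoment q h) with hb
  set w := (Fintype.card ι : ℝ)⁻¹ • ∑ i, ⟪T t (q i), b⟫ • q i with hw
  have hMq := norm_secondMoment_signal_le hq h
  have hbn : ‖b‖ ≤ ‖T t‖ * (Q ^ 2 * ‖h‖) := ((T t).le_opNorm _).trans (by gcongr)
  have hwn : ‖w‖ ≤ Q * (‖T t‖ * Q) * ‖b‖ := by
    rw [hw, norm_smul, Real.norm_of_nonneg (by positivity)]
    rcases isEmpty_or_nonempty ι with hι | hι
    · simp; positivity
    have hcard : (0 : ℝ) < Fintype.card ι := by exact_mod_cast Fintype.card_pos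
    rw [inv_mul_le_iff₀ hcard]
    refine (norm_sum_le _ _).trans ?_
    calc _ ≤ ∑ _i : ι, Q * (‖T t‖ * Q) * ‖b‖ := Finset.sum_le_sum fun i _ => by
          rw [norm_smul]
          have h1 := norm_inner_le_norm (𝕜 := ℝ) (T t (q i)) b
          have h2 : ‖T t (q i)‖ ≤ ‖T t‖ * Q :=
            ((T t).le_opNorm _).trans (by gcongr; exact hq i)
          calc _ ≤ (‖T t (q i)‖ * ‖b‖) * Q := by gcongr; exact hq i
            _ ≤ ((‖T t‖ * Q) * ‖b‖) * Q := by gcongr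
            _ = _ := by ring
      _ = _ := by simp
  have hwn' : a * ‖w‖ ≤ Q ^ 2 * nonlin a Q (T t) (N t) * ‖h‖ := by
    have : ‖w‖ ≤ Q * (‖T t‖ * Q) * (‖T t‖ * (Q ^ 2 * ‖h‖)) := hwn.trans (by gcongr)
    have h2 := meanSq_nonneg (N t)
    calc a * ‖w‖ ≤ a * (Q * (‖T t‖ * Q) * (‖T t‖ * (Q ^ 2 * ‖h‖))) := by gcongr
      _ = Q ^ 2 * (a * (Q ^ 2 * ‖T t‖ ^ 2 + 0)) * ‖h‖ := by ring
      _ ≤ _ := by unfold nonlin; gcongr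
  have hstep : T (t + 1) h = T t (h + a • (⟪u, h⟫ • u + ⟪r, h⟫ • r) - a • w)
      - (a * σ ^ 2) • secondMoment (N t) b := by
    rw [hd.step_T, ← hb, secondMoment_map, ← hw]
    simp only [map_add, map_sub, map_smul, smul_add, smul_smul]
    abel
  have h1 : (1 - Q ^ 2 * nonlin a Q (T t) (N t)) * ‖h‖
      ≤ ‖h + a • (⟪u, h⟫ • u + ⟪r, h⟫ • r) - a • w‖ := by
    have e1 := norm_add_rankTwo_ge ha u r h
    have e2 := norm_sub_norm_le (h + a • (⟪u, h⟫ • u + ⟪r, h⟫ • r)) (a • w)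
    rw [norm_smul a w, Real.norm_of_nonneg ha] at e2
    linarith
  have h2 : ‖(a * σ ^ 2) • secondMoment (N t) b‖ ≤ a * meanSq (N t) * ‖T t‖ * Q ^ 2 * ‖h‖ := by
    rw [norm_smul, Real.norm_of_nonneg (by positivity)]
    have e1 := norm_secondMoment_le (N t) b
    have e2 : σ ^ 2 ≤ 1 := pow_le_one₀ hσ hσ1
    have e3 := meanSq_nonneg (N t)
    calc _ ≤ (a * 1) * (meanSq (N t) * (‖T t‖ * (Q ^ 2 * ‖h‖))) := by
          gcongr; exact e1.trans (by gcongr)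
      _ = _ := by ring
  have h3 := hT (h + a • (⟪u, h⟫ • u + ⟪r, h⟫ • r) - a • w)
  rw [hstep]
  have h4 := norm_sub_norm_le (T t (h + a • (⟪u, h⟫ • u + ⟪r, h⟫ • r) - a • w))
    ((a * σ ^ 2) • secondMoment (N t) b)
  have h5 := mul_le_mul_of_nonneg_left h1 hm
  linarith

end ReducedDynamics

/-! ### Growth and conditioning while the nonlinear part is small. -/

namespace ReducedDynamics

variable {ι I H Y : Type*} [Fintype ι] [Fintype I]
  [NormedAddCommGroup H] [InnerProductSpace ℝ H] [NormedAddCommGroup Y] [InnerProductSpace ℝ Y]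
  {a σ Q s L : ℝ} {q : ι → H} {u r : H} {T : ℕ → H →L[ℝ] Y} {N : ℕ → I → Y}

/-- The assumptions on the constants and on the initialization under which the dynamics is
controlled up to the time where it reaches constant size: `s` is the scale of the initialization
and `L` a large constant. -/
structure Controlled (a σ Q s L : ℝ) (q : ι → H) (u r : H) (T : ℕ → H →L[ℝ] Y)
    (N : ℕ → I → Y) : Prop where
  dyn : ReducedDynamics a σ q u r T N
  a_pos : 0 < a
  σ_nonneg : 0 ≤ σ
  σ_le_one : σ ≤ 1
  s_pos : 0 < s
  one_le_Q : 1 ≤ Q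
  norm_q_le : ∀ i, ‖q i‖ ≤ Q
  inner_u_r : ⟪u, r⟫ = 0
  norm_r_le : ‖r‖ ≤ ‖u‖
  one_le_norm_u : 1 ≤ ‖u‖
  -- With `‖T‖ ≤ 6 y` and `√(meanSq N) ≤ 6 s ≤ 6 y`, `nonlin` is at most `36 a (Q² + 1) y²`. The
  -- factor `7 = 6 + 1` is what `norm_ge` needs: `6` for the noise term and `1` for the signal term.
  -- In `L_mul_ge`, `2 * a` is a lower bound for `λ² - 1`, as `‖u‖ ≥ 1`.
  L_ge : 7 * Q ^ 2 * (36 * a * (Q ^ 2 + 1)) ≤ L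
  L_mul_ge : 7 * Q ^ 2 * (36 * a * (Q ^ 2 + 1)) ≤ L * (2 * a)
  opNorm_zero_le : ‖T 0‖ ≤ 3 * s
  meanSq_zero_le : √(meanSq (N 0)) ≤ 3 * s
  norm_zero_ge : ∀ h, s / 2 * ‖h‖ ≤ ‖T 0 h‖

namespace Controlled

lemma one_le_rate (hc : Controlled a σ Q s L q u r T N) : 1 ≤ 1 + a * ‖u‖ ^ 2 := by
  have := hc.a_pos
  nlinarith [sq_nonneg ‖u‖, mul_nonneg this.le (sq_nonneg ‖u‖)]

lemma L_pos (hc : Controlled a σ Q s L q u r T N) : 0 < L := by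
  have := hc.a_pos
  have h1 := hc.one_le_Q
  have h2 := hc.L_ge
  have : 0 < 7 * Q ^ 2 * (36 * a * (Q ^ 2 + 1)) := by positivity
  linarith

lemma L_mul_rate_ge (hc : Controlled a σ Q s L q u r T N) :
    7 * Q ^ 2 * (36 * a * (Q ^ 2 + 1)) ≤ L * ((1 + a * ‖u‖ ^ 2) ^ 2 - 1) := by
  refine hc.L_mul_ge.trans ?_
  have h1 : 1 ≤ ‖u‖ ^ 2 := one_le_pow₀ hc.one_le_norm_u
  have := hc.a_pos
  refine mul_le_mul_of_nonneg_left ?_ hc.L_pos.le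
  nlinarith [mul_le_mul_of_nonneg_left h1 this.le, sq_nonneg (a * ‖u‖ ^ 2)]

lemma sq_mono (hc : Controlled a σ Q s L q u r T N) (t : ℕ) :
    L * (s * (1 + a * ‖u‖ ^ 2) ^ t) ^ 2 ≤ L * (s * (1 + a * ‖u‖ ^ 2) ^ (t + 1)) ^ 2 := by
  have h1 := hc.one_le_rate
  have h2 := hc.L_pos
  have h3 := hc.s_pos
  gcongr _ * (_ * ?_) ^ 2
  exact pow_le_pow_right₀ h1 (Nat.le_succ t)

lemma nonlin_le_of (hc : Controlled a σ Q s L q u r T N) {t : ℕ} {y : ℝ} (hsy : s ≤ y)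
    (h1 : ‖T t‖ ≤ 6 * y) (h2 : √(meanSq (N t)) ≤ 6 * s) :
    nonlin a Q (T t) (N t) ≤ 36 * a * (Q ^ 2 + 1) * y ^ 2 := by
  have ha := hc.a_pos
  have hs := hc.s_pos
  have h3 : meanSq (N t) ≤ (6 * y) ^ 2 := by
    rw [← Real.sq_sqrt (meanSq_nonneg (N t))]
    gcongr
    linarith
  unfold nonlin
  calc _ ≤ a * (Q ^ 2 * (6 * y) ^ 2 + (6 * y) ^ 2) := by gcongr
    _ = _ := by ring

lemma le_scale (hc : Controlled a σ Q s L q u r T N) (t : ℕ) :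
    s ≤ s * (1 + a * ‖u‖ ^ 2) ^ t :=
  le_mul_of_one_le_right hc.s_pos.le (one_le_pow₀ hc.one_le_rate)

/-- The relative errors of the steps form a geometric sum dominated by its last term. The correction
factor `1 + L y²` encodes this: its increment `L (λ² - 1) y²` per step pays for the nonlinear term.
The centred noise gains only this bounded factor and stays at scale `s`. -/
lemma growth (hc : Controlled a σ Q s L q u r T N) (t : ℕ)
    (ht : L * (s * (1 + a * ‖u‖ ^ 2) ^ t) ^ 2 ≤ 1) :
    ‖T t‖ ≤ 3 * (s * (1 + a * ‖u‖ ^ 2) ^ t) * (1 + L * (s * (1 + a * ‖u‖ ^ 2) ^ t) ^ 2) ∧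
    √(meanSq (N t)) ≤ 3 * s * (1 + L * (s * (1 + a * ‖u‖ ^ 2) ^ t) ^ 2) := by
  have hs := hc.s_pos
  have hL := hc.L_pos
  have ha := hc.a_pos
  have hlam := hc.one_le_rate
  induction t with
  | zero =>
    have h1 := hc.opNorm_zero_le
    have h2 := hc.meanSq_zero_le
    simp only [pow_zero, mul_one]
    have : 0 ≤ 3 * s * (L * s ^ 2) := by positivity
    constructor <;> linarith
  | succ t ih =>
    obtain ⟨ih1, ih2⟩ := ih ((hc.sq_mono t).trans ht)
    have hle := (hc.sq_mono t).trans ht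
    have hsy := hc.le_scale t
    have hLr := hc.L_mul_rate_ge
    have hstep1 := hc.dyn.opNorm_step_le ha.le hc.σ_nonneg hc.σ_le_one hc.norm_q_le hc.inner_u_r hc.norm_r_le t
    have hstep2 := hc.dyn.meanSq_step_le ha.le hc.σ_nonneg hc.σ_le_one hc.one_le_Q hc.norm_q_le t
    rw [pow_succ (1 + a * ‖u‖ ^ 2) t, ← mul_assoc s]
    set lam := 1 + a * ‖u‖ ^ 2
    set y := s * lam ^ t
    set D := 36 * a * (Q ^ 2 + 1)
    have hy : 0 < y := by linarith
    have hD : 0 < D := by positivity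
    have hg : nonlin a Q (T t) (N t) ≤ D * y ^ 2 := by
      refine hc.nonlin_le_of hsy ?_ ?_ <;> nlinarith
    clear_value y D
    -- As `L y² ≤ 1`, the cross term is at most `Q² D y²`, so the excess is at most `2 Q² D y²`,
    -- well within the budget `L (λ² - 1) y² ≥ 7 Q² D y²`.
    have key : (1 + Q ^ 2 * (D * y ^ 2)) * (1 + L * y ^ 2) ≤ 1 + L * (y * lam) ^ 2 := by
      have h1 : 0 ≤ Q ^ 2 * D * y ^ 2 := by positivity
      have h2 : 7 * (Q ^ 2 * D * y ^ 2) ≤ L * (lam ^ 2 - 1) * y ^ 2 := by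
        calc _ = (7 * Q ^ 2 * D) * y ^ 2 := by ring
          _ ≤ _ := by gcongr
      nlinarith [mul_le_mul_of_nonneg_left hle h1]
    have hQg : Q ^ 2 * nonlin a Q (T t) (N t) ≤ Q ^ 2 * (D * y ^ 2) := by gcongr
    have hpos : 0 ≤ Q ^ 2 * (D * y ^ 2) := by positivity
    constructor
    · calc ‖T (t + 1)‖ ≤ (lam + Q ^ 2 * (D * y ^ 2)) * ‖T t‖ := hstep1.trans (by gcongr)
        _ ≤ (lam * (1 + Q ^ 2 * (D * y ^ 2))) * (3 * y * (1 + L * y ^ 2)) := by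
            gcongr
            nlinarith
        _ = 3 * (y * lam) * ((1 + Q ^ 2 * (D * y ^ 2)) * (1 + L * y ^ 2)) := by ring
        _ ≤ _ := by gcongr
    · calc √(meanSq (N (t + 1))) ≤ (1 + Q ^ 2 * (D * y ^ 2)) * √(meanSq (N t)) :=
            hstep2.trans (by gcongr)
        _ ≤ (1 + Q ^ 2 * (D * y ^ 2)) * (3 * s * (1 + L * y ^ 2)) := by gcongr
        _ = 3 * s * ((1 + Q ^ 2 * (D * y ^ 2)) * (1 + L * y ^ 2)) := by ring
        _ ≤ _ := by gcongr

lemma opNorm_le (hc : Controlled a σ Q s L q u r T N) (t : ℕ)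
    (ht : L * (s * (1 + a * ‖u‖ ^ 2) ^ t) ^ 2 ≤ 1) :
    ‖T t‖ ≤ 6 * (s * (1 + a * ‖u‖ ^ 2) ^ t) := by
  have := (hc.growth t ht).1
  have hy := hc.s_pos.trans_le (hc.le_scale t)
  nlinarith

lemma sqrt_meanSq_le (hc : Controlled a σ Q s L q u r T N) (t : ℕ)
    (ht : L * (s * (1 + a * ‖u‖ ^ 2) ^ t) ^ 2 ≤ 1) :
    √(meanSq (N t)) ≤ 6 * s := by
  have := (hc.growth t ht).2
  have hy := hc.s_pos
  nlinarith

lemma nonlin_le (hc : Controlled a σ Q s L q u r T N) (t : ℕ)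
    (ht : L * (s * (1 + a * ‖u‖ ^ 2) ^ t) ^ 2 ≤ 1) :
    nonlin a Q (T t) (N t) ≤ 36 * a * (Q ^ 2 + 1) * (s * (1 + a * ‖u‖ ^ 2) ^ t) ^ 2 :=
  hc.nonlin_le_of (hc.le_scale t) (hc.opNorm_le t ht) (hc.sqrt_meanSq_le t ht)

lemma norm_step_sub_le' (hc : Controlled a σ Q s L q u r T N) (t : ℕ)
    (ht : L * (s * (1 + a * ‖u‖ ^ 2) ^ t) ^ 2 ≤ 1) (h : H) :
    ‖T (t + 1) h - (T t h + a • T t (⟪u, h⟫ • u + ⟪r, h⟫ • r))‖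
      ≤ (7 * Q ^ 2 * (36 * a * (Q ^ 2 + 1))) * (s * (1 + a * ‖u‖ ^ 2) ^ t) ^ 2
        * (s * (1 + a * ‖u‖ ^ 2) ^ t) * ‖h‖ := by
  have ha := hc.a_pos
  have h1 := hc.opNorm_le t ht
  have h2 := hc.nonlin_le t ht
  have hy := hc.s_pos.trans_le (hc.le_scale t)
  refine (hc.dyn.norm_step_sub_le ha.le hc.σ_nonneg hc.σ_le_one hc.norm_q_le t h).trans ?_
  set y := s * (1 + a * ‖u‖ ^ 2) ^ t
  have h0 := nonlin_nonneg (Q := Q) ha.le (T t) (N t)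
  calc _ ≤ Q ^ 2 * (36 * a * (Q ^ 2 + 1) * y ^ 2) * (6 * y) * ‖h‖ := by gcongr
    _ = 6 * (Q ^ 2 * (36 * a * (Q ^ 2 + 1)) * y ^ 2 * y * ‖h‖) := by ring
    _ ≤ 7 * (Q ^ 2 * (36 * a * (Q ^ 2 + 1)) * y ^ 2 * y * ‖h‖) := by gcongr; norm_num
    _ = _ := by ring

/-- Since `r` is orthogonal to `u`, the linearized step multiplies `T t u` by exactly `λ`; the loss
`L y²` absorbs the cubic errors. -/
lemma norm_top_ge (hc : Controlled a σ Q s L q u r T N) (t : ℕ)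
    (ht : L * (s * (1 + a * ‖u‖ ^ 2) ^ t) ^ 2 ≤ 1) :
    (s * (1 + a * ‖u‖ ^ 2) ^ t) * (1 / 2 - L * (s * (1 + a * ‖u‖ ^ 2) ^ t) ^ 2) * ‖u‖
      ≤ ‖T t u‖ := by
  have hL := hc.L_pos
  induction t with
  | zero =>
    have h1 := hc.norm_zero_ge u
    have hs := hc.s_pos
    simp only [pow_zero, mul_one]
    have : 0 ≤ s * (L * s ^ 2) * ‖u‖ := by positivity
    linarith
  | succ t ih =>
    have hle := (hc.sq_mono t).trans ht
    have ih := ih hle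
    have hy := hc.s_pos.trans_le (hc.le_scale t)
    have hLr := hc.L_mul_rate_ge
    have hlam := hc.one_le_rate
    have hstep := hc.norm_step_sub_le' t hle u
    have hru : ⟪r, u⟫ = 0 := by rw [real_inner_comm]; exact hc.inner_u_r
    have e : T t u + a • T t (⟪u, u⟫ • u + ⟪r, u⟫ • r) = (1 + a * ‖u‖ ^ 2) • T t u := by
      rw [hru, real_inner_self_eq_norm_sq, zero_smul, add_zero, map_smul, smul_smul, add_smul,
        one_smul]
    rw [e] at hstep
    rw [pow_succ (1 + a * ‖u‖ ^ 2) t, ← mul_assoc s]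
    set lam := 1 + a * ‖u‖ ^ 2
    set y := s * lam ^ t
    set D := 7 * Q ^ 2 * (36 * a * (Q ^ 2 + 1))
    have h1 := norm_sub_norm_le (lam • T t u) (T (t + 1) u)
    rw [norm_sub_rev, norm_smul, Real.norm_of_nonneg (by linarith : 0 ≤ lam)] at h1
    have h2 : D * y ^ 2 * y * ‖u‖ ≤ lam * y * (L * (lam ^ 2 - 1) * y ^ 2) * ‖u‖ := by
      have h0 : 0 ≤ L * (lam ^ 2 - 1) := mul_nonneg hL.le (by nlinarith)
      calc D * y ^ 2 * y * ‖u‖ ≤ L * (lam ^ 2 - 1) * y ^ 2 * (1 * y) * ‖u‖ := by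
            rw [one_mul]; gcongr
        _ ≤ L * (lam ^ 2 - 1) * y ^ 2 * (lam * y) * ‖u‖ := by gcongr
        _ = _ := by ring
    have h3 := mul_le_mul_of_nonneg_left ih (by linarith : 0 ≤ lam)
    calc _ = lam * (y * (1 / 2 - L * y ^ 2) * ‖u‖)
          - lam * y * (L * (lam ^ 2 - 1) * y ^ 2) * ‖u‖ := by ring
      _ ≤ _ := by linarith

/-- The linearized step fixes the image of a vector orthogonal to `u` and `r`, so only cubic errors
accumulate. This keeps the rest of the subclass feature from cancelling its growing component along
`u`. -/
lemma norm_kernel_le (hc : Controlled a σ Q s L q u r T N) {h : H} (hu : ⟪u, h⟫ = 0)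
    (hr : ⟪r, h⟫ = 0) (t : ℕ) (ht : L * (s * (1 + a * ‖u‖ ^ 2) ^ t) ^ 2 ≤ 1) :
    ‖T t h‖ ≤ (3 * s + L * (s * (1 + a * ‖u‖ ^ 2) ^ t) ^ 2 * (s * (1 + a * ‖u‖ ^ 2) ^ t))
      * ‖h‖ := by
  have hL := hc.L_pos
  induction t with
  | zero =>
    have h1 := (T 0).le_of_opNorm_le hc.opNorm_zero_le h
    have hs := hc.s_pos
    simp only [pow_zero, mul_one]
    have : 0 ≤ L * s ^ 2 * s * ‖h‖ := by positivity
    linarith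
  | succ t ih =>
    have hle := (hc.sq_mono t).trans ht
    have ih := ih hle
    have hy := hc.s_pos.trans_le (hc.le_scale t)
    have hLr := hc.L_mul_rate_ge
    have hlam := hc.one_le_rate
    have hstep := hc.norm_step_sub_le' t hle h
    simp only [hu, hr, zero_smul, add_zero, map_zero, smul_zero] at hstep
    rw [pow_succ (1 + a * ‖u‖ ^ 2) t, ← mul_assoc s]
    set lam := 1 + a * ‖u‖ ^ 2
    set y := s * lam ^ t
    set D := 7 * Q ^ 2 * (36 * a * (Q ^ 2 + 1))
    have h1 := norm_le_norm_add_norm_sub' (T (t + 1) h) (T t h)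
    have h2 : D * y ^ 2 * y * ‖h‖ ≤ L * (lam ^ 2 - 1) * y ^ 2 * y * ‖h‖ := by gcongr
    -- The claimed bound lets the cubic term grow by `λ³`, whereas the step only needs `λ²`.
    have h3 : L * y ^ 2 * y * ‖h‖ * lam ^ 2 ≤ L * y ^ 2 * y * ‖h‖ * lam ^ 3 := by
      exact mul_le_mul_of_nonneg_left (pow_le_pow_right₀ hlam (by norm_num)) (by positivity)
    calc ‖T (t + 1) h‖ ≤ _ := h1
      _ ≤ (3 * s + L * y ^ 2 * y) * ‖h‖ + L * (lam ^ 2 - 1) * y ^ 2 * y * ‖h‖ := by linarith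
      _ = 3 * s * ‖h‖ + L * y ^ 2 * y * ‖h‖ * lam ^ 2 := by ring
      _ ≤ 3 * s * ‖h‖ + L * y ^ 2 * y * ‖h‖ * lam ^ 3 := by linarith
      _ = _ := by ring

/-- Injectivity survives at the scale `s` even when `‖T t‖` is of order `y`, which is much larger.
In `norm_step_ge` the additive error is of order `s² y ≤ s y²`, hence of relative order `y²` like
the multiplicative one. The threshold `1 / 2` keeps the lower constant nonnegative. -/
lemma norm_ge (hc : Controlled a σ Q s L q u r T N) (t : ℕ)
    (ht : L * (s * (1 + a * ‖u‖ ^ 2) ^ t) ^ 2 ≤ 1 / 2) (h : H) :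
    s * (1 / 2 - L * (s * (1 + a * ‖u‖ ^ 2) ^ t) ^ 2) * ‖h‖ ≤ ‖T t h‖ := by
  have hL := hc.L_pos
  have hs := hc.s_pos
  induction t generalizing h with
  | zero =>
    have h1 := hc.norm_zero_ge h
    simp only [pow_zero, mul_one]
    have : 0 ≤ s * (L * s ^ 2) * ‖h‖ := by positivity
    linarith
  | succ t ih =>
    have hle := (hc.sq_mono t).trans ht
    have ih := ih hle
    have hsy := hc.le_scale t
    have hy := hs.trans_le hsy
    have hLr := hc.L_mul_rate_ge
    have ha := hc.a_pos
    have hQ := hc.one_le_Q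
    have h1 := hc.opNorm_le t (hle.trans (by norm_num))
    have h2 := hc.nonlin_le t (hle.trans (by norm_num))
    have h3 := hc.sqrt_meanSq_le t (hle.trans (by norm_num))
    have hm : meanSq (N t) ≤ (6 * s) ^ 2 := by
      rw [← Real.sq_sqrt (meanSq_nonneg (N t))]; gcongr
    have hm0 := meanSq_nonneg (N t)
    rw [pow_succ (1 + a * ‖u‖ ^ 2) t, ← mul_assoc s]
    set lam := 1 + a * ‖u‖ ^ 2
    set y := s * lam ^ t
    have hstep := hc.dyn.norm_step_ge ha.le hc.σ_nonneg hc.σ_le_one (by linarith) hc.norm_q_le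
      (m := s * (1 / 2 - L * y ^ 2)) (mul_nonneg hs.le (by linarith)) t ih h
    refine le_trans (mul_le_mul_of_nonneg_right ?_ (norm_nonneg h)) hstep
    set D := 36 * a * (Q ^ 2 + 1) with hD
    have hD0 : 0 < D := by positivity
    have e1 : a * meanSq (N t) * ‖T t‖ * Q ^ 2 ≤ s * (6 * Q ^ 2 * D * y ^ 2) := by
      calc _ ≤ a * (6 * s) ^ 2 * (6 * y) * Q ^ 2 := by gcongr
        _ = s * (6 * Q ^ 2 * (36 * a * (0 + 1)) * (s * y)) := by ring
        _ ≤ s * (6 * Q ^ 2 * (36 * a * (Q ^ 2 + 1)) * (y * y)) := by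
            gcongr
            positivity
        _ = _ := by rw [hD]; ring
    have e2 : Q ^ 2 * nonlin a Q (T t) (N t) ≤ Q ^ 2 * D * y ^ 2 := by
      calc _ ≤ Q ^ 2 * (D * y ^ 2) := by gcongr
        _ = _ := by ring
    have e3 : s * (1 / 2 - L * y ^ 2) * (Q ^ 2 * nonlin a Q (T t) (N t))
        ≤ s * (Q ^ 2 * D * y ^ 2) := by
      have : 0 ≤ Q ^ 2 * nonlin a Q (T t) (N t) :=
        mul_nonneg (by positivity) (nonlin_nonneg ha.le _ _)
      have e4 : 1 / 2 - L * y ^ 2 ≤ 1 := by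
        have : 0 ≤ L * y ^ 2 := by positivity
        linarith
      calc _ ≤ s * 1 * (Q ^ 2 * nonlin a Q (T t) (N t)) := by gcongr
        _ = s * (Q ^ 2 * nonlin a Q (T t) (N t)) := by ring
        _ ≤ _ := by gcongr
    have e5 : s * (7 * Q ^ 2 * D * y ^ 2) ≤ s * (L * (lam ^ 2 - 1) * y ^ 2) := by gcongr
    linear_combination e1 + e3 + e5

end Controlled

end ReducedDynamics

/-! ### Dual functionals and the exit time. -/

/-- A functional on the domain of an injective operator is realized by pairing with a vector of
the codomain, with control of its norm. -/
lemma exists_inner_eq_of_antilipschitz {H Y : Type*} [NormedAddCommGroup H] [InnerProductSpace ℝ H]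
    [FiniteDimensional ℝ H] [NormedAddCommGroup Y] [InnerProductSpace ℝ Y] [CompleteSpace Y]
    (T : H →L[ℝ] Y) {m : ℝ} (hm : 0 < m) (hT : ∀ h, m * ‖h‖ ≤ ‖T h‖) (l : H) :
    ∃ β : Y, (∀ h, ⟪β, T h⟫ = ⟪l, h⟫) ∧ ‖β‖ ≤ ‖l‖ / m := by
  have : CompleteSpace H := FiniteDimensional.complete ℝ H
  -- The vector `β` is sought in the range of `T`, as `T g` with `T* T g = l`. The norm bound
  -- follows from `‖T g‖² = ⟪l, g⟫ ≤ ‖l‖ ‖T g‖ / m`.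
  set S : H →ₗ[ℝ] H := ((ContinuousLinearMap.adjoint T).comp T).toLinearMap with hS
  have hin : Function.Injective S := by
    rw [← LinearMap.ker_eq_bot, LinearMap.ker_eq_bot']
    intro h hh
    have h1 : ⟪S h, h⟫ = ‖T h‖ ^ 2 := by
      simp [hS, ContinuousLinearMap.adjoint_inner_left]
    rw [hh, inner_zero_left] at h1
    have h2 : ‖T h‖ = 0 := by
      rw [eq_comm] at h1
      exact pow_eq_zero_iff (two_ne_zero) |>.mp h1
    have h3 := hT h
    rw [h2] at h3
    have : ‖h‖ ≤ 0 := by nlinarith [norm_nonneg h]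
    exact norm_le_zero_iff.mp this
  obtain ⟨g, hg⟩ := (LinearMap.injective_iff_surjective.mp hin) l
  have hβ : ∀ h, ⟪T g, T h⟫ = ⟪l, h⟫ := by
    intro h
    rw [← hg]
    simp [hS, ContinuousLinearMap.adjoint_inner_left]
  refine ⟨T g, hβ, ?_⟩
  rw [le_div_iff₀ hm]
  have h1 : ‖T g‖ ^ 2 = ⟪l, g⟫ := by rw [← hβ, real_inner_self_eq_norm_sq]
  have h2 := real_inner_le_norm l g
  have h3 := hT g
  rcases (norm_nonneg (T g)).eq_or_lt with h0 | h0
  · rw [← h0]; simp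
  · have : ‖T g‖ * (‖T g‖ * m) ≤ ‖T g‖ * ‖l‖ := by
      calc _ = m * ‖T g‖ ^ 2 := by ring
        _ ≤ m * (‖l‖ * ‖g‖) := by rw [h1]; gcongr
        _ = ‖l‖ * (m * ‖g‖) := by ring
        _ ≤ ‖l‖ * ‖T g‖ := by gcongr
        _ = _ := by ring
    exact le_of_mul_le_mul_left this h0

namespace ReducedDynamics.Controlled

variable {ι I H Y : Type*} [Fintype ι] [Fintype I]
  [NormedAddCommGroup H] [InnerProductSpace ℝ H] [NormedAddCommGroup Y] [InnerProductSpace ℝ Y]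
  {a σ Q s L : ℝ} {q : ι → H} {u r : H} {T : ℕ → H →L[ℝ] Y} {N : ℕ → I → Y}

/-- At a suitable logarithmic time, the image of a vector with a component along the leading
direction has constant size while the operator is still injective at the scale of the
initialization. -/
lemma exists_time (hc : Controlled a σ Q s L q u r T N) {κ κ₀ c₀ Λ : ℝ} {k : H}
    (hc₀ : 0 < c₀) (hc₁ : c₀ ≤ 1) (hL : L * c₀ ^ 2 ≤ 1 / 4) (hLκ : L * c₀ ^ 2 ≤ κ₀ / 8)
    (hκ₀ : 0 < κ₀) (hκ : κ₀ ≤ |κ|) (hΛ : 1 + a * ‖u‖ ^ 2 ≤ Λ) (hs : s ≤ c₀)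
    (hs' : 3 * s ≤ κ₀ * c₀ / (16 * Λ)) (hk : ‖k‖ ≤ 1) (huk : ⟪u, k⟫ = 0) (hrk : ⟪r, k⟫ = 0) :
    ∃ t : ℕ, t * Real.log (1 + a * ‖u‖ ^ 2) ≤ Real.log (1 / s) ∧
      κ₀ * c₀ / (16 * Λ) ≤ ‖T t (κ • u + k)‖ ∧ ∀ h, s / 4 * ‖h‖ ≤ ‖T t h‖ := by
  have hs0 := hc.s_pos
  have hu := hc.one_le_norm_u
  have hL0 := hc.L_pos
  have hlam1 : 1 < 1 + a * ‖u‖ ^ 2 := by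
    have := hc.a_pos
    have : 0 < a * ‖u‖ ^ 2 := by positivity
    linarith
  -- The last time with `s λ ^ t ≤ c₀`. By maximality `s λ ^ t` exceeds `c₀ / λ ≥ c₀ / Λ`.
  obtain ⟨t, ht1, ht2⟩ := exists_nat_pow_near (x := c₀ / s) ((one_le_div hs0).mpr hs) hlam1
  refine ⟨t, ?_, ?_, ?_⟩
  · rw [← Real.log_pow]
    apply Real.log_le_log (by positivity)
    exact ht1.trans (by gcongr)
  all_goals
    have hy1 : s * (1 + a * ‖u‖ ^ 2) ^ t ≤ c₀ := by
      rw [le_div_iff₀ hs0] at ht1; linarith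
    have hy0 := hs0.trans_le (hc.le_scale t)
    have hx : L * (s * (1 + a * ‖u‖ ^ 2) ^ t) ^ 2 ≤ L * c₀ ^ 2 := by gcongr
  · have hy2 : c₀ / Λ ≤ s * (1 + a * ‖u‖ ^ 2) ^ t := by
      rw [pow_succ, div_lt_iff₀ hs0] at ht2
      rw [div_le_iff₀ (by linarith)]
      nlinarith
    have h1 := hc.norm_top_ge t (by linarith)
    have h2 := hc.norm_kernel_le huk hrk t (by linarith)
    set y := s * (1 + a * ‖u‖ ^ 2) ^ t
    rw [map_add, map_smul]
    have h3 : ‖κ • T t u‖ - ‖T t k‖ ≤ ‖κ • T t u + T t k‖ := by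
      have := norm_sub_norm_le (κ • T t u) (-T t k)
      rwa [norm_neg, sub_neg_eq_add] at this
    rw [norm_smul, Real.norm_eq_abs] at h3
    have hΛ0 : 0 < Λ := by linarith
    -- The component along `u` contributes at least `κ₀ y / 4` and the orthogonal part at most `3 s
    -- + κ₀ y / 8`. The remaining `κ₀ y / 8` is at least twice the claimed bound, and `3 s` uses up
    -- at most one half of that.
    have h4 : κ₀ * (y / 4) ≤ |κ| * ‖T t u‖ := by
      gcongr
      calc y / 4 = y * (1 / 2 - 1 / 4) * 1 := by ring
        _ ≤ y * (1 / 2 - L * y ^ 2) * ‖u‖ := by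
            have : 1 / 4 ≤ 1 / 2 - L * y ^ 2 := by linarith
            have : 0 ≤ 1 / 2 - L * y ^ 2 := by linarith
            gcongr
            linarith
        _ ≤ _ := h1
    have h5 : ‖T t k‖ ≤ 3 * s + κ₀ / 8 * y := by
      calc _ ≤ (3 * s + L * y ^ 2 * y) * 1 := h2.trans (by gcongr)
        _ ≤ _ := by rw [mul_one]; gcongr; linarith
    have h6 : κ₀ / 8 * (c₀ / Λ) ≤ κ₀ / 8 * y := by gcongr
    have h7 : κ₀ / 8 * (c₀ / Λ) = 2 * (κ₀ * c₀ / (16 * Λ)) := by field_simp; ring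
    linarith
  · intro h
    refine le_trans ?_ (hc.norm_ge t (by linarith) h)
    gcongr
    nlinarith

end ReducedDynamics.Controlled

/-! ### Extended inputs and the gradient of the loss. -/

namespace Param

variable {p d : ℕ}

/-- The bilinear map `(z, Θ) ↦ Θ z` on extended inputs `z ∈ ℝ^{d+1}`. -/
def actBilin (p d : ℕ) : Vec (d + 1) →ₗ[ℝ] Param p d →ₗ[ℝ] Vec p :=
  LinearMap.mk₂ ℝ (fun z Θ => WithLp.toLp 2 fun i => ∑ j, z j * Θ (i, j))
    (fun z z' Θ => by ext i; simp [add_mul, Finset.sum_add_distrib])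
    (fun c z Θ => by ext i; simp [Finset.mul_sum, mul_assoc])
    (fun z Θ Θ' => by ext i; simp [mul_add, Finset.sum_add_distrib])
    (fun c z Θ => by ext i; simp [Finset.mul_sum, mul_left_comm])

/-- The linear map `z ↦ Θ z` on extended inputs `z ∈ ℝ^{d+1}`. -/
def act (Θ : Param p d) : Vec (d + 1) →L[ℝ] Vec p :=
  ((actBilin p d).flip Θ).toContinuousLinearMap

/-- The linear map `Θ ↦ Θ z`. -/
def evalAt (z : Vec (d + 1)) : Param p d →L[ℝ] Vec p :=
  (actBilin p d z).toContinuousLinearMap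

lemma evalAt_apply (z : Vec (d + 1)) (Θ : Param p d) : evalAt z Θ = Θ.act z := rfl

lemma act_apply (Θ : Param p d) (z : Vec (d + 1)) (i : Fin p) :
    Θ.act z i = ∑ j, z j * Θ (i, j) := rfl

lemma act_add (Θ Θ' : Param p d) (z : Vec (d + 1)) : (Θ + Θ').act z = Θ.act z + Θ'.act z :=
  map_add (evalAt z) Θ Θ'

lemma act_sub (Θ Θ' : Param p d) (z : Vec (d + 1)) : (Θ - Θ').act z = Θ.act z - Θ'.act z :=
  map_sub (evalAt z) Θ Θ'

lemma act_smul (c : ℝ) (Θ : Param p d) (z : Vec (d + 1)) : (c • Θ).act z = c • Θ.act z :=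
  map_smul (evalAt z) c Θ

lemma act_sum {ι : Type*} (s : Finset ι) (Θ : ι → Param p d) (z : Vec (d + 1)) :
    (∑ i ∈ s, Θ i).act z = ∑ i ∈ s, (Θ i).act z :=
  map_sum (evalAt z) Θ s

/-- The rank-one parameter `y zᵀ`. -/
def outer (y : Vec p) (z : Vec (d + 1)) : Param p d := WithLp.toLp 2 fun ij => y ij.1 * z ij.2

lemma inner_outer (y : Vec p) (z : Vec (d + 1)) (Θ : Param p d) :
    ⟪outer y z, Θ⟫ = ⟪y, Θ.act z⟫ := by
  simp only [PiLp.inner_apply, outer, act_apply, Fintype.sum_prod_type,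
    RCLike.inner_apply, conj_trivial, Finset.sum_mul]
  exact Finset.sum_congr rfl fun i _ => Finset.sum_congr rfl fun j _ => by ring

lemma act_outer (y : Vec p) (z z' : Vec (d + 1)) : (outer y z).act z' = ⟪z, z'⟫ • y := by
  ext i
  simp only [act_apply, outer, PiLp.smul_apply, PiLp.inner_apply, smul_eq_mul, Finset.sum_mul,
    RCLike.inner_apply, conj_trivial]
  exact Finset.sum_congr rfl fun j _ => by ring

/-- The extended input `(x, 0)`. -/
def padZero (d : ℕ) : Vec d →ₗ[ℝ] Vec (d + 1) where
  toFun x := WithLp.toLp 2 (Fin.snoc x.ofLp 0)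
  map_add' x y := by
    ext j; refine Fin.lastCases ?_ (fun j => ?_) j <;> simp
  map_smul' c x := by
    ext j; refine Fin.lastCases ?_ (fun j => ?_) j <;> simp

/-- The extended input `(0, 1)`, on which a parameter takes its bias as value. -/
def biasVec (d : ℕ) : Vec (d + 1) := EuclideanSpace.single (Fin.last d) 1

lemma padZero_castSucc (x : Vec d) (j : Fin d) : padZero d x j.castSucc = x j := by
  simp [padZero]

lemma padZero_last (x : Vec d) : padZero d x (Fin.last d) = 0 := by
  simp [padZero]

lemma inner_padZero (x y : Vec d) : ⟪padZero d x, padZero d y⟫ = ⟪x, y⟫ := by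
  simp only [PiLp.inner_apply, Fin.sum_univ_castSucc, padZero_castSucc, padZero_last]
  simp

lemma inner_padZero_biasVec (x : Vec d) : ⟪padZero d x, biasVec d⟫ = 0 := by
  rw [biasVec, EuclideanSpace.inner_single_right]
  simp [padZero_last]

lemma inner_biasVec_biasVec : ⟪biasVec d, biasVec d⟫ = 1 := by
  simp [biasVec]

lemma linear_eq_act (Θ : Param p d) (x : Vec d) : Θ.linear x = Θ.act (padZero d x) := by
  ext i
  rw [act_apply, Fin.sum_univ_castSucc]
  simp only [padZero_castSucc, padZero_last, zero_mul, add_zero]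
  simp [linear, weight, Matrix.mulVec, dotProduct, mul_comm]

lemma bias_eq_act (Θ : Param p d) : Θ.bias = Θ.act (biasVec d) := by
  ext i
  rw [act_apply]
  simp [bias, biasVec]

lemma model_eq_act (Θ : Param p d) (x : Vec d) : Θ.model x = Θ.act (padZero d x + biasVec d) := by
  rw [model, linear_eq_act, bias_eq_act, map_add]

end Param

section Gradient

open Param

variable {p d : ℕ} {I : Type*} [Fintype I]

/-- The supervised spectral contrastive loss of arbitrary extended inputs `X` with classes given by
the finite sets `S c`. -/
def contrastiveLoss (X : I → Vec (d + 1)) (S : ℤˣ → Finset I) (Θ : Param p d) : ℝ :=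
  -2 * (𝔼 c : ℤˣ, 𝔼 a ∈ S c, 𝔼 b ∈ S c, ⟪Θ.act (X a), Θ.act (X b)⟫)
    + 𝔼 a : I, 𝔼 b : I, ⟪Θ.act (X a), Θ.act (X b)⟫ ^ 2

/-- The mean of the inputs of class `c`. -/
def classMean {E : Type*} [AddCommGroup E] [Module ℝ E] (X : I → E) (S : Finset I) : E :=
  ((S.card : ℝ))⁻¹ • ∑ a ∈ S, X a

/-- The gradient of the contrastive loss. -/
def contrastiveGrad (X : I → Vec (d + 1)) (S : ℤˣ → Finset I) (Θ : Param p d) : Param p d :=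
  (-2 : ℝ) • (∑ c, outer (Θ.act (classMean X (S c))) (classMean X (S c)))
    + (4 : ℝ) • (Fintype.card I : ℝ)⁻¹ • ∑ a,
      outer (secondMoment (fun b => Θ.act (X b)) (Θ.act (X a))) (X a)

lemma hasFDerivAt_inner_act (Θ : Param p d) (x y : Vec (d + 1)) :
    HasFDerivAt (fun Θ : Param p d => ⟪Θ.act x, Θ.act y⟫)
      (innerSL ℝ (outer (Θ.act y) x + outer (Θ.act x) y)) Θ := by
  have h := ((evalAt (p := p) x).hasFDerivAt (x := Θ)).inner ℝ
    ((evalAt (p := p) y).hasFDerivAt (x := Θ))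
  refine h.congr_fderiv ?_
  ext H
  simp only [ContinuousLinearMap.comp_apply, ContinuousLinearMap.prod_apply,
    fderivInnerCLM_apply, innerSL_apply_apply, inner_add_left, inner_outer, evalAt_apply]
  rw [real_inner_comm, add_comm]
  rw [real_inner_comm]

/-- The average over positive pairs factors by bilinearity, so it sees the data only through the
class means. Averaging over two classes turns the coefficient `-2` into `-1`. -/
lemma contrastiveLoss_eq (X : I → Vec (d + 1)) (S : ℤˣ → Finset I) (Θ : Param p d) :
    contrastiveLoss X S Θ = (-1) * (∑ c, ⟪Θ.act (classMean X (S c)), Θ.act (classMean X (S c))⟫)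
      + ((Fintype.card I : ℝ)⁻¹ * (Fintype.card I : ℝ)⁻¹) *
        ∑ a, ∑ b, ⟪Θ.act (X a), Θ.act (X b)⟫ ^ 2 := by
  unfold contrastiveLoss
  simp only [Finset.expect_eq_sum_div_card, classMean, map_smul, map_sum, inner_smul_left,
    inner_smul_right, sum_inner, inner_sum, Finset.card_univ, ← Finset.sum_div]
  have h2 : ((Fintype.card ℤˣ : ℕ) : ℝ) = 2 := by norm_num
  rw [h2]
  congr 1
  · rw [Finset.sum_div, Finset.mul_sum, Finset.mul_sum]
    refine Finset.sum_congr rfl fun c _ => ?_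
    simp only [conj_trivial, div_eq_mul_inv, ← Finset.mul_sum]
    rw [Finset.sum_comm]
    ring
  · field_simp

lemma hasGradientAt_contrastiveLoss (X : I → Vec (d + 1)) (S : ℤˣ → Finset I) (Θ : Param p d) :
    HasGradientAt (contrastiveLoss X S) (contrastiveGrad X S Θ) Θ := by
  rw [hasGradientAt_iff_hasFDerivAt]
  have e : contrastiveLoss X S = fun Θ : Param p d => (-1) *
      (∑ c, ⟪Θ.act (classMean X (S c)), Θ.act (classMean X (S c))⟫)
      + ((Fintype.card I : ℝ)⁻¹ * (Fintype.card I : ℝ)⁻¹) *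
        ∑ a, ∑ b, ⟪Θ.act (X a), Θ.act (X b)⟫ ^ 2 := funext (contrastiveLoss_eq X S)
  rw [e]
  have h1 := (HasFDerivAt.fun_sum (u := Finset.univ) fun (c : ℤˣ) _ =>
    hasFDerivAt_inner_act Θ (classMean X (S c)) (classMean X (S c))).const_mul (-1 : ℝ)
  have h2 := (HasFDerivAt.fun_sum (u := Finset.univ) fun (a : I) _ =>
    HasFDerivAt.fun_sum (u := Finset.univ) fun (b : I) _ =>
      (hasFDerivAt_inner_act Θ (X a) (X b)).pow 2).const_mul
        ((Fintype.card I : ℝ)⁻¹ * (Fintype.card I : ℝ)⁻¹)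
  refine (h1.add h2).congr_fderiv ?_
  ext H
  simp only [contrastiveGrad, secondMoment, add_apply, smul_apply, sum_apply, innerSL_apply_apply,
    InnerProductSpace.toDual_apply_apply, inner_add_left, inner_outer, smul_eq_mul, sum_inner,
    real_inner_smul_left, nsmul_eq_mul]
  -- Exchanging the two examples of a pair identifies the two halves of the derivative of the
  -- squared inner product; this produces the factor `4`.
  have h3 : ∑ a, ∑ b, ⟪Θ.act (X a), Θ.act (X b)⟫ * ⟪Θ.act (X b), H.act (X a)⟫
      = ∑ a, ∑ b, ⟪Θ.act (X a), Θ.act (X b)⟫ * ⟪Θ.act (X a), H.act (X b)⟫ := by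
    rw [Finset.sum_comm]
    exact Finset.sum_congr rfl fun a _ => Finset.sum_congr rfl fun b _ => by
      rw [real_inner_comm]
  have h4 : ∑ a, ∑ b, ⟪Θ.act (X b), Θ.act (X a)⟫ * ⟪Θ.act (X b), H.act (X a)⟫
      = ∑ a, ∑ b, ⟪Θ.act (X a), Θ.act (X b)⟫ * ⟪Θ.act (X b), H.act (X a)⟫ := by
    exact Finset.sum_congr rfl fun a _ => Finset.sum_congr rfl fun b _ => by
      rw [real_inner_comm]
  rw [← Finset.mul_sum, h4]
  have h5 : ∑ a, ∑ b, ((2 : ℕ) : ℝ) * ⟪Θ.act (X a), Θ.act (X b)⟫ ^ (2 - 1) *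
      (⟪Θ.act (X b), H.act (X a)⟫ + ⟪Θ.act (X a), H.act (X b)⟫)
      = 4 * ∑ a, ∑ b, ⟪Θ.act (X a), Θ.act (X b)⟫ * ⟪Θ.act (X b), H.act (X a)⟫ := by
    calc _ = 2 * (∑ a, ∑ b, ⟪Θ.act (X a), Θ.act (X b)⟫ * ⟪Θ.act (X b), H.act (X a)⟫)
          + 2 * (∑ a, ∑ b, ⟪Θ.act (X a), Θ.act (X b)⟫ * ⟪Θ.act (X a), H.act (X b)⟫) := by
          simp only [Finset.mul_sum, ← Finset.sum_add_distrib]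
          exact Finset.sum_congr rfl fun a _ => Finset.sum_congr rfl fun b _ => by
            norm_num; ring
      _ = _ := by rw [h3]; ring
  simp only [Nat.cast_ofNat] at h5 ⊢
  rw [h5, Finset.sum_add_distrib]
  ring

/-- One step of gradient descent on the contrastive loss, evaluated at an extended input. -/
lemma act_gradient_step (X : I → Vec (d + 1)) (S : ℤˣ → Finset I) (η : ℝ) (Θ : Param p d)
    (z : Vec (d + 1)) :
    (Θ - η • gradient (contrastiveLoss X S) Θ).act z = Θ.act z
      + (2 * η) • (∑ c, ⟪classMean X (S c), z⟫ • Θ.act (classMean X (S c)))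
      - (4 * η) • secondMoment (fun b => Θ.act (X b)) (Θ.act (secondMoment X z)) := by
  rw [(hasGradientAt_contrastiveLoss X S Θ).gradient, act_sub, act_smul, contrastiveGrad, act_add,
    act_smul, act_smul, act_smul, act_sum, act_sum]
  simp only [act_outer]
  have h : secondMoment (fun b => Θ.act (X b)) (Θ.act (secondMoment X z))
      = (Fintype.card I : ℝ)⁻¹ • ∑ a, ⟪X a, z⟫ •
        secondMoment (fun b => Θ.act (X b)) (Θ.act (X a)) := by
    simp only [secondMoment, map_smul, map_sum, inner_smul_right, inner_sum, Finset.smul_sum,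
      Finset.sum_smul, smul_smul]
    rw [Finset.sum_comm]
    exact Finset.sum_congr rfl fun a _ => Finset.sum_congr rfl fun b _ => by
      congr 1; ring
  rw [h]
  module

end Gradient

/-! ### The frame of features, bias and averaged noise, and the centred noise. -/

/-- The linear map from coefficients to combinations of the family `e`. -/
def synthesis {ι E : Type*} [Fintype ι] [NormedAddCommGroup E] [InnerProductSpace ℝ E]
    (e : ι → E) : EuclideanSpace ℝ ι →L[ℝ] E :=
  LinearMap.toContinuousLinearMap
    { toFun := fun h => ∑ i, h i • e i
      map_add' := fun h h' => by simp [add_smul, Finset.sum_add_distrib]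
      map_smul' := fun c h => by simp [Finset.smul_sum, smul_smul] }

section Synthesis

variable {ι E : Type*} [Fintype ι] [NormedAddCommGroup E] [InnerProductSpace ℝ E] {e : ι → E}

lemma synthesis_apply (h : EuclideanSpace ℝ ι) : synthesis e h = ∑ i, h i • e i := rfl

lemma synthesis_single [DecidableEq ι] (i : ι) :
    synthesis e (EuclideanSpace.single i 1) = e i := by
  rw [synthesis_apply, Finset.sum_eq_single i]
  · simp
  · intro j _ hj; simp [hj]
  · simp

lemma inner_synthesis (he : Orthonormal ℝ e) (h h' : EuclideanSpace ℝ ι) :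
    ⟪synthesis e h, synthesis e h'⟫ = ⟪h, h'⟫ := by
  rw [synthesis_apply, synthesis_apply, he.inner_sum]
  simp [PiLp.inner_apply, mul_comm]

lemma inner_synthesis_eq_zero {x : E} (hx : ∀ i, ⟪e i, x⟫ = 0) (h : EuclideanSpace ℝ ι) :
    ⟪synthesis e h, x⟫ = 0 := by
  simp [synthesis_apply, sum_inner, inner_smul_left, hx]

end Synthesis

/-- The coordinates of the reduced dynamics: the features, the bias, and one averaged noise
direction for every value of the attributes. -/
abbrev Coord (κ : Constants) : Type := (Fin κ.K ⊕ Unit) ⊕ Attr κ.K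

namespace Constants

variable (κ : Constants)

/-- The coordinate of a feature. -/
abbrev featVec (k : Fin κ.K) : EuclideanSpace ℝ (Coord κ) :=
  EuclideanSpace.single (Sum.inl (Sum.inl k)) 1

/-- The coordinate of the bias. -/
abbrev biasCoord : EuclideanSpace ℝ (Coord κ) := EuclideanSpace.single (Sum.inl (Sum.inr ())) 1

/-- The coordinate of an averaged noise direction. -/
abbrev noiseVec (a : Attr κ.K) : EuclideanSpace ℝ (Coord κ) := EuclideanSpace.single (Sum.inr a) 1

/-- The coordinates of the signal. -/
def signalCoord (a : Attr κ.K) : EuclideanSpace ℝ (Coord κ) :=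
  (((a.y : ℤ) : ℝ) * κ.φ κ.cls) • κ.featVec κ.cls
    + (((a.ysub : ℤ) : ℝ) * κ.φ κ.sub + κ.μ) • κ.featVec κ.sub
    + (((a.ρ : ℤ) : ℝ) * κ.φ a.k) • κ.featVec a.k

lemma cls_ne_sub : κ.cls ≠ κ.sub := by simp [cls, sub]

instance : Nonempty (Attr κ.K) := ⟨⟨1, 1, ⟨⟨2, by have := κ.three_le_K; omega⟩, le_rfl⟩, 1⟩⟩

end Constants

namespace Problem

variable {κ : Constants} (S : Problem κ)

/-- The indices of the augmented examples with attributes `a`. -/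
def attrIdx (a : Attr κ.K) : Finset (Fin S.n × Fin S.m) :=
  Finset.univ.filter fun α => S.attr α.1 = a

/-- The number of augmented examples for every value of the attributes. -/
def rep : ℕ := (S.attrIdx (Classical.arbitrary _)).card

lemma card_attrIdx (a : Attr κ.K) : (S.attrIdx a).card = S.rep := by
  have h : ∀ a, (S.attrIdx a).card = (Finset.univ.filter fun i => S.attr i = a).card * S.m := by
    intro a
    have : S.attrIdx a = (Finset.univ.filter fun i => S.attr i = a) ×ˢ Finset.univ := by
      ext α; simp [attrIdx]
    rw [this, Finset.card_product, Finset.card_univ, Fintype.card_fin]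
  rw [rep, h, h, S.balanced]

lemma sum_comp_attr {M : Type*} [AddCommMonoid M] (f : Fin S.n × Fin S.m → M) :
    ∑ α, f α = ∑ a, ∑ α ∈ S.attrIdx a, f α := by
  unfold attrIdx
  rw [← Finset.sum_fiberwise Finset.univ (fun α : Fin S.n × Fin S.m => S.attr α.1) f]

lemma card_index : S.n * S.m = Fintype.card (Attr κ.K) * S.rep := by
  have h := S.sum_comp_attr fun _ => (1 : ℕ)
  simp only [Finset.sum_const, card_attrIdx, smul_eq_mul, mul_one, Finset.card_univ,
    Fintype.card_prod, Fintype.card_fin] at h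
  exact h

lemma rep_pos : 0 < S.rep := by
  have h := S.card_index
  have h1 : 0 < S.n * S.m := Nat.mul_pos S.n_pos S.m_pos
  rw [h] at h1
  exact Nat.pos_of_mul_pos_left h1

/-- The noise indices are pairwise distinct and none of them belongs to a feature. -/
structure GoodNoise (ξ : S.Noise) : Prop where
  injective : Function.Injective ξ
  K_le : ∀ α, κ.K ≤ (ξ α : ℕ)

/-- The noise direction of a training example, as an extended input. -/
def noiseDir (ξ : S.Noise) (α : Fin S.n × Fin S.m) : Vec (S.d + 1) := Param.padZero S.d (S.v (ξ α))

/-- The orthonormal family consisting of the features, the bias direction and the normalized sums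
of the noise directions with given attributes. -/
def frame (ξ : S.Noise) : Coord κ → Vec (S.d + 1)
  | Sum.inl (Sum.inl k) => Param.padZero S.d (S.feature k)
  | Sum.inl (Sum.inr _) => Param.biasVec S.d
  | Sum.inr a => (√(S.rep : ℝ))⁻¹ • ∑ α ∈ S.attrIdx a, S.noiseDir ξ α

/-- The noise direction of a training example, minus its mean over the examples with the same
attributes. -/
def centredNoise (ξ : S.Noise) (α : Fin S.n × Fin S.m) : Vec (S.d + 1) :=
  S.noiseDir ξ α - (√(S.rep : ℝ))⁻¹ • S.frame ξ (Sum.inr (S.attr α.1))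

/-- The extended training inputs. -/
def input (ξ : S.Noise) (α : Fin S.n × Fin S.m) : Vec (S.d + 1) :=
  Param.padZero S.d (S.trainExample ξ α) + Param.biasVec S.d

/-- The coordinates of the mean of the training inputs with attributes `a`. -/
def meanCoord (a : Attr κ.K) : EuclideanSpace ℝ (Coord κ) :=
  κ.signalCoord a + κ.biasCoord + (S.σξ * (√(S.rep : ℝ))⁻¹) • κ.noiseVec a

variable {S} {ξ : S.Noise}

lemma inner_feature_v {k : Fin κ.K} {j : Fin S.d} (hj : κ.K ≤ (j : ℕ)) :
    ⟪S.feature k, S.v j⟫ = 0 := by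
  apply S.v.orthonormal.2
  intro h
  rw [← h] at hj
  have := k.2
  simp at hj
  omega

lemma inner_feature_feature (k k' : Fin κ.K) :
    ⟪S.feature k, S.feature k'⟫ = if k = k' then 1 else 0 := by
  unfold feature
  rw [orthonormal_iff_ite.mp S.v.orthonormal]
  simp

lemma inner_signal_v (a : Attr κ.K) {j : Fin S.d} (hj : κ.K ≤ (j : ℕ)) :
    ⟪S.signal a, S.v j⟫ = 0 := by
  simp [signal, inner_add_left, inner_smul_left, inner_feature_v hj]

namespace GoodNoise

/-- This is where distinctness of the noise indices enters: it makes the noise directions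
orthonormal. -/
lemma inner_noiseDir (hξ : S.GoodNoise ξ) (α β : Fin S.n × Fin S.m) :
    ⟪S.noiseDir ξ α, S.noiseDir ξ β⟫ = if α = β then 1 else 0 := by
  unfold noiseDir
  rw [Param.inner_padZero, orthonormal_iff_ite.mp S.v.orthonormal]
  simp [hξ.injective.eq_iff]

lemma inner_frame_noiseDir (hξ : S.GoodNoise ξ) (i : Coord κ) (α : Fin S.n × Fin S.m) :
    ⟪S.frame ξ i, S.noiseDir ξ α⟫ = if i = Sum.inr (S.attr α.1) then (√(S.rep : ℝ))⁻¹ else 0 := by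
  rcases i with (k | _) | a
  · simp [frame, noiseDir, Param.inner_padZero, inner_feature_v (hξ.K_le α)]
  · rw [frame, noiseDir, real_inner_comm, Param.inner_padZero_biasVec]; simp
  · rw [frame, inner_smul_left, sum_inner]
    simp only [hξ.inner_noiseDir]
    rw [Finset.sum_ite_eq']
    simp only [attrIdx, Finset.mem_filter, Finset.mem_univ, true_and, Sum.inr.injEq,
      conj_trivial]
    by_cases h : S.attr α.1 = a
    · simp [h]
    · simp [h, Ne.symm h]

lemma orthonormal_frame (hξ : S.GoodNoise ξ) : Orthonormal ℝ (S.frame ξ) := by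
  have hr : (0 : ℝ) < S.rep := by exact_mod_cast S.rep_pos
  rw [orthonormal_iff_ite]
  have hnoise : ∀ (i : Coord κ) (a : Attr κ.K),
      ⟪S.frame ξ i, S.frame ξ (Sum.inr a)⟫ = if i = Sum.inr a then 1 else 0 := by
    intro i a
    rw [show S.frame ξ (Sum.inr a) = (√(S.rep : ℝ))⁻¹ • ∑ α ∈ S.attrIdx a, S.noiseDir ξ α from rfl,
      inner_smul_right, inner_sum]
    have : ∀ α ∈ S.attrIdx a, ⟪S.frame ξ i, S.noiseDir ξ α⟫
        = if i = Sum.inr a then (√(S.rep : ℝ))⁻¹ else 0 := by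
      intro α hα
      rw [hξ.inner_frame_noiseDir]
      simp only [attrIdx, Finset.mem_filter, Finset.mem_univ, true_and] at hα
      rw [hα]
    rw [Finset.sum_congr rfl this, Finset.sum_const, S.card_attrIdx, nsmul_eq_mul]
    split_ifs
    · have := Real.mul_self_sqrt hr.le
      have h0 := Real.sqrt_pos.mpr hr
      field_simp
      nlinarith
    · simp
  rintro ((k | u) | a) ((k' | u') | a')
  · simp [frame, Param.inner_padZero, inner_feature_feature]
  · simp [frame, Param.inner_padZero_biasVec]
  · exact hnoise _ _
  · simp only [frame]; rw [real_inner_comm, Param.inner_padZero_biasVec]; simp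
  · simp only [frame, Param.inner_biasVec_biasVec, if_true]
  · exact hnoise _ _
  · rw [real_inner_comm, hnoise]; simp
  · rw [real_inner_comm, hnoise]; simp
  · exact hnoise _ _

lemma inner_frame_centredNoise (hξ : S.GoodNoise ξ) (i : Coord κ) (α : Fin S.n × Fin S.m) :
    ⟪S.frame ξ i, S.centredNoise ξ α⟫ = 0 := by
  rw [centredNoise, inner_sub_right, inner_smul_right, hξ.inner_frame_noiseDir,
    orthonormal_iff_ite.mp hξ.orthonormal_frame]
  split_ifs <;> simp

lemma inner_synthesis_centredNoise (hξ : S.GoodNoise ξ) (h : EuclideanSpace ℝ (Coord κ))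
    (α : Fin S.n × Fin S.m) : ⟪synthesis (S.frame ξ) h, S.centredNoise ξ α⟫ = 0 :=
  inner_synthesis_eq_zero (fun i => hξ.inner_frame_centredNoise i α) h

end GoodNoise

lemma sum_centredNoise (ξ : S.Noise) (a : Attr κ.K) :
    ∑ α ∈ S.attrIdx a, S.centredNoise ξ α = 0 := by
  have hr : (0 : ℝ) < S.rep := by exact_mod_cast S.rep_pos
  have h : ∀ α ∈ S.attrIdx a, S.centredNoise ξ α
      = S.noiseDir ξ α - (√(S.rep : ℝ))⁻¹ • S.frame ξ (Sum.inr a) := by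
    intro α hα
    simp only [attrIdx, Finset.mem_filter, Finset.mem_univ, true_and] at hα
    rw [centredNoise, hα]
  rw [Finset.sum_congr rfl h, Finset.sum_sub_distrib, Finset.sum_const, S.card_attrIdx, frame,
    ← Nat.cast_smul_eq_nsmul ℝ, smul_smul, smul_smul]
  have : (S.rep : ℝ) * (√(S.rep : ℝ))⁻¹ * (√(S.rep : ℝ))⁻¹ = 1 := by
    have := Real.mul_self_sqrt hr.le
    have h0 := Real.sqrt_pos.mpr hr
    field_simp
    nlinarith
  rw [this, one_smul, sub_self]

/-- Sums over the training examples of centred noise with weights depending only on the attributes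
vanish. -/
lemma sum_smul_map_centredNoise {E : Type*} [NormedAddCommGroup E] [NormedSpace ℝ E] (ξ : S.Noise)
    (A : Attr κ.K → Vec (S.d + 1) →ₗ[ℝ] E) :
    ∑ α, A (S.attr α.1) (S.centredNoise ξ α) = 0 := by
  rw [S.sum_comp_attr]
  refine Finset.sum_eq_zero fun a _ => ?_
  have h : ∀ α ∈ S.attrIdx a, A (S.attr α.1) (S.centredNoise ξ α) = A a (S.centredNoise ξ α) := by
    intro α hα
    simp only [attrIdx, Finset.mem_filter, Finset.mem_univ, true_and] at hα
    rw [hα]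
  rw [Finset.sum_congr rfl h, ← map_sum, sum_centredNoise, map_zero]

lemma sum_comp_attr_eq {M : Type*} [AddCommGroup M] [Module ℝ M] (f : Attr κ.K → M) :
    ∑ α : Fin S.n × Fin S.m, f (S.attr α.1) = (S.rep : ℝ) • ∑ a, f a := by
  rw [S.sum_comp_attr, Finset.smul_sum]
  refine Finset.sum_congr rfl fun a _ => ?_
  have h : ∀ α ∈ S.attrIdx a, f (S.attr α.1) = f a := by
    intro α hα
    simp only [attrIdx, Finset.mem_filter, Finset.mem_univ, true_and] at hα
    rw [hα]
  rw [Finset.sum_congr rfl h, Finset.sum_const, S.card_attrIdx, Nat.cast_smul_eq_nsmul]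

lemma inv_card_mul_rep : (Fintype.card (Fin S.n × Fin S.m) : ℝ)⁻¹ * S.rep
    = (Fintype.card (Attr κ.K) : ℝ)⁻¹ := by
  have hr : (0 : ℝ) < S.rep := by exact_mod_cast S.rep_pos
  have h : (Fintype.card (Fin S.n × Fin S.m) : ℝ) = Fintype.card (Attr κ.K) * S.rep := by
    rw [Fintype.card_prod, Fintype.card_fin, Fintype.card_fin, S.card_index]; push_cast; rfl
  rw [h, mul_inv, mul_assoc, inv_mul_cancel₀ hr.ne', mul_one]

lemma synthesis_signalCoord (a : Attr κ.K) :
    synthesis (S.frame ξ) (κ.signalCoord a) = Param.padZero S.d (S.signal a) := by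
  simp only [Constants.signalCoord, map_add, map_smul, synthesis_single, signal, frame]

lemma input_eq (ξ : S.Noise) (α : Fin S.n × Fin S.m) :
    S.input ξ α = synthesis (S.frame ξ) (S.meanCoord (S.attr α.1)) + S.σξ • S.centredNoise ξ α := by
  rw [meanCoord, map_add, map_add, synthesis_signalCoord, map_smul, synthesis_single,
    synthesis_single, centredNoise, input, trainExample, dataPoint, map_add, map_smul, noiseDir]
  simp only [frame]
  module

namespace GoodNoise

/-- The centred noise vectors are the orthogonal projections of orthonormal vectors onto one
subspace, hence a Parseval frame of it. -/
lemma sum_inner_centredNoise (hξ : S.GoodNoise ξ) (α : Fin S.n × Fin S.m) :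
    ∑ β, ⟪S.centredNoise ξ β, S.centredNoise ξ α⟫ • S.centredNoise ξ β = S.centredNoise ξ α := by
  have h : ∀ β, ⟪S.centredNoise ξ β, S.centredNoise ξ α⟫
      = (if β = α then 1 else 0) - (if S.attr β.1 = S.attr α.1 then
        (√(S.rep : ℝ))⁻¹ * (√(S.rep : ℝ))⁻¹ else 0) := by
    intro β
    nth_rewrite 1 [centredNoise]
    rw [inner_sub_left, inner_smul_left, hξ.inner_frame_centredNoise, mul_zero, sub_zero,
      centredNoise, inner_sub_right, inner_smul_right, hξ.inner_noiseDir,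
      real_inner_comm, hξ.inner_frame_noiseDir]
    simp only [Sum.inr.injEq, eq_comm]
    split_ifs <;> simp
  simp only [h, sub_smul, Finset.sum_sub_distrib]
  have h2 := S.sum_smul_map_centredNoise ξ (fun a => (if a = S.attr α.1 then
        (√(S.rep : ℝ))⁻¹ * (√(S.rep : ℝ))⁻¹ else (0 : ℝ)) • LinearMap.id)
  simp only [LinearMap.smul_apply, LinearMap.id_apply] at h2
  rw [h2]
  simp

lemma inner_input_synthesis (hξ : S.GoodNoise ξ) (α : Fin S.n × Fin S.m)
    (h : EuclideanSpace ℝ (Coord κ)) :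
    ⟪S.input ξ α, synthesis (S.frame ξ) h⟫ = ⟪S.meanCoord (S.attr α.1), h⟫ := by
  rw [input_eq, inner_add_left, inner_smul_left, inner_synthesis hξ.orthonormal_frame,
    real_inner_comm (synthesis _ h), hξ.inner_synthesis_centredNoise, mul_zero, add_zero]

lemma inner_input_centredNoise (hξ : S.GoodNoise ξ) (α β : Fin S.n × Fin S.m) :
    ⟪S.input ξ β, S.centredNoise ξ α⟫ = S.σξ * ⟪S.centredNoise ξ β, S.centredNoise ξ α⟫ := by
  rw [input_eq, inner_add_left, inner_smul_left, hξ.inner_synthesis_centredNoise, zero_add]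
  rfl

/-- Weights that depend only on the attributes annihilate the centred noise, so the span of the
frame is invariant and each attribute value enters through its mean input. -/
lemma secondMoment_input_synthesis (hξ : S.GoodNoise ξ) (h : EuclideanSpace ℝ (Coord κ)) :
    secondMoment (S.input ξ) (synthesis (S.frame ξ) h)
      = synthesis (S.frame ξ) (secondMoment S.meanCoord h) := by
  unfold secondMoment
  simp only [hξ.inner_input_synthesis]
  simp only [input_eq, smul_add, Finset.sum_add_distrib]
  have h2 := S.sum_smul_map_centredNoise ξ (fun a => (⟪S.meanCoord a, h⟫ * S.σξ) • LinearMap.id)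
  simp only [LinearMap.smul_apply, LinearMap.id_apply, mul_smul] at h2
  rw [h2, smul_zero, add_zero, S.sum_comp_attr_eq fun a => ⟪S.meanCoord a, h⟫ •
    synthesis (S.frame ξ) (S.meanCoord a), smul_smul, inv_card_mul_rep, map_smul, map_sum]
  simp only [map_smul]

/-- The frame component cancels by centring, and the Parseval identity makes each centred noise
vector an eigenvector. -/
lemma secondMoment_input_centredNoise (hξ : S.GoodNoise ξ) (α : Fin S.n × Fin S.m) :
    secondMoment (S.input ξ) (S.centredNoise ξ α)
      = (S.σξ ^ 2 / Fintype.card (Fin S.n × Fin S.m)) • S.centredNoise ξ α := by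
  unfold secondMoment
  simp only [hξ.inner_input_centredNoise]
  simp only [input_eq, smul_add, Finset.sum_add_distrib]
  have h1 := S.sum_smul_map_centredNoise ξ (fun a =>
    (LinearMap.toSpanSingleton ℝ _ (synthesis (S.frame ξ) (S.meanCoord a))).comp
      (S.σξ • ((innerSL ℝ (S.centredNoise ξ α) : Vec (S.d + 1) →L[ℝ] ℝ) :
        Vec (S.d + 1) →ₗ[ℝ] ℝ)))
  have h2 : ∑ β, (S.σξ * ⟪S.centredNoise ξ β, S.centredNoise ξ α⟫) •
      synthesis (S.frame ξ) (S.meanCoord (S.attr β.1)) = 0 := by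
    rw [← h1]
    refine Finset.sum_congr rfl fun β _ => ?_
    rw [real_inner_comm]
    rfl
  have h3 : ∑ β, (S.σξ * ⟪S.centredNoise ξ β, S.centredNoise ξ α⟫) • S.σξ • S.centredNoise ξ β
      = S.σξ ^ 2 • S.centredNoise ξ α := by
    nth_rewrite 2 [← hξ.sum_inner_centredNoise α]
    rw [Finset.smul_sum]
    refine Finset.sum_congr rfl fun β _ => ?_
    rw [smul_smul, smul_smul]
    congr 1
    ring
  rw [h2, h3, smul_zero, zero_add, smul_smul, div_eq_inv_mul]

end GoodNoise
end Problem

/-! ### Class means and the two directions of the linearized dynamics. -/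

namespace Attr

variable {K : ℕ}

/-- The attribute values with class label `c`. -/
def ofClass (K : ℕ) (c : ℤˣ) : Finset (Attr K) := Finset.univ.filter fun a => a.y = c

lemma mem_ofClass {c : ℤˣ} {a : Attr K} : a ∈ ofClass K c ↔ a.y = c := by simp [ofClass]

/-- Negating the subclass label and the sign of the irrelevant feature. -/
def flip (a : Attr K) : Attr K := { a with ysub := -a.ysub, ρ := -a.ρ }

lemma flip_flip (a : Attr K) : a.flip.flip = a := by simp [flip]

lemma sum_ofClass_flip {M : Type*} [AddCommMonoid M] (c : ℤˣ) (f : Attr K → M) :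
    ∑ a ∈ ofClass K c, f a.flip = ∑ a ∈ ofClass K c, f a :=
  Finset.sum_nbij' flip flip (fun a ha => by rw [mem_ofClass] at ha ⊢; exact ha)
    (fun a ha => by rw [mem_ofClass] at ha ⊢; exact ha)
    (fun a _ => flip_flip a) (fun a _ => flip_flip a) (fun a _ => rfl)

lemma card_ofClass_eq (c c' : ℤˣ) : (ofClass K c).card = (ofClass K c').card :=
  Finset.card_nbij' (fun a => { a with y := c' }) (fun a => { a with y := c })
    (fun a _ => by simp [mem_ofClass]) (fun a _ => by simp [mem_ofClass])
    (fun a ha => by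
      rw [Finset.mem_coe, mem_ofClass] at ha; subst ha; rfl)
    (fun a ha => by
      rw [Finset.mem_coe, mem_ofClass] at ha; subst ha; rfl)

end Attr

namespace Constants

variable (κ : Constants)

lemma card_ofClass_pos (c : ℤˣ) : 0 < (Attr.ofClass κ.K c).card := by
  refine Finset.card_pos.mpr ⟨⟨c, 1, ⟨⟨2, by have := κ.three_le_K; omega⟩, le_rfl⟩, 1⟩, ?_⟩
  rw [Attr.mem_ofClass]

/-- Pairing each attribute value with its `flip` cancels the subclass sign and the irrelevant
feature within a class, leaving the class feature and the mean `μ`. -/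
lemma sum_signalCoord (c : ℤˣ) :
    ∑ a ∈ Attr.ofClass κ.K c, κ.signalCoord a = ((Attr.ofClass κ.K c).card : ℝ) •
      ((((c : ℤ) : ℝ) * κ.φ κ.cls) • κ.featVec κ.cls + κ.μ • κ.featVec κ.sub) := by
  have h : ∀ a ∈ Attr.ofClass κ.K c, κ.signalCoord a + κ.signalCoord a.flip = (2 : ℝ) •
      ((((c : ℤ) : ℝ) * κ.φ κ.cls) • κ.featVec κ.cls + κ.μ • κ.featVec κ.sub) := by
    intro a ha
    rw [Attr.mem_ofClass] at ha
    simp only [signalCoord, Attr.flip, ha, Units.val_neg, Int.cast_neg]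
    module
  have h2 := Finset.sum_congr rfl h
  rw [Finset.sum_add_distrib, Attr.sum_ofClass_flip, ← two_smul ℝ, Finset.sum_const,
    ← Nat.cast_smul_eq_nsmul ℝ, smul_comm] at h2
  exact (smul_right_injective _ (two_ne_zero (α := ℝ))) h2

/-- A bound for the norms of the coordinate vectors of the training inputs. -/
def inputBound : ℝ := κ.φ κ.cls + κ.φ κ.sub + |κ.μ| + ∑ k, κ.φ k + 2

lemma inputBound_ge : 2 ≤ κ.inputBound := by
  have h1 := κ.φ_pos κ.cls
  have h2 := κ.φ_pos κ.sub
  have h3 : 0 ≤ ∑ k, κ.φ k := Finset.sum_nonneg fun k _ => (κ.φ_pos k).le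
  have := abs_nonneg κ.μ
  unfold inputBound
  linarith

lemma abs_units (c : ℤˣ) : |((c : ℤ) : ℝ)| = 1 := by
  rcases Int.units_eq_one_or c with rfl | rfl <;> simp

lemma units_mul_self (c : ℤˣ) : ((c : ℤ) : ℝ) * ((c : ℤ) : ℝ) = 1 := by
  rcases Int.units_eq_one_or c with rfl | rfl <;> simp

lemma norm_signalCoord_le (a : Attr κ.K) : ‖κ.signalCoord a‖ ≤ κ.inputBound - 2 := by
  have h1 := κ.φ_pos κ.cls
  have h2 := κ.φ_pos κ.sub
  have h3 := κ.φ_pos a.k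
  have h4 : κ.φ a.k ≤ ∑ k, κ.φ k :=
    Finset.single_le_sum (fun k _ => (κ.φ_pos k).le) (Finset.mem_univ _)
  unfold signalCoord inputBound
  refine (norm_add₃_le).trans ?_
  simp only [norm_smul, PiLp.norm_single, norm_one, mul_one, Real.norm_eq_abs, abs_mul,
    abs_units, one_mul, abs_of_pos h1, abs_of_pos h3]
  have h5 := abs_add_le (((a.ysub : ℤ) : ℝ) * κ.φ κ.sub) κ.μ
  rw [abs_mul, abs_units, one_mul, abs_of_pos h2] at h5
  linarith

end Constants

namespace Problem

variable {κ : Constants} (S : Problem κ)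

lemma noiseCoeff_nonneg : 0 ≤ S.σξ * (√(S.rep : ℝ))⁻¹ := mul_nonneg S.σξ_nonneg (by positivity)

lemma noiseCoeff_le_one (hσ : S.σξ ≤ 1) : S.σξ * (√(S.rep : ℝ))⁻¹ ≤ 1 := by
  have h : 1 ≤ √(S.rep : ℝ) := by
    rw [Real.one_le_sqrt]; exact_mod_cast S.rep_pos
  have h2 : (√(S.rep : ℝ))⁻¹ ≤ 1 := inv_le_one_of_one_le₀ h
  have := S.σξ_nonneg
  have h3 : 0 ≤ (√(S.rep : ℝ))⁻¹ := by positivity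
  nlinarith

lemma norm_meanCoord_le (hσ : S.σξ ≤ 1) (a : Attr κ.K) : ‖S.meanCoord a‖ ≤ κ.inputBound := by
  unfold meanCoord
  refine (norm_add₃_le).trans ?_
  have h1 := κ.norm_signalCoord_le a
  have h2 := S.noiseCoeff_le_one hσ
  simp only [norm_smul, PiLp.norm_single, norm_one, mul_one,
    Real.norm_of_nonneg S.noiseCoeff_nonneg]
  linarith

/-- The coordinates of the mean of the training inputs of class `c`. -/
def classCoord (c : ℤˣ) : EuclideanSpace ℝ (Coord κ) := classMean S.meanCoord (Attr.ofClass κ.K c)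

lemma classCoord_eq (c : ℤˣ) : S.classCoord c =
    (((c : ℤ) : ℝ) * κ.φ κ.cls) • κ.featVec κ.cls + κ.μ • κ.featVec κ.sub + κ.biasCoord
      + (((Attr.ofClass κ.K 1).card : ℝ)⁻¹ * (S.σξ * (√(S.rep : ℝ))⁻¹)) •
        ∑ a ∈ Attr.ofClass κ.K c, κ.noiseVec a := by
  have h : ((Attr.ofClass κ.K 1).card : ℝ) ≠ 0 := by
    exact_mod_cast (κ.card_ofClass_pos 1).ne'
  unfold classCoord classMean meanCoord
  rw [Finset.sum_add_distrib, Finset.sum_add_distrib, κ.sum_signalCoord, Finset.sum_const,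
    ← Nat.cast_smul_eq_nsmul ℝ, ← smul_add, smul_add, smul_smul,
    Attr.card_ofClass_eq c 1, inv_mul_cancel₀ h, one_smul, ← Finset.smul_sum, smul_smul]

lemma norm_classCoord_le (hσ : S.σξ ≤ 1) (c : ℤˣ) : ‖S.classCoord c‖ ≤ κ.inputBound := by
  have h : (0 : ℝ) < (Attr.ofClass κ.K c).card := by exact_mod_cast κ.card_ofClass_pos c
  unfold classCoord classMean
  rw [norm_smul, Real.norm_of_nonneg (by positivity), inv_mul_le_iff₀ h]
  refine (norm_sum_le _ _).trans ?_
  calc _ ≤ ∑ _a ∈ Attr.ofClass κ.K c, κ.inputBound :=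
        Finset.sum_le_sum fun a _ => S.norm_meanCoord_le hσ a
    _ = _ := by simp

/-- The leading direction of the reduced dynamics. -/
def leading : EuclideanSpace ℝ (Coord κ) := (1 / 2 : ℝ) • (S.classCoord 1 + S.classCoord (-1))

/-- The second direction of the reduced dynamics. -/
def second : EuclideanSpace ℝ (Coord κ) := (1 / 2 : ℝ) • (S.classCoord 1 - S.classCoord (-1))

lemma inner_single_single (i j : Coord κ) :
    ⟪(EuclideanSpace.single i 1 : EuclideanSpace ℝ (Coord κ)), EuclideanSpace.single j 1⟫
      = if i = j then 1 else 0 := by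
  rw [EuclideanSpace.inner_single_left, PiLp.single_apply]
  simp

lemma inner_classCoord_feat (c : ℤˣ) :
    ⟪S.classCoord c, κ.featVec κ.sub⟫ = κ.μ := by
  simp [S.classCoord_eq, inner_add_left, real_inner_smul_left, sum_inner, inner_single_single,
    κ.cls_ne_sub]

lemma inner_classCoord_bias (c : ℤˣ) : ⟪S.classCoord c, κ.biasCoord⟫ = 1 := by
  simp [S.classCoord_eq, inner_add_left, real_inner_smul_left, sum_inner, inner_single_single]

/-- The averaged noise of different classes lies on disjoint coordinates, so it contributes only
when `c = c'`, and equally for both classes. The latter is what makes `leading` and `second`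
orthogonal. -/
lemma inner_classCoord_classCoord (c c' : ℤˣ) : ⟪S.classCoord c, S.classCoord c'⟫ =
    ((c : ℤ) : ℝ) * ((c' : ℤ) : ℝ) * κ.φ κ.cls ^ 2 + κ.μ ^ 2 + 1
      + if c = c' then (((Attr.ofClass κ.K 1).card : ℝ)⁻¹ * (S.σξ * (√(S.rep : ℝ))⁻¹)) ^ 2
        * (Attr.ofClass κ.K 1).card else 0 := by
  have hn : ∑ a' ∈ Attr.ofClass κ.K c', ∑ a ∈ Attr.ofClass κ.K c, (if a = a' then (1 : ℝ) else 0)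
      = if c = c' then ((Attr.ofClass κ.K 1).card : ℝ) else 0 := by
    simp only [Finset.sum_ite_eq', Attr.mem_ofClass]
    split_ifs with h
    · subst h
      rw [Finset.sum_congr rfl fun a ha => if_pos (Attr.mem_ofClass.mp ha)]
      simp [Attr.card_ofClass_eq c 1]
    · refine Finset.sum_eq_zero fun a ha => if_neg ?_
      rw [Attr.mem_ofClass.mp ha]; exact Ne.symm h
  have h12 : κ.cls ≠ κ.sub := κ.cls_ne_sub
  simp only [S.classCoord_eq, inner_add_left, inner_add_right, real_inner_smul_left,
    real_inner_smul_right, sum_inner, inner_sum, inner_single_single, Sum.inl.injEq,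
    Sum.inr.injEq, reduceCtorEq, if_true, if_false, h12, h12.symm,
    Finset.sum_const_zero, ← Finset.mul_sum, hn]
  split_ifs <;> ring

lemma inner_leading_second : ⟪S.leading, S.second⟫ = 0 := by
  rw [leading, second, real_inner_smul_left, real_inner_smul_right, inner_add_left,
    inner_sub_right, inner_sub_right, real_inner_comm (S.classCoord 1) (S.classCoord (-1)),
    S.inner_classCoord_classCoord 1 1, S.inner_classCoord_classCoord (-1) (-1)]
  simp

/-- By polarization the difference of the squared norms is the inner product of the two class means,
which contains no noise and equals `1 + μ² - φ₁²`. -/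
lemma norm_second_le (hgap : κ.φ κ.cls ^ 2 < 1 + κ.μ ^ 2) : ‖S.second‖ ≤ ‖S.leading‖ := by
  rw [← sq_le_sq₀ (norm_nonneg _) (norm_nonneg _), ← real_inner_self_eq_norm_sq,
    ← real_inner_self_eq_norm_sq]
  have h : ⟪S.classCoord 1, S.classCoord (-1)⟫ = - κ.φ κ.cls ^ 2 + κ.μ ^ 2 + 1 := by
    rw [inner_classCoord_classCoord]
    have : (1 : ℤˣ) ≠ -1 := by decide
    simp [this]
  simp only [leading, second, real_inner_smul_left, real_inner_smul_right, inner_add_left,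
    inner_sub_left, inner_add_right, inner_sub_right,
    real_inner_comm (S.classCoord 1) (S.classCoord (-1)), h]
  linarith

lemma one_le_norm_leading : 1 ≤ ‖S.leading‖ := by
  have h : ⟪S.leading, κ.biasCoord⟫ = 1 := by
    rw [leading, real_inner_smul_left, inner_add_left, inner_classCoord_bias,
      inner_classCoord_bias]
    norm_num
  have h2 := real_inner_le_norm S.leading κ.biasCoord
  rw [h] at h2
  simpa using h2

lemma norm_leading_le (hσ : S.σξ ≤ 1) : ‖S.leading‖ ≤ κ.inputBound := by
  have h1 := S.norm_classCoord_le hσ 1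
  have h2 := S.norm_classCoord_le hσ (-1)
  rw [leading, norm_smul]
  have := norm_add_le (S.classCoord 1) (S.classCoord (-1))
  rw [Real.norm_of_nonneg (by norm_num)]
  linarith

lemma inner_leading_sub : ⟪S.leading, κ.featVec κ.sub⟫ = κ.μ := by
  rw [leading, real_inner_smul_left, inner_add_left, inner_classCoord_feat, inner_classCoord_feat]
  ring

lemma inner_second_sub : ⟪S.second, κ.featVec κ.sub⟫ = 0 := by
  rw [second, real_inner_smul_left, inner_sub_left, inner_classCoord_feat, inner_classCoord_feat]
  ring

/-- The part of the subclass feature that is orthogonal to the leading direction. -/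
def subRemainder : EuclideanSpace ℝ (Coord κ) :=
  κ.featVec κ.sub - (κ.μ / ‖S.leading‖ ^ 2) • S.leading

lemma inner_leading_subRemainder : ⟪S.leading, S.subRemainder⟫ = 0 := by
  have := S.one_le_norm_leading
  rw [subRemainder, inner_sub_right, real_inner_smul_right, inner_leading_sub,
    real_inner_self_eq_norm_sq]
  field_simp
  ring

lemma inner_second_subRemainder : ⟪S.second, S.subRemainder⟫ = 0 := by
  rw [subRemainder, inner_sub_right, real_inner_smul_right, inner_second_sub, real_inner_comm,
    inner_leading_second]
  ring

/-- An orthogonal projection of a unit vector. -/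
lemma norm_subRemainder_le : ‖S.subRemainder‖ ≤ 1 := by
  have h : ‖S.subRemainder‖ ^ 2 = ⟪S.subRemainder, κ.featVec κ.sub⟫ := by
    have e : κ.featVec κ.sub = S.subRemainder + (κ.μ / ‖S.leading‖ ^ 2) • S.leading := by
      rw [subRemainder, sub_add_cancel]
    rw [e, inner_add_right, real_inner_smul_right, real_inner_comm S.leading,
      inner_leading_subRemainder, real_inner_self_eq_norm_sq]
    ring
  have h2 := real_inner_le_norm S.subRemainder (κ.featVec κ.sub)
  rw [← h] at h2
  simp only [PiLp.norm_single, norm_one, mul_one] at h2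
  nlinarith [norm_nonneg S.subRemainder]

/-! ### Gradient descent follows the reduced dynamics. -/

variable {S} {ξ : S.Noise}

lemma lossSCL_eq (ξ : S.Noise) : S.lossSCL ξ = contrastiveLoss (S.input ξ) S.classIdx := by
  funext Θ
  simp only [lossSCL, contrastiveLoss, Param.model_eq_act, input]

lemma act_iterate_succ (ω : S.Sample) (t : ℕ) (z : Vec (S.d + 1)) :
    (S.iterate ω (t + 1)).act z = (S.iterate ω t).act z
      + (2 * κ.η) • (∑ c, ⟪classMean (S.input ω.1) (S.classIdx c), z⟫ •
          (S.iterate ω t).act (classMean (S.input ω.1) (S.classIdx c)))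
      - (4 * κ.η) • secondMoment (fun b => (S.iterate ω t).act (S.input ω.1 b))
          ((S.iterate ω t).act (secondMoment (S.input ω.1) z)) := by
  rw [← act_gradient_step, ← lossSCL_eq]
  rfl

lemma sum_classIdx {M : Type*} [AddCommMonoid M] (c : ℤˣ) (f : Fin S.n × Fin S.m → M) :
    ∑ α ∈ S.classIdx c, f α = ∑ α, if (S.attr α.1).y = c then f α else 0 := by
  rw [classIdx, Finset.sum_filter]

lemma classMean_input (ξ : S.Noise) (c : ℤˣ) :
    classMean (S.input ξ) (S.classIdx c) = synthesis (S.frame ξ) (S.classCoord c) := by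
  have hr : (S.rep : ℝ) ≠ 0 := by exact_mod_cast S.rep_pos.ne'
  have hcard : ((S.classIdx c).card : ℝ) = S.rep * (Attr.ofClass κ.K c).card := by
    have h := S.sum_classIdx c fun _ => (1 : ℝ)
    rw [S.sum_comp_attr_eq fun a => if a.y = c then (1 : ℝ) else 0, ← Finset.sum_filter] at h
    simpa [Attr.ofClass] using h
  have hsum : ∑ α ∈ S.classIdx c, S.input ξ α
      = (S.rep : ℝ) • ∑ a ∈ Attr.ofClass κ.K c, synthesis (S.frame ξ) (S.meanCoord a) := by
    rw [sum_classIdx, Attr.ofClass, Finset.sum_filter, ← S.sum_comp_attr_eq fun a =>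
      if a.y = c then synthesis (S.frame ξ) (S.meanCoord a) else 0]
    have h2 := S.sum_smul_map_centredNoise ξ
      (fun a => (if a.y = c then S.σξ else (0 : ℝ)) • LinearMap.id)
    simp only [LinearMap.smul_apply, LinearMap.id_apply] at h2
    rw [← add_zero (∑ α, ite _ (synthesis _ _) 0), ← h2, ← Finset.sum_add_distrib]
    refine Finset.sum_congr rfl fun α _ => ?_
    split_ifs
    · exact input_eq ξ α
    · simp
  rw [classMean, hsum, hcard, smul_smul, classCoord, classMean, map_smul, map_sum]
  congr 1
  field_simp

/-- The mixed terms between signal and centred noise sum to zero within each attribute value, so the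
output second moment splits. -/
lemma act_secondMoment_input (ξ : S.Noise) (Θ : Param S.p S.d) (y : Vec S.p) :
    secondMoment (fun b => Θ.act (S.input ξ b)) y
      = secondMoment (fun a => Θ.act (synthesis (S.frame ξ) (S.meanCoord a))) y
        + S.σξ ^ 2 • secondMoment (fun α => Θ.act (S.centredNoise ξ α)) y := by
  unfold secondMoment
  set T : Attr κ.K → Vec S.p := fun a => Θ.act (synthesis (S.frame ξ) (S.meanCoord a)) with hT
  set N : Fin S.n × Fin S.m → Vec S.p := fun α => Θ.act (S.centredNoise ξ α) with hN
  have h0 : ∀ α, Θ.act (S.input ξ α) = T (S.attr α.1) + S.σξ • N α := by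
    intro α; rw [input_eq, map_add, map_smul]
  have h1 : ∑ α, ⟪T (S.attr α.1), y⟫ • N α = 0 := by
    have := S.sum_smul_map_centredNoise ξ (fun a => ⟪T a, y⟫ • (Θ.act : Vec (S.d + 1) →ₗ[ℝ] Vec S.p))
    simpa using this
  have h2 : ∑ α, ⟪N α, y⟫ • T (S.attr α.1) = 0 := by
    have := S.sum_smul_map_centredNoise ξ (fun a =>
      (LinearMap.toSpanSingleton ℝ _ (T a)).comp
        (((innerSL ℝ y).comp Θ.act : Vec (S.d + 1) →L[ℝ] ℝ) : Vec (S.d + 1) →ₗ[ℝ] ℝ))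
    rw [← this]
    refine Finset.sum_congr rfl fun α _ => ?_
    rw [real_inner_comm]
    rfl
  have h3 : ∑ α, ⟪Θ.act (S.input ξ α), y⟫ • Θ.act (S.input ξ α)
      = ∑ α : Fin S.n × Fin S.m, ⟪T (S.attr α.1), y⟫ • T (S.attr α.1)
        + S.σξ ^ 2 • ∑ α, ⟪N α, y⟫ • N α := by
    have : ∀ α, ⟪Θ.act (S.input ξ α), y⟫ • Θ.act (S.input ξ α)
        = ⟪T (S.attr α.1), y⟫ • T (S.attr α.1) + S.σξ ^ 2 • (⟪N α, y⟫ • N α)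
          + (S.σξ • (⟪T (S.attr α.1), y⟫ • N α) + S.σξ • (⟪N α, y⟫ • T (S.attr α.1))) := by
      intro α
      rw [h0, inner_add_left, real_inner_smul_left]
      module
    simp only [this, Finset.sum_add_distrib, ← Finset.smul_sum, h1, h2, smul_zero, add_zero]
  rw [h3, S.sum_comp_attr_eq fun a => ⟪T a, y⟫ • T a, smul_add, smul_smul, inv_card_mul_rep,
    smul_comm (S.σξ ^ 2)]

/-- Gradient descent, restricted to the span of the frame and to the centred noise, follows the
reduced dynamics. -/
lemma GoodNoise.reducedDynamics {ω : S.Sample} (hξ : S.GoodNoise ω.1) :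
    ReducedDynamics (4 * κ.η) S.σξ S.meanCoord S.leading S.second
      (fun t => (S.iterate ω t).act.comp (synthesis (S.frame ω.1)))
      (fun t α => (S.iterate ω t).act (S.centredNoise ω.1 α)) where
  step_T t h := by
    simp only [ContinuousLinearMap.comp_apply]
    rw [act_iterate_succ, hξ.secondMoment_input_synthesis, act_secondMoment_input]
    congr 2
    simp only [classMean_input, inner_synthesis hξ.orthonormal_frame]
    -- The sum of the two projections onto class means is `2 (u uᵀ + r rᵀ)`, which turns the
    -- coefficient `2 η` into `4 η`.
    rw [UnitsInt.univ, Finset.sum_pair (by decide)]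
    simp only [leading, second, map_add, map_sub, map_smul, real_inner_smul_left, inner_add_left,
      inner_sub_left]
    module
  step_N t α := by
    simp only [ContinuousLinearMap.comp_apply]
    rw [act_iterate_succ, hξ.secondMoment_input_centredNoise, act_secondMoment_input]
    have h0 : ∀ c, ⟪classMean (S.input ω.1) (S.classIdx c), S.centredNoise ω.1 α⟫ = 0 := by
      intro c
      rw [classMean_input, hξ.inner_synthesis_centredNoise]
    simp only [h0, zero_smul, Finset.sum_const_zero, smul_zero, add_zero]
    congr 1
    simp only [secondMoment, map_smul, real_inner_smul_right, mul_smul, ← Finset.smul_sum, smul_add]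
    simp only [smul_comm _ (S.σξ ^ 2 / (Fintype.card (Fin S.n × Fin S.m) : ℝ))]

/-- Directions orthogonal to the training inputs are not changed by gradient descent. -/
lemma act_iterate_eq_of_inner_eq_zero (ω : S.Sample) {z : Vec (S.d + 1)}
    (hz : ∀ α, ⟪S.input ω.1 α, z⟫ = 0) (t : ℕ) :
    (S.iterate ω t).act z = (S.iterate ω 0).act z := by
  induction t with
  | zero => rfl
  | succ t ih =>
    rw [act_iterate_succ, ih]
    simp [secondMoment, classMean, real_inner_smul_left, sum_inner, hz]

lemma inner_input_v {j : Fin S.d} (hj : κ.K ≤ (j : ℕ)) (hj' : ∀ α, ξ α ≠ j)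
    (α : Fin S.n × Fin S.m) : ⟪S.input ξ α, Param.padZero S.d (S.v j)⟫ = 0 := by
  rw [input, inner_add_left, real_inner_comm _ (Param.biasVec S.d), Param.inner_padZero_biasVec,
    Param.inner_padZero, trainExample, dataPoint, inner_add_left, inner_signal_v _ hj,
    real_inner_smul_left, S.v.orthonormal.2 (hj' α)]
  simp

end Problem

/-! ### Chi-square tail bounds for the Gaussian initialization. -/

section GaussianSquare

open Real

lemma integral_exp_mul_sq_gaussianReal {v : NNReal} (hv : v ≠ 0) {t : ℝ} (ht : 2 * t * v < 1) :
    ∫ x, exp (t * x ^ 2) ∂(gaussianReal 0 v) = (√(1 - 2 * t * v))⁻¹ := by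
  have hv0 : (0 : ℝ) < v := by positivity
  rw [integral_gaussianReal_eq_integral_smul hv]
  have h : ∀ x : ℝ, gaussianPDFReal 0 v x • exp (t * x ^ 2)
      = (√(2 * π * v))⁻¹ * exp (-((1 - 2 * t * v) / (2 * v)) * x ^ 2) := by
    intro x
    rw [gaussianPDFReal, smul_eq_mul, mul_assoc, ← exp_add]
    congr 2
    field_simp
    ring
  simp only [h]
  rw [integral_const_mul, integral_gaussian]
  have h1 : 0 < 1 - 2 * t * v := by linarith
  have h2 : π / ((1 - 2 * t * v) / (2 * v)) = (2 * π * v) / (1 - 2 * t * v) := by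
    field_simp
  have h3 : √(2 * π * v) ≠ 0 := by positivity
  rw [h2, sqrt_div (by positivity)]
  field_simp

end GaussianSquare

/-- The law of a Gaussian initialization with entries of variance `v`. -/
abbrev initLaw (p d : ℕ) (v : NNReal) : Measure (Fin p × Fin (d + 1) → ℝ) :=
  Measure.pi fun _ => gaussianReal 0 v

/-- The parameter with the given entries. -/
abbrev toParam {p d : ℕ} (ω : Fin p × Fin (d + 1) → ℝ) : Param p d := WithLp.toLp 2 ω

section InitLaw

variable {p d : ℕ} {v : NNReal}

lemma hasLaw_entry (ij : Fin p × Fin (d + 1)) :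
    HasLaw (fun ω : Fin p × Fin (d + 1) → ℝ => ω ij) (gaussianReal 0 v) (initLaw p d v) where
  aemeasurable := (measurable_pi_apply ij).aemeasurable
  map_eq := (measurePreserving_eval (fun _ => gaussianReal 0 v) ij).map_eq

lemma iIndepFun_entry :
    iIndepFun (fun (ij : Fin p × Fin (d + 1)) ω => ω ij) (initLaw p d v) :=
  iIndepFun_pi (X := fun _ => id) (fun _ => aemeasurable_id)

lemma hasGaussianLaw_entries :
    HasGaussianLaw (fun ω : Fin p × Fin (d + 1) → ℝ => (fun ij => ω ij)) (initLaw p d v) :=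
  iIndepFun_entry.hasGaussianLaw fun ij => (hasLaw_entry ij).hasGaussianLaw

lemma memLp_entry (ij : Fin p × Fin (d + 1)) :
    MemLp (fun ω : Fin p × Fin (d + 1) → ℝ => ω ij) 2 (initLaw p d v) :=
  (hasLaw_entry ij).hasGaussianLaw.memLp_two

lemma covariance_entry (ij kl : Fin p × Fin (d + 1)) :
    cov[fun ω : Fin p × Fin (d + 1) → ℝ => ω ij, fun ω => ω kl; initLaw p d v]
      = if ij = kl then (v : ℝ) else 0 := by
  split_ifs with h
  · subst h
    rw [covariance_self (hasLaw_entry ij).aemeasurable, (hasLaw_entry ij).variance_eq, variance_id_gaussianReal]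
  · exact (iIndepFun_entry.indepFun h).covariance_eq_zero (memLp_entry ij) (memLp_entry kl)

/-- The coordinates of the image of `z` under the initialization. -/
def rowProj (z : Vec (d + 1)) (i : Fin p) (ω : Fin p × Fin (d + 1) → ℝ) : ℝ :=
  ∑ j, z j * ω (i, j)

lemma hasGaussianLaw_rowProj (z : Vec (d + 1)) :
    HasGaussianLaw (fun ω => (fun i => rowProj z i ω)) (initLaw p d v) := by
  let L : (Fin p × Fin (d + 1) → ℝ) →L[ℝ] (Fin p → ℝ) := LinearMap.toContinuousLinearMap
    { toFun := fun ω i => rowProj z i ω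
      map_add' := fun ω ω' => by ext i; simp [rowProj, mul_add, Finset.sum_add_distrib]
      map_smul' := fun c ω => by ext i; simp [rowProj, Finset.mul_sum, mul_left_comm] }
  exact hasGaussianLaw_entries.map_fun L

lemma covariance_rowProj (z : Vec (d + 1)) (i k : Fin p) :
    cov[rowProj z i, rowProj z k; initLaw p d v] = if i = k then ‖z‖ ^ 2 * v else 0 := by
  unfold rowProj
  rw [covariance_fun_sum_fun_sum (fun j => (memLp_entry _).const_mul _)
    (fun j => (memLp_entry _).const_mul _)]
  simp only [covariance_const_mul_left, covariance_const_mul_right, covariance_entry,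
    Prod.mk.injEq]
  split_ifs with h
  · simp only [h, true_and, mul_ite, mul_zero, Finset.sum_ite_eq, Finset.mem_univ, if_true]
    rw [EuclideanSpace.real_norm_sq_eq, Finset.sum_mul]
    exact Finset.sum_congr rfl fun j _ => by ring
  · simp [h]

/-- The coordinates are jointly Gaussian and uncorrelated, hence independent. -/
lemma iIndepFun_rowProj (z : Vec (d + 1)) :
    iIndepFun (fun i => rowProj (p := p) z i) (initLaw p d v) :=
  (hasGaussianLaw_rowProj z).iIndepFun_of_covariance_eq_zero fun i j hij => by
    rw [covariance_rowProj, if_neg hij]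

lemma map_rowProj {z : Vec (d + 1)} (hz : ‖z‖ = 1) (i : Fin p) :
    (initLaw p d v).map (rowProj z i) = gaussianReal 0 v := by
  have hg : HasGaussianLaw (rowProj z i) (initLaw p d v) := (hasGaussianLaw_rowProj z).eval i
  rw [hg.map_eq_gaussianReal, ← covariance_self hg.aemeasurable, covariance_rowProj]
  have h0 : ∫ ω, rowProj z i ω ∂(initLaw p d v) = 0 := by
    unfold rowProj
    rw [integral_finsetSum _ fun j _ => ((memLp_entry (i, j)).integrable (by norm_num)).const_mul _]
    refine Finset.sum_eq_zero fun j _ => ?_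
    rw [integral_const_mul, (hasLaw_entry (i, j)).integral_eq, integral_id_gaussianReal, mul_zero]
  rw [h0]
  simp [hz]

lemma measurable_rowProj (z : Vec (d + 1)) (i : Fin p) : Measurable (rowProj z i) := by
  unfold rowProj; fun_prop

lemma norm_act_sq (z : Vec (d + 1)) (ω : Fin p × Fin (d + 1) → ℝ) :
    ‖(toParam (p := p) ω).act z‖ ^ 2 = ∑ i, rowProj z i ω ^ 2 := by
  rw [EuclideanSpace.real_norm_sq_eq]
  rfl

lemma measurable_norm_act_sq (z : Vec (d + 1)) :
    Measurable fun ω => ‖(toParam (p := p) ω).act z‖ ^ 2 := by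
  simp only [norm_act_sq]
  exact Finset.measurable_sum _ fun i _ => (measurable_rowProj z i).pow_const 2

lemma mgf_norm_act_sq (hv : v ≠ 0) {z : Vec (d + 1)} (hz : ‖z‖ = 1) {t : ℝ}
    (ht : 2 * t * v < 1) :
    mgf (fun ω => ‖(toParam (p := p) ω).act z‖ ^ 2) (initLaw p d v) t
      = ((√(1 - 2 * t * v))⁻¹) ^ p := by
  have h1 : (fun ω => ‖(toParam (p := p) ω).act z‖ ^ 2)
      = ∑ i : Fin p, fun ω => rowProj z i ω ^ 2 := by
    ext ω; rw [norm_act_sq, Finset.sum_apply]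
  rw [h1]
  have h2 : iIndepFun (fun i ω => rowProj (p := p) z i ω ^ 2) (initLaw p d v) :=
    (iIndepFun_rowProj z).comp (fun _ x => x ^ 2) fun _ => by fun_prop
  rw [h2.mgf_sum fun i => (measurable_rowProj z i).pow_const 2]
  have h3 : ∀ i : Fin p, mgf (fun ω => rowProj z i ω ^ 2) (initLaw p d v) t
      = (√(1 - 2 * t * v))⁻¹ := by
    intro i
    rw [← integral_exp_mul_sq_gaussianReal hv ht, ← map_rowProj hz i,
      integral_map (measurable_rowProj z i).aemeasurable (by fun_prop)]
    rfl
  simp [h3]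

/-- A non-integrable function has integral `0` by convention, but the moment generating function was
computed to be positive. -/
lemma integrable_exp_norm_act_sq (hv : v ≠ 0) {z : Vec (d + 1)} (hz : ‖z‖ = 1) {t : ℝ}
    (ht : 2 * t * v < 1) :
    Integrable (fun ω => Real.exp (t * ‖(toParam (p := p) ω).act z‖ ^ 2))
      (initLaw p d v) := by
  by_contra h
  have h1 := mgf_norm_act_sq (p := p) hv hz ht
  rw [mgf, integral_undef h] at h1
  have : 0 < ((√(1 - 2 * t * v))⁻¹) ^ p := by
    have : 0 < 1 - 2 * t * v := by linarith
    positivity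
  linarith

/-- Upper tail of the mean square norm of the images of unit vectors. -/
lemma upper_tail {I : Type*} [Fintype I] [Nonempty I] (hv : v ≠ 0) {δ : ℝ} (hδ : 0 < δ)
    {z : I → Vec (d + 1)} (hz : ∀ i, ‖z i‖ = 1) :
    (initLaw p d v).real {ω | (1 + δ) * (p * v)
        ≤ meanSq fun i => (toParam (p := p) ω).act (z i)}
      ≤ (Real.exp (-δ / 2) * √(1 + δ)) ^ p := by
  have hv0 : (0 : ℝ) < v := by positivity
  -- The optimal Chernoff parameter, for which `1 - 2 t v = 1 / (1 + δ)`.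
  set t : ℝ := δ / (1 + δ) / (2 * v) with ht
  have ht0 : 0 ≤ t := by positivity
  have hI : (0 : ℝ) < Fintype.card I := by exact_mod_cast Fintype.card_pos
  have h1 : 1 - 2 * t * v = (1 + δ)⁻¹ := by rw [ht]; field_simp; ring
  have ht1 : 2 * t * v < 1 := by
    have : 0 < (1 + δ)⁻¹ := by positivity
    linarith
  -- Convexity bounds the exponential moment of the average by that of a single vector. The estimate
  -- is thus uniform in the size of `I`, with no independence among the vectors and no union bound.
  have hjensen : ∀ ω, Real.exp (t * meanSq fun i => (toParam (p := p) ω).act (z i))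
      ≤ (Fintype.card I : ℝ)⁻¹ * ∑ i,
        Real.exp (t * ‖(toParam (p := p) ω).act (z i)‖ ^ 2) := by
    intro ω
    have := convexOn_exp.map_sum_le (t := Finset.univ) (w := fun _ : I => (Fintype.card I : ℝ)⁻¹)
      (p := fun i => t * ‖(toParam (p := p) ω).act (z i)‖ ^ 2)
      (fun i _ => by positivity) (by simp [hI.ne']) (fun i _ => Set.mem_univ _)
    simp only [smul_eq_mul, ← Finset.mul_sum] at this
    refine le_trans (le_of_eq ?_) this
    unfold meanSq
    congr 1
    ring
  have hint : Integrable (fun ω => (Fintype.card I : ℝ)⁻¹ * ∑ i,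
        Real.exp (t * ‖(toParam (p := p) ω).act (z i)‖ ^ 2)) (initLaw p d v) :=
    (integrable_finsetSum _ fun i _ => integrable_exp_norm_act_sq hv (hz i) ht1).const_mul _
  have hmeas : Measurable fun ω => meanSq fun i => (toParam (p := p) ω).act (z i) := by
    unfold meanSq
    exact (Finset.measurable_sum _ fun i _ => measurable_norm_act_sq (z i)).const_mul _
  have hint' : Integrable
      (fun ω => Real.exp (t * meanSq fun i => (toParam (p := p) ω).act (z i)))
      (initLaw p d v) := by
    refine hint.mono' ((hmeas.const_mul t).exp.aestronglyMeasurable) (ae_of_all _ fun ω => ?_)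
    rw [Real.norm_of_nonneg (Real.exp_pos _).le]
    exact hjensen ω
  have hmgf : mgf (fun ω => meanSq fun i => (toParam (p := p) ω).act (z i))
      (initLaw p d v) t ≤ ((√(1 - 2 * t * v))⁻¹) ^ p := by
    refine (integral_mono hint' hint hjensen).trans ?_
    rw [integral_const_mul, integral_finsetSum _ fun i _ =>
      integrable_exp_norm_act_sq hv (hz i) ht1]
    have : ∀ i, ∫ ω, Real.exp (t * ‖(toParam (p := p) ω).act (z i)‖ ^ 2) ∂(initLaw p d v)
        = ((√(1 - 2 * t * v))⁻¹) ^ p := fun i => mgf_norm_act_sq hv (hz i) ht1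
    simp only [this, Finset.sum_const, Finset.card_univ, nsmul_eq_mul]
    rw [inv_mul_cancel_left₀ hI.ne']
  refine (measure_ge_le_exp_mul_mgf _ ht0 hint').trans ?_
  refine (mul_le_mul_of_nonneg_left hmgf (Real.exp_pos _).le).trans (le_of_eq ?_)
  rw [h1, Real.sqrt_inv, inv_inv, mul_pow, ← Real.exp_nat_mul]
  congr 2
  rw [ht]
  field_simp

/-- Lower tail of the norm of the image of a unit vector. -/
lemma lower_tail (hv : v ≠ 0) {δ : ℝ} (hδ : 0 < δ) (hδ1 : δ < 1)
    {z : Vec (d + 1)} (hz : ‖z‖ = 1) :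
    (initLaw p d v).real {ω | ‖(toParam (p := p) ω).act z‖ ^ 2 ≤ (1 - δ) * (p * v)}
      ≤ (Real.exp (δ / 2) * √(1 - δ)) ^ p := by
  have hv0 : (0 : ℝ) < v := by positivity
  have hδ2 : 0 < 1 - δ := by linarith
  -- Again the optimal parameter, now negative, with `1 - 2 t v = 1 / (1 - δ)`.
  set t : ℝ := -(δ / (1 - δ) / (2 * v)) with ht
  have ht0 : t ≤ 0 := by
    rw [ht, neg_nonpos]; positivity
  have h1 : 1 - 2 * t * v = (1 - δ)⁻¹ := by rw [ht]; field_simp; ring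
  have ht1 : 2 * t * v < 1 := by
    have : 0 < (1 - δ)⁻¹ := by positivity
    linarith
  refine (measure_le_le_exp_mul_mgf _ ht0 (integrable_exp_norm_act_sq hv hz ht1)).trans ?_
  rw [mgf_norm_act_sq hv hz ht1, h1, Real.sqrt_inv, inv_inv, mul_pow, ← Real.exp_nat_mul]
  refine le_of_eq ?_
  congr 2
  rw [ht]
  field_simp

end InitLaw

lemma upper_rate_lt_one {δ : ℝ} (hδ : 0 < δ) : Real.exp (-δ / 2) * √(1 + δ) < 1 := by
  have h1 : 1 + δ < Real.exp δ := by linarith [Real.add_one_lt_exp hδ.ne']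
  have h2 : √(1 + δ) < Real.exp (δ / 2) := by
    rw [Real.sqrt_lt' (Real.exp_pos _), ← Real.exp_nat_mul]
    refine h1.trans_eq ?_
    congr 1; push_cast; ring
  calc _ < Real.exp (-δ / 2) * Real.exp (δ / 2) := by gcongr
    _ = 1 := by rw [← Real.exp_add, ← Real.exp_zero]; congr 1; ring

lemma lower_rate_lt_one {δ : ℝ} (hδ : 0 < δ) : Real.exp (δ / 2) * √(1 - δ) < 1 := by
  have h1 : 1 - δ < Real.exp (-δ) := by linarith [Real.add_one_lt_exp (neg_ne_zero.mpr hδ.ne')]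
  have h2 : √(1 - δ) < Real.exp (-δ / 2) := by
    rw [Real.sqrt_lt' (Real.exp_pos _), ← Real.exp_nat_mul]
    refine h1.trans_eq ?_
    congr 1; push_cast; ring
  calc _ < Real.exp (δ / 2) * Real.exp (-δ / 2) := by gcongr
    _ = 1 := by rw [← Real.exp_add, ← Real.exp_zero]; congr 1; ring

/-! ### The initialization is well conditioned on the frame. -/

section Gram

variable {ι Y : Type*} [Fintype ι] [DecidableEq ι] [NormedAddCommGroup Y] [InnerProductSpace ℝ Y]

/-- A family whose Gram matrix is close to `s²` times the identity is nearly an isometry. -/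
lemma abs_norm_sum_sq_sub_le {g : ι → Y} {s δ : ℝ} (hδ : δ * Fintype.card ι ≤ 1 / 2)
    (h : ∀ i j, |⟪g i, g j⟫ - if i = j then s ^ 2 else 0| ≤ δ * s ^ 2)
    (x : EuclideanSpace ℝ ι) :
    |‖∑ i, x i • g i‖ ^ 2 - s ^ 2 * ‖x‖ ^ 2| ≤ s ^ 2 / 2 * ‖x‖ ^ 2 := by
  have h1 : ‖∑ i, x i • g i‖ ^ 2 - s ^ 2 * ‖x‖ ^ 2
      = ∑ i, ∑ j, x i * x j * (⟪g i, g j⟫ - if i = j then s ^ 2 else 0) := by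
    rw [← real_inner_self_eq_norm_sq, sum_inner, EuclideanSpace.real_norm_sq_eq, Finset.mul_sum,
      ← Finset.sum_sub_distrib]
    refine Finset.sum_congr rfl fun i _ => ?_
    simp only [inner_sum, real_inner_smul_left, real_inner_smul_right, mul_sub,
      Finset.sum_sub_distrib, mul_ite, mul_zero, Finset.sum_ite_eq, Finset.mem_univ, if_true]
    congr 1
    · exact Finset.sum_congr rfl fun j _ => by ring
    · ring
  rw [h1]
  calc _ ≤ ∑ i, ∑ j, |x i| * |x j| * (δ * s ^ 2) := by
        refine (Finset.abs_sum_le_sum_abs _ _).trans (Finset.sum_le_sum fun i _ => ?_)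
        refine (Finset.abs_sum_le_sum_abs _ _).trans (Finset.sum_le_sum fun j _ => ?_)
        rw [abs_mul, abs_mul]
        exact mul_le_mul_of_nonneg_left (h i j) (by positivity)
    _ = δ * s ^ 2 * (∑ i, |x i|) ^ 2 := by
        rw [sq (∑ i, |x i|), Finset.sum_mul_sum, Finset.mul_sum]
        refine Finset.sum_congr rfl fun i _ => ?_
        rw [Finset.mul_sum]
        exact Finset.sum_congr rfl fun j _ => by ring
    _ ≤ s ^ 2 / 2 * ‖x‖ ^ 2 := by
        have h2 : (∑ i, |x i|) ^ 2 ≤ Fintype.card ι * ‖x‖ ^ 2 := by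
          have := sq_sum_le_card_mul_sum_sq (s := Finset.univ) (f := fun i => |x i|)
          simpa [EuclideanSpace.real_norm_sq_eq, sq_abs] using this
        rcases isEmpty_or_nonempty ι with hι | ⟨⟨i⟩⟩
        · have : ∑ i, |x i| = 0 := by simp
          have h3 : 0 ≤ s ^ 2 / 2 * ‖x‖ ^ 2 := by positivity
          simpa [this] using h3
        have h0 : 0 ≤ δ * s ^ 2 := (abs_nonneg _).trans (h i i)
        calc _ ≤ δ * s ^ 2 * (Fintype.card ι * ‖x‖ ^ 2) := by gcongr
          _ = (δ * Fintype.card ι) * (s ^ 2 * ‖x‖ ^ 2) := by ring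
          _ ≤ 1 / 2 * (s ^ 2 * ‖x‖ ^ 2) := by gcongr
          _ = _ := by ring

end Gram

section TestVec

variable {ι Y : Type*} [DecidableEq ι] [NormedAddCommGroup Y] [InnerProductSpace ℝ Y]

/-- Unit vectors whose images determine the Gram matrix of the image of the family `e`. -/
def testVec (e : ι → Y) (i j : ι) (ε : ℤˣ) : Y :=
  if i = j then e i else (√2)⁻¹ • (e i + ((ε : ℤ) : ℝ) • e j)

lemma norm_testVec {e : ι → Y} (he : Orthonormal ℝ e) (i j : ι) (ε : ℤˣ) :
    ‖testVec e i j ε‖ = 1 := by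
  unfold testVec
  split_ifs with h
  · exact he.1 i
  · have h1 : ‖e i + ((ε : ℤ) : ℝ) • e j‖ ^ 2 = 2 := by
      have h2 : ⟪e i, e j⟫ = 0 := he.2 h
      rw [norm_add_sq_real, norm_smul, he.1, he.1, real_inner_smul_right, h2, Real.norm_eq_abs,
        Constants.abs_units]
      norm_num
    have h3 : ‖e i + ((ε : ℤ) : ℝ) • e j‖ = √2 := by
      rw [← h1, Real.sqrt_sq (norm_nonneg _)]
    rw [norm_smul, h3, Real.norm_of_nonneg (by positivity)]
    exact inv_mul_cancel₀ (by positivity)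

/-- Polarization: for `i ≠ j` the squared norms at the two signs differ by `2 ⟪A (e i), A (e j)⟫`,
so finitely many norm estimates control the whole Gram matrix. -/
lemma abs_inner_sub_le_of_testVec {E : Type*} [NormedAddCommGroup E] [InnerProductSpace ℝ E]
    {e : ι → E} (A : E →L[ℝ] Y) {s δ : ℝ}
    (h : ∀ i j ε, |‖A (testVec e i j ε)‖ ^ 2 - s ^ 2| ≤ δ * s ^ 2) (i j : ι) :
    |⟪A (e i), A (e j)⟫ - if i = j then s ^ 2 else 0| ≤ δ * s ^ 2 := by
  split_ifs with hij
  · subst hij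
    have := h i i 1
    simpa [testVec, real_inner_self_eq_norm_sq] using this
  · have h1 := h i j 1
    have h2 := h i j (-1)
    simp only [testVec, if_neg hij, map_smul, map_add, norm_smul, mul_pow] at h1 h2
    rw [Real.norm_of_nonneg (by positivity), inv_pow, Real.sq_sqrt (by norm_num),
      norm_add_sq_real] at h1 h2
    simp only [Units.val_one, Int.cast_one, Units.val_neg, Int.cast_neg, one_smul, neg_smul,
      norm_neg, inner_neg_right] at h1 h2
    rw [abs_le] at h1 h2 ⊢
    constructor <;> linarith [h1.1, h1.2, h2.1, h2.2]

end TestVec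

namespace Problem

variable {κ : Constants} (S : Problem κ)

lemma d_pos : 0 < S.d := by have := S.K_le_d; have := κ.three_le_K; omega

/-- The size `σ₀ √(p/d)` of the image of a unit vector under the initialization. -/
def scale : ℝ := S.σ₀ * √((S.p : ℝ) / (S.d : ℝ))

/-- The variance of the entries of the initialization. -/
def initVar : NNReal := Real.toNNReal (S.σ₀ ^ 2 / (S.d : ℝ))

lemma initVar_ne_zero : S.initVar ≠ 0 := by
  have h1 : (0 : ℝ) < S.d := by exact_mod_cast S.d_pos
  have h2 := S.σ₀_pos
  have : 0 < S.initVar := Real.toNNReal_pos.mpr (by positivity)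
  exact this.ne'

lemma scale_pos : 0 < S.scale := by
  have h1 : (0 : ℝ) < S.d := by exact_mod_cast S.d_pos
  have h2 := S.σ₀_pos
  have h3 : (0 : ℝ) < S.p := by
    have := S.three_le_p
    exact_mod_cast (by omega : 0 < S.p)
  unfold scale
  positivity

lemma scale_sq : S.scale ^ 2 = S.p * S.initVar := by
  have h1 : (0 : ℝ) < S.d := by exact_mod_cast S.d_pos
  rw [scale, mul_pow, Real.sq_sqrt (by positivity), initVar, Real.coe_toNNReal _ (by positivity)]
  ring

/-- The initialization is well conditioned on the span of the frame, and not too large on the noise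
directions. -/
structure GoodInit (ξ : S.Noise) (Θ : Param S.p S.d) : Prop where
  lower : ∀ h, S.scale / 2 * ‖h‖ ≤ ‖Θ.act (synthesis (S.frame ξ) h)‖
  upper : ∀ h, ‖Θ.act (synthesis (S.frame ξ) h)‖ ≤ 3 / 2 * S.scale * ‖h‖
  noise : √(meanSq fun α => Θ.act (S.centredNoise ξ α)) ≤ 3 * S.scale
  basis : (meanSq fun j => Θ.act (Param.padZero S.d (S.v j))) ≤ 2 * S.scale ^ 2

/-- The tolerance in the Gram matrix of the initialization on the frame. -/
def _root_.Constants.tol (κ : Constants) : ℝ := 1 / (2 * Fintype.card (Coord κ))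

lemma _root_.Constants.card_coord_pos (κ : Constants) : (0 : ℝ) < Fintype.card (Coord κ) := by
  have : 0 < Fintype.card (Coord κ) := Fintype.card_pos_iff.mpr ⟨Sum.inl (Sum.inr ())⟩
  exact_mod_cast this

lemma _root_.Constants.tol_pos (κ : Constants) : 0 < κ.tol := by
  have := κ.card_coord_pos
  unfold Constants.tol; positivity

lemma _root_.Constants.tol_lt_one (κ : Constants) : κ.tol < 1 := by
  have h : 1 ≤ Fintype.card (Coord κ) := Fintype.card_pos_iff.mpr ⟨Sum.inl (Sum.inr ())⟩
  have h' : (1 : ℝ) ≤ Fintype.card (Coord κ) := by exact_mod_cast h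
  unfold Constants.tol
  rw [div_lt_one (by positivity)]
  linarith

variable {S} {ξ : S.Noise}

lemma goodInit_of_testVec {Θ : Param S.p S.d}
    (h1 : ∀ i j ε, |‖Θ.act (testVec (S.frame ξ) i j ε)‖ ^ 2 - S.scale ^ 2|
      ≤ κ.tol * S.scale ^ 2)
    (h2 : (meanSq fun α => Θ.act (S.noiseDir ξ α)) ≤ 2 * S.scale ^ 2)
    (h3 : (meanSq fun j => Θ.act (Param.padZero S.d (S.v j))) ≤ 2 * S.scale ^ 2) :
    S.GoodInit ξ Θ := by
  have hs := S.scale_pos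
  have hδ : κ.tol * Fintype.card (Coord κ) ≤ 1 / 2 := by
    have := κ.card_coord_pos
    unfold Constants.tol
    field_simp
    exact le_rfl
  have key : ∀ h, |‖Θ.act (synthesis (S.frame ξ) h)‖ ^ 2 - S.scale ^ 2 * ‖h‖ ^ 2|
      ≤ S.scale ^ 2 / 2 * ‖h‖ ^ 2 := by
    intro h
    have := abs_norm_sum_sq_sub_le hδ (abs_inner_sub_le_of_testVec Θ.act h1) h
    rwa [synthesis_apply, map_sum, Finset.sum_congr rfl fun i _ => map_smul Θ.act _ _]
  have hup : ∀ h, ‖Θ.act (synthesis (S.frame ξ) h)‖ ≤ 3 / 2 * S.scale * ‖h‖ := by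
    intro h
    refine abs_le_of_sq_le_sq' ?_ (by positivity) |>.2
    have := (abs_le.mp (key h)).2
    have h0 : 0 ≤ S.scale ^ 2 * ‖h‖ ^ 2 := by positivity
    nlinarith
  refine ⟨fun h => ?_, hup, ?_, h3⟩
  · refine abs_le_of_sq_le_sq' ?_ (norm_nonneg _) |>.2
    have := (abs_le.mp (key h)).1
    have h0 : 0 ≤ S.scale ^ 2 * ‖h‖ ^ 2 := by positivity
    nlinarith
  · have hterm : ∀ α, ‖Θ.act (S.centredNoise ξ α)‖ ^ 2
        ≤ 2 * ‖Θ.act (S.noiseDir ξ α)‖ ^ 2 + 9 / 2 * S.scale ^ 2 := by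
      intro α
      have e1 : ‖Θ.act ((√(S.rep : ℝ))⁻¹ • S.frame ξ (Sum.inr (S.attr α.1)))‖
          ≤ 3 / 2 * S.scale := by
        have := hup ((√(S.rep : ℝ))⁻¹ • κ.noiseVec (S.attr α.1))
        rw [map_smul, synthesis_single] at this
        refine this.trans ?_
        rw [norm_smul, PiLp.norm_single, norm_one, mul_one, Real.norm_of_nonneg (by positivity)]
        have h : 1 ≤ √(S.rep : ℝ) := by
          rw [Real.one_le_sqrt]; exact_mod_cast S.rep_pos
        have h2 : (√(S.rep : ℝ))⁻¹ ≤ 1 := inv_le_one_of_one_le₀ h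
        have : 0 < 3 / 2 * S.scale := by positivity
        nlinarith
      rw [centredNoise, map_sub]
      have e2 := norm_sub_le (Θ.act (S.noiseDir ξ α))
        (Θ.act ((√(S.rep : ℝ))⁻¹ • S.frame ξ (Sum.inr (S.attr α.1))))
      set a := ‖Θ.act (S.noiseDir ξ α)‖
      have ha : 0 ≤ a := norm_nonneg _
      calc _ ≤ (a + 3 / 2 * S.scale) ^ 2 := by gcongr; linarith
        _ ≤ _ := by nlinarith [sq_nonneg (a - 3 / 2 * S.scale)]
    rw [Real.sqrt_le_left (by positivity)]
    have hI : (0 : ℝ) < Fintype.card (Fin S.n × Fin S.m) := by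
      have : 0 < Fintype.card (Fin S.n × Fin S.m) := by
        rw [Fintype.card_prod, Fintype.card_fin, Fintype.card_fin]
        exact Nat.mul_pos S.n_pos S.m_pos
      exact_mod_cast this
    have hsum : (meanSq fun α => Θ.act (S.centredNoise ξ α))
        ≤ 2 * (meanSq fun α => Θ.act (S.noiseDir ξ α)) + 9 / 2 * S.scale ^ 2 := by
      unfold meanSq
      rw [inv_mul_le_iff₀ hI]
      refine (Finset.sum_le_sum fun α _ => hterm α).trans (le_of_eq ?_)
      rw [Finset.sum_add_distrib, ← Finset.mul_sum, Finset.sum_const, Finset.card_univ,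
        nsmul_eq_mul]
      field_simp
    -- The bounds add up to `2 * 2 + 9 / 2 = 17 / 2`, below `3 ^ 2`.
    nlinarith [sq_nonneg S.scale]

/-- A bound `< 1` for the exponential rate of all tail estimates. -/
def _root_.Constants.rate (κ : Constants) : ℝ :=
  max (max (Real.exp (-κ.tol / 2) * √(1 + κ.tol)) (Real.exp (κ.tol / 2) * √(1 - κ.tol)))
    (Real.exp (-1 / 2) * √(1 + 1))

lemma _root_.Constants.rate_lt_one (κ : Constants) : κ.rate < 1 :=
  max_lt (max_lt (upper_rate_lt_one κ.tol_pos) (lower_rate_lt_one κ.tol_pos))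
    (upper_rate_lt_one one_pos)

lemma _root_.Constants.rate_pos (κ : Constants) : 0 < κ.rate :=
  lt_of_lt_of_le (by positivity) (le_max_right _ _)

/-- The number of tail estimates. -/
def _root_.Constants.numEvents (κ : Constants) : ℝ := 4 * (Fintype.card (Coord κ) : ℝ) ^ 2 + 2

lemma measureReal_testVec_le {z : Vec (S.d + 1)} (hz : ‖z‖ = 1) :
    (initLaw S.p S.d S.initVar).real
      {ω | ¬ |‖(toParam (p := S.p) ω).act z‖ ^ 2 - S.scale ^ 2| ≤ κ.tol * S.scale ^ 2}
      ≤ 2 * κ.rate ^ S.p := by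
  have h1 := upper_tail (p := S.p) (I := Unit) S.initVar_ne_zero κ.tol_pos (z := fun _ => z)
    fun _ => hz
  have h2 := lower_tail (p := S.p) S.initVar_ne_zero κ.tol_pos κ.tol_lt_one hz
  rw [← S.scale_sq] at h1 h2
  simp only [meanSq, Fintype.card_unit, Finset.univ_unique, Finset.sum_singleton, Nat.cast_one,
    inv_one, one_mul] at h1
  have h3 : (Real.exp (-κ.tol / 2) * √(1 + κ.tol)) ^ S.p ≤ κ.rate ^ S.p :=
    pow_le_pow_left₀ (by positivity) ((le_max_left _ _).trans (le_max_left _ _)) _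
  have h4 : (Real.exp (κ.tol / 2) * √(1 - κ.tol)) ^ S.p ≤ κ.rate ^ S.p :=
    pow_le_pow_left₀ (by positivity) ((le_max_right _ _).trans (le_max_left _ _)) _
  calc _ ≤ (initLaw S.p S.d S.initVar).real
        ({ω | (1 + κ.tol) * S.scale ^ 2 ≤ ‖(toParam (p := S.p) ω).act z‖ ^ 2} ∪
          {ω | ‖(toParam (p := S.p) ω).act z‖ ^ 2 ≤ (1 - κ.tol) * S.scale ^ 2}) := by
        refine measureReal_mono fun ω hω => ?_
        simp only [Set.mem_ofPred_eq, abs_le, not_and_or, not_le] at hω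
        rcases hω with hω | hω
        · right; simp only [Set.mem_ofPred_eq]; linarith
        · left; simp only [Set.mem_ofPred_eq]; linarith
    _ ≤ _ := measureReal_union_le _ _
    _ ≤ 2 * κ.rate ^ S.p := by linarith

lemma measureReal_meanSq_le {I : Type*} [Fintype I] [Nonempty I] {z : I → Vec (S.d + 1)}
    (hz : ∀ i, ‖z i‖ = 1) :
    (initLaw S.p S.d S.initVar).real
      {ω | ¬ (meanSq fun i => (toParam (p := S.p) ω).act (z i)) ≤ 2 * S.scale ^ 2}
      ≤ κ.rate ^ S.p := by
  have h1 := upper_tail (p := S.p) S.initVar_ne_zero one_pos hz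
  rw [← S.scale_sq] at h1
  have h3 : (Real.exp (-1 / 2) * √(1 + 1)) ^ S.p ≤ κ.rate ^ S.p :=
    pow_le_pow_left₀ (by positivity) (le_max_right _ _) _
  refine le_trans (measureReal_mono fun ω hω => ?_) (h1.trans h3)
  simp only [Set.mem_ofPred_eq, not_le] at hω ⊢
  linarith

lemma GoodNoise.measureReal_not_goodInit (hξ : S.GoodNoise ξ) :
    (initLaw S.p S.d S.initVar).real {ω | ¬ S.GoodInit ξ (toParam ω)}
      ≤ κ.numEvents * κ.rate ^ S.p := by
  set P := initLaw S.p S.d S.initVar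
  have hn : Nonempty (Fin S.n × Fin S.m) := ⟨⟨⟨0, S.n_pos⟩, ⟨0, S.m_pos⟩⟩⟩
  have hd : Nonempty (Fin S.d) := ⟨⟨0, S.d_pos⟩⟩
  have hpad : ∀ j, ‖Param.padZero S.d (S.v j)‖ = 1 := by
    intro j
    rw [← sq_eq_sq₀ (norm_nonneg _) zero_le_one, ← real_inner_self_eq_norm_sq,
      Param.inner_padZero, real_inner_self_eq_norm_sq, S.v.orthonormal.1]
  let B : Coord κ × Coord κ × ℤˣ → Set (Fin S.p × Fin (S.d + 1) → ℝ) := fun x =>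
    {ω | ¬ |‖(toParam (p := S.p) ω).act (testVec (S.frame ξ) x.1 x.2.1 x.2.2)‖ ^ 2 - S.scale ^ 2|
      ≤ κ.tol * S.scale ^ 2}
  have hB : ∀ x, P.real (B x) ≤ 2 * κ.rate ^ S.p := fun x =>
    measureReal_testVec_le (norm_testVec hξ.orthonormal_frame _ _ _)
  have h2 := measureReal_meanSq_le (S := S) (z := S.noiseDir ξ) fun α => hpad _
  have h3 := measureReal_meanSq_le (S := S) (z := fun j => Param.padZero S.d (S.v j)) hpad
  have hsub : {ω | ¬ S.GoodInit ξ (toParam ω)} ⊆ ((⋃ x, B x)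
      ∪ {ω | ¬ (meanSq fun α => (toParam (p := S.p) ω).act (S.noiseDir ξ α)) ≤ 2 * S.scale ^ 2})
      ∪ {ω | ¬ (meanSq fun j => (toParam (p := S.p) ω).act (Param.padZero S.d (S.v j)))
        ≤ 2 * S.scale ^ 2} := by
    intro ω hω
    by_contra hcon
    simp only [Set.mem_union, Set.mem_iUnion, Set.mem_ofPred_eq, not_or, not_exists, not_not,
      B] at hcon
    exact hω (goodInit_of_testVec (fun i j ε => hcon.1.1 (i, j, ε)) hcon.1.2 hcon.2)
  have h1 : P.real (⋃ x, B x) ≤ 4 * (Fintype.card (Coord κ) : ℝ) ^ 2 * κ.rate ^ S.p := by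
    refine (measureReal_iUnion_fintype_le B).trans ?_
    refine (Finset.sum_le_sum fun x _ => hB x).trans (le_of_eq ?_)
    rw [Finset.sum_const, Finset.card_univ, Fintype.card_prod, Fintype.card_prod, nsmul_eq_mul]
    have : Fintype.card ℤˣ = 2 := by decide
    rw [this]
    push_cast
    ring
  calc _ ≤ _ := measureReal_mono hsub
    _ ≤ _ := measureReal_union_le _ _
    _ ≤ _ := add_le_add (measureReal_union_le _ _) le_rfl
    _ ≤ 4 * (Fintype.card (Coord κ) : ℝ) ^ 2 * κ.rate ^ S.p + κ.rate ^ S.p + κ.rate ^ S.p :=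
        add_le_add (add_le_add h1 h2) h3
    _ = _ := by unfold Constants.numEvents; ring

/-! ### Noise collisions and the probability of the good event. -/

variable (S)

/-- The law of the noise indices of the training examples. -/
abbrev noiseLaw : Measure S.Noise :=
  Measure.pi fun _ : Fin S.n × Fin S.m => (uniformOn Set.univ : Measure (Fin S.d))

instance : IsProbabilityMeasure (uniformOn Set.univ : Measure (Fin S.d)) :=
  have : Nonempty (Fin S.d) := ⟨⟨0, S.d_pos⟩⟩
  isProbabilityMeasure_uniformOn Set.finite_univ Set.univ_nonempty

lemma noiseLaw_eval (α : Fin S.n × Fin S.m) (A : Finset (Fin S.d)) :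
    S.noiseLaw.real {ξ | ξ α ∈ A} = A.card / S.d := by
  have h := (measurePreserving_eval
    (fun _ : Fin S.n × Fin S.m => (uniformOn Set.univ : Measure (Fin S.d))) α)
  have h2 : S.noiseLaw.real {ξ | ξ α ∈ A} = (uniformOn Set.univ : Measure (Fin S.d)).real A := by
    rw [← h.map_eq, map_measureReal_apply (measurable_pi_apply α) A.measurableSet]
    rfl
  rw [h2, measureReal_def, uniformOn_univ, Measure.count_apply_finset, Fintype.card_fin]
  simp

lemma noiseLaw_collision {α β : Fin S.n × Fin S.m} (h : α ≠ β) :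
    S.noiseLaw.real {ξ | ξ α = ξ β} ≤ 1 / S.d := by
  have hd : (0 : ℝ) < S.d := by exact_mod_cast S.d_pos
  have hind : iIndepFun (fun (α : Fin S.n × Fin S.m) (ξ : S.Noise) => ξ α) S.noiseLaw :=
    iIndepFun_pi (X := fun _ => id) (fun _ => aemeasurable_id)
  have hpair : ∀ j, S.noiseLaw.real ({ξ | ξ α ∈ ({j} : Finset (Fin S.d))} ∩
      {ξ | ξ β ∈ ({j} : Finset (Fin S.d))}) = (1 / S.d) * (1 / S.d) := by
    intro j
    have h1 := (hind.indepFun h).measure_inter_preimage_eq_mul _ _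
      (({j} : Finset (Fin S.d)).measurableSet) (({j} : Finset (Fin S.d)).measurableSet)
    have h2 := S.noiseLaw_eval α {j}
    have h3 := S.noiseLaw_eval β {j}
    rw [Finset.card_singleton, Nat.cast_one] at h2 h3
    calc _ = S.noiseLaw.real {ξ | ξ α ∈ ({j} : Finset (Fin S.d))}
          * S.noiseLaw.real {ξ | ξ β ∈ ({j} : Finset (Fin S.d))} := by
          simp only [measureReal_def, ← ENNReal.toReal_mul]
          exact congrArg ENNReal.toReal h1
      _ = _ := by rw [h2, h3]
  calc S.noiseLaw.real {ξ | ξ α = ξ β} ≤ S.noiseLaw.real (⋃ j,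
        ({ξ | ξ α ∈ ({j} : Finset (Fin S.d))} ∩ {ξ | ξ β ∈ ({j} : Finset (Fin S.d))})) := by
        refine measureReal_mono fun ξ hξ => ?_
        simp only [Set.mem_ofPred_eq] at hξ
        simp [hξ]
    _ ≤ _ := measureReal_iUnion_fintype_le _
    _ = 1 / S.d := by
        simp only [hpair, Finset.sum_const, Finset.card_univ, Fintype.card_fin, nsmul_eq_mul]
        field_simp

/-- A union bound: each noise index hits a feature with probability at most `K / d`, and each pair
of distinct examples collides with probability at most `1 / d`. As `m n ≥ 1`, the first sum is also
absorbed by `m² n² / d`. -/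
lemma measureReal_not_goodNoise :
    S.noiseLaw.real {ξ | ¬ S.GoodNoise ξ}
      ≤ (κ.K + 1) * ((S.m : ℝ) ^ 2 * (S.n : ℝ) ^ 2 / S.d) := by
  have hd : (0 : ℝ) < S.d := by exact_mod_cast S.d_pos
  let A : Finset (Fin S.d) := Finset.univ.filter fun j => (j : ℕ) < κ.K
  have hA : A.card ≤ κ.K := by
    have : A.card ≤ (Finset.range κ.K).card :=
      Finset.card_le_card_of_injOn (fun j => (j : ℕ)) (fun j hj => by simpa [A] using hj)
        (fun a _ b _ h => Fin.ext h)
    simpa using this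
  let C : (Fin S.n × Fin S.m) × (Fin S.n × Fin S.m) → Set S.Noise := fun x =>
    if x.1 = x.2 then ∅ else {ξ | ξ x.1 = ξ x.2}
  have hsub : {ξ | ¬ S.GoodNoise ξ} ⊆ (⋃ α, {ξ : S.Noise | ξ α ∈ A}) ∪ ⋃ x, C x := by
    intro ξ hξ
    by_contra hcon
    simp only [Set.mem_union, Set.mem_iUnion, not_or, not_exists] at hcon
    refine hξ ⟨fun α β hαβ => ?_, fun α => ?_⟩
    · by_contra hne
      have := hcon.2 (α, β)
      simp only [C, if_neg hne] at this
      exact this hαβ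
    · have := hcon.1 α
      simpa [A] using this
  have h1 : S.noiseLaw.real (⋃ α, {ξ : S.Noise | ξ α ∈ A}) ≤ (S.n * S.m : ℝ) * (κ.K / S.d) := by
    refine (measureReal_iUnion_fintype_le _).trans ?_
    calc _ ≤ ∑ _α : Fin S.n × Fin S.m, ((κ.K : ℝ) / S.d) := Finset.sum_le_sum fun α _ => by
          rw [S.noiseLaw_eval]
          gcongr
      _ = _ := by simp
  have h2 : S.noiseLaw.real (⋃ x, C x) ≤ (S.n * S.m : ℝ) ^ 2 * (1 / S.d) := by
    refine (measureReal_iUnion_fintype_le _).trans ?_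
    calc _ ≤ ∑ _x : (Fin S.n × Fin S.m) × (Fin S.n × Fin S.m), (1 / S.d : ℝ) :=
          Finset.sum_le_sum fun x _ => by
          by_cases h : x.1 = x.2
          · simp only [C, if_pos h, measureReal_empty]; positivity
          · simp only [C, if_neg h]; exact S.noiseLaw_collision h
      _ = _ := by
          simp only [Finset.sum_const, Finset.card_univ, Fintype.card_prod, Fintype.card_fin,
            nsmul_eq_mul]
          push_cast
          ring
  have h3 : (1 : ℝ) ≤ S.n * S.m := by exact_mod_cast Nat.mul_pos S.n_pos S.m_pos
  calc _ ≤ _ := measureReal_mono hsub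
    _ ≤ _ := measureReal_union_le _ _
    _ ≤ (S.n * S.m : ℝ) * (κ.K / S.d) + (S.n * S.m : ℝ) ^ 2 * (1 / S.d) := add_le_add h1 h2
    _ ≤ (S.n * S.m : ℝ) ^ 2 * (κ.K / S.d) + (S.n * S.m : ℝ) ^ 2 * (1 / S.d) := by
        gcongr
        nlinarith
    _ = _ := by ring

/-- With high probability the noise and the initialization are good. -/
lemma measureReal_not_good :
    S.law.real {ω | ¬ (S.GoodNoise ω.1 ∧ S.GoodInit ω.1 (toParam ω.2))}
      ≤ (κ.K + 1) * ((S.m : ℝ) ^ 2 * (S.n : ℝ) ^ 2 / S.d) + κ.numEvents * κ.rate ^ S.p := by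
  have hlaw : S.law = S.noiseLaw.prod (initLaw S.p S.d S.initVar) := rfl
  set P := initLaw S.p S.d S.initVar
  have hpos : 0 ≤ κ.numEvents * κ.rate ^ S.p := by
    have := κ.rate_pos
    unfold Constants.numEvents; positivity
  classical
  -- The frame depends on the noise, so the Gaussian estimate is applied for each fixed good noise
  -- and then averaged, using independence of noise and initialization.
  let B : S.Noise → Set S.Sample := fun ξ =>
    if S.GoodNoise ξ then {ξ} ×ˢ {ω | ¬ S.GoodInit ξ (toParam ω)} else ∅
  have hsub : {ω : S.Sample | ¬ (S.GoodNoise ω.1 ∧ S.GoodInit ω.1 (toParam ω.2))} ⊆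
      ({ξ | ¬ S.GoodNoise ξ} ×ˢ Set.univ) ∪ ⋃ ξ, B ξ := by
    intro ω hω
    by_cases h : S.GoodNoise ω.1
    · right
      refine Set.mem_iUnion.mpr ⟨ω.1, ?_⟩
      simp only [B, if_pos h]
      exact ⟨rfl, fun hg => hω ⟨h, hg⟩⟩
    · left
      exact ⟨h, trivial⟩
  have hB : ∀ ξ, S.law.real (B ξ) ≤ S.noiseLaw.real {ξ} * (κ.numEvents * κ.rate ^ S.p) := by
    intro ξ
    by_cases h : S.GoodNoise ξ
    · simp only [B, if_pos h]
      rw [hlaw, measureReal_prod_prod]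
      gcongr
      exact h.measureReal_not_goodInit
    · simp only [B, if_neg h, measureReal_empty]
      exact mul_nonneg measureReal_nonneg hpos
  have h1 : S.law.real ({ξ | ¬ S.GoodNoise ξ} ×ˢ Set.univ)
      ≤ (κ.K + 1) * ((S.m : ℝ) ^ 2 * (S.n : ℝ) ^ 2 / S.d) := by
    rw [hlaw, measureReal_prod_prod, probReal_univ, mul_one]
    exact S.measureReal_not_goodNoise
  have : IsProbabilityMeasure S.law := by rw [hlaw]; infer_instance
  calc _ ≤ _ := measureReal_mono hsub
    _ ≤ _ := measureReal_union_le _ _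
    _ ≤ _ := add_le_add h1 (measureReal_iUnion_fintype_le B)
    _ ≤ _ := add_le_add le_rfl (Finset.sum_le_sum fun ξ _ => hB ξ)
    _ = _ := by
        rw [← Finset.sum_mul]
        have : ∑ ξ : S.Noise, S.noiseLaw.real {ξ} = 1 := by
          rw [sum_measureReal_singleton]; simp
        rw [this, one_mul]

end Problem

/-! ### Separating functionals and the classification error. -/

namespace Constants

variable (κ : Constants)

lemma inner_featVec_cls_signalCoord (a : Attr κ.K) :
    ⟪κ.featVec κ.cls, κ.signalCoord a⟫ = ((a.y : ℤ) : ℝ) * κ.φ κ.cls := by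
  have h : κ.cls ≠ a.k := by
    intro h
    have := a.k.2
    rw [← h] at this
    simp [cls] at this
  simp [signalCoord, inner_add_right, real_inner_smul_right, Problem.inner_single_single,
    κ.cls_ne_sub, h]

lemma inner_featVec_sub_signalCoord (a : Attr κ.K) :
    ⟪κ.featVec κ.sub, κ.signalCoord a⟫ = ((a.ysub : ℤ) : ℝ) * κ.φ κ.sub + κ.μ := by
  have h : κ.sub ≠ a.k := by
    intro h
    have := a.k.2
    rw [← h] at this
    simp [sub] at this
  simp [signalCoord, inner_add_right, real_inner_smul_right, Problem.inner_single_single,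
    κ.cls_ne_sub.symm, h]

lemma inner_biasCoord_signalCoord (a : Attr κ.K) : ⟪κ.biasCoord, κ.signalCoord a⟫ = 0 := by
  simp [signalCoord, inner_add_right, real_inner_smul_right, Problem.inner_single_single]

/-- The margin with which the subclasses are separated. -/
def margin : ℝ := if |κ.μ| < κ.φ κ.sub then κ.φ κ.sub - |κ.μ| else κ.φ κ.sub

lemma margin_pos : 0 < κ.margin := by
  unfold margin
  split_ifs with h
  · linarith
  · exact κ.φ_pos _

lemma margin_le : κ.margin ≤ κ.φ κ.sub := by
  unfold margin
  split_ifs with h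
  · linarith [abs_nonneg κ.μ]
  · exact le_rfl

/-- A bound for the norms of the separating functionals. -/
def functionalBound : ℝ := 1 + |κ.μ| + |κ.μ| / κ.φ κ.cls

lemma functionalBound_ge : 1 + |κ.μ| ≤ κ.functionalBound ∧
    1 + |κ.μ| / κ.φ κ.cls ≤ κ.functionalBound ∧ 1 ≤ κ.functionalBound := by
  have h1 := abs_nonneg κ.μ
  have h2 : 0 ≤ |κ.μ| / κ.φ κ.cls := div_nonneg h1 (κ.φ_pos _).le
  unfold functionalBound
  refine ⟨?_, ?_, ?_⟩ <;> linarith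

end Constants

namespace Problem

variable {κ : Constants} (S : Problem κ)

lemma dataLaw_real (s : Finset (Attr κ.K × Fin S.d)) :
    S.dataLaw.real s = s.card / (Fintype.card (Attr κ.K) * S.d) := by
  rw [dataLaw, measureReal_def, uniformOn_univ, Measure.count_apply_finset, Fintype.card_prod,
    Fintype.card_fin]
  simp

instance : IsProbabilityMeasure S.dataLaw :=
  have : Nonempty (Fin S.d) := ⟨⟨0, S.d_pos⟩⟩
  isProbabilityMeasure_uniformOn Set.finite_univ Set.univ_nonempty

/-- A classifier that is correct for all noise indices outside of `bad` has error probability at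
most `bad.card / d`. -/
lemma one_sub_le_subclassAccuracy {g : Vec S.d → Vec S.p} {β : Vec S.p} {c : ℤˣ}
    (bad : Finset (Fin S.d))
    (h : ∀ a : Attr κ.K, a.y = c → ∀ j ∉ bad, 0 < ((a.ysub : ℤ) : ℝ) * ⟪β, g (S.dataPoint a j)⟫) :
    1 - (bad.card : ℝ) / S.d ≤ S.subclassAccuracy g β c := by
  have hd : (0 : ℝ) < S.d := by exact_mod_cast S.d_pos
  have hA : (0 : ℝ) < Fintype.card (Attr κ.K) := by exact_mod_cast Fintype.card_pos
  have hC : (0 : ℝ) < (Attr.ofClass κ.K c).card := by exact_mod_cast κ.card_ofClass_pos c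
  set E : Set (Attr κ.K × Fin S.d) := {z | z.1.y = c} with hE
  have hEc : S.dataLaw.real E
      = ((Attr.ofClass κ.K c).card * S.d) / (Fintype.card (Attr κ.K) * S.d) := by
    have : E = ((Attr.ofClass κ.K c ×ˢ (Finset.univ : Finset (Fin S.d)) :
        Finset (Attr κ.K × Fin S.d)) : Set (Attr κ.K × Fin S.d)) := by
      ext z; simp [hE, Attr.mem_ofClass]
    rw [this, dataLaw_real, Finset.card_product, Finset.card_univ, Fintype.card_fin]
    push_cast; rfl
  have hE0 : 0 < S.dataLaw.real E := by rw [hEc]; positivity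
  have hE0' : S.dataLaw E ≠ 0 := fun h0 => by simp [measureReal_def, h0] at hE0
  have hprob : IsProbabilityMeasure (ProbabilityTheory.cond S.dataLaw E) :=
    cond_isProbabilityMeasure hE0'
  set G : Set (Attr κ.K × Fin S.d) :=
    {z | 0 < ((z.1.ysub : ℤ) : ℝ) * ⟪β, g (S.dataPoint z.1 z.2)⟫} with hG
  have hfail : S.dataLaw.real (E ∩ Gᶜ)
      ≤ ((Attr.ofClass κ.K c).card * bad.card) / (Fintype.card (Attr κ.K) * S.d) := by
    have hsub : E ∩ Gᶜ ⊆ ((Attr.ofClass κ.K c ×ˢ bad :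
        Finset (Attr κ.K × Fin S.d)) : Set (Attr κ.K × Fin S.d)) := by
      rintro z ⟨hz1, hz2⟩
      rw [Finset.mem_coe, Finset.mem_product, Attr.mem_ofClass]
      refine ⟨hz1, ?_⟩
      by_contra hj
      exact hz2 (h z.1 hz1 z.2 hj)
    refine (measureReal_mono hsub).trans (le_of_eq ?_)
    rw [dataLaw_real, Finset.card_product]
    push_cast; rfl
  have h1 : (ProbabilityTheory.cond S.dataLaw E).real Gᶜ ≤ bad.card / S.d := by
    rw [measureReal_def, cond_apply (Set.toFinite E).measurableSet, ENNReal.toReal_mul,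
      ENNReal.toReal_inv, ← measureReal_def, ← measureReal_def, hEc,
      inv_mul_le_iff₀ (by positivity)]
    refine hfail.trans (le_of_eq ?_)
    field_simp
  have h2 : (ProbabilityTheory.cond S.dataLaw E).real G
      = 1 - (ProbabilityTheory.cond S.dataLaw E).real Gᶜ := by
    rw [probReal_compl_eq_one_sub (Set.toFinite G).measurableSet]; ring
  change _ ≤ (ProbabilityTheory.cond S.dataLaw E).real G
  linarith

/-- The quantity `m² n² / d`. -/
def overlap : ℝ := (S.m : ℝ) ^ 2 * (S.n : ℝ) ^ 2 / S.d

lemma overlap_nonneg : 0 ≤ S.overlap := by unfold overlap; positivity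

/-- A bound for the error probability of the separating functionals. -/
def errorBound : ℝ :=
  (κ.K + 1) * S.overlap + 32 * (S.σξ * κ.functionalBound / κ.margin) ^ 2

variable {S}

/-- All but few noise directions have a small effect on a given functional of the embedding. -/
lemma exists_bad_noise {ω : S.Sample} (hI : S.GoodInit ω.1 (S.iterate ω 0)) (t : ℕ)
    {β : Vec S.p} (hβ : ‖β‖ ≤ κ.functionalBound / (S.scale / 4)) :
    ∃ bad : Finset (Fin S.d), (bad.card : ℝ) / S.d ≤ S.errorBound ∧
      ∀ j ∉ bad, |S.σξ * ⟪β, (S.iterate ω t).act (Param.padZero S.d (S.v j))⟫| < κ.margin := by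
  classical
  have hd : (0 : ℝ) < S.d := by exact_mod_cast S.d_pos
  have hs := S.scale_pos
  have hσ := S.σξ_nonneg
  have hM := κ.margin_pos
  have hF : 0 < κ.functionalBound := by linarith [κ.functionalBound_ge.2.2]
  let x : Fin S.d → ℝ := fun j => ‖(S.iterate ω 0).act (Param.padZero S.d (S.v j))‖
  -- Three kinds of exceptional directions: features, directions seen in training, and directions on
  -- which the initialization is unusually large. The first two number at most `K + m n`. The third
  -- is counted by Chebyshev's inequality, with `32 = 4² * 2` from `‖β‖ ≤ 4 F / s`, where `F` is
  -- `functionalBound`, and the mean square bound `2 s²`. On all other directions gradient descent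
  -- leaves the parameter unchanged.
  let bad₁ : Finset (Fin S.d) := Finset.univ.filter fun j => (j : ℕ) < κ.K
  let bad₂ : Finset (Fin S.d) := Finset.univ.image ω.1
  let bad₃ : Finset (Fin S.d) := Finset.univ.filter fun j => κ.margin ≤ S.σξ * (‖β‖ * x j)
  have h1 : (bad₁.card : ℝ) ≤ κ.K := by
    have : bad₁.card ≤ (Finset.range κ.K).card :=
      Finset.card_le_card_of_injOn (fun j => (j : ℕ)) (fun j hj => by simpa [bad₁] using hj)
        (fun a _ b _ h => Fin.ext h)
    rw [Finset.card_range] at this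
    exact_mod_cast this
  have h2 : (bad₂.card : ℝ) ≤ S.n * S.m := by
    have : bad₂.card ≤ (Finset.univ : Finset (Fin S.n × Fin S.m)).card := Finset.card_image_le
    rw [Finset.card_univ, Fintype.card_prod, Fintype.card_fin, Fintype.card_fin] at this
    exact_mod_cast this
  have h3 : (bad₃.card : ℝ) ≤ 32 * (S.σξ * κ.functionalBound / κ.margin) ^ 2 * S.d := by
    have hx : ∑ j, x j ^ 2 ≤ S.d * (2 * S.scale ^ 2) := by
      have := hI.basis
      rw [meanSq, Fintype.card_fin, inv_mul_le_iff₀ hd] at this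
      exact this
    have hsum : bad₃.card * κ.margin ^ 2 ≤ (S.σξ * ‖β‖) ^ 2 * ∑ j, x j ^ 2 := by
      calc _ = ∑ j ∈ bad₃, κ.margin ^ 2 := by rw [Finset.sum_const, nsmul_eq_mul]
        _ ≤ ∑ j ∈ bad₃, (S.σξ * (‖β‖ * x j)) ^ 2 := by
            refine Finset.sum_le_sum fun j hj => ?_
            exact pow_le_pow_left₀ hM.le (Finset.mem_filter.mp hj).2 2
        _ ≤ ∑ j, (S.σξ * (‖β‖ * x j)) ^ 2 :=
            Finset.sum_le_sum_of_subset_of_nonneg (Finset.subset_univ _)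
              fun _ _ _ => sq_nonneg _
        _ = _ := by
            rw [Finset.mul_sum]
            exact Finset.sum_congr rfl fun j _ => by ring
    have hfin : (S.σξ * ‖β‖) ^ 2 * ∑ j, x j ^ 2
        ≤ (S.σξ * (κ.functionalBound / (S.scale / 4))) ^ 2 * (S.d * (2 * S.scale ^ 2)) := by
      gcongr
    rw [← mul_le_mul_iff_left₀ (pow_pos hM 2)]
    refine (hsum.trans hfin).trans (le_of_eq ?_)
    field_simp
    ring
  refine ⟨bad₁ ∪ bad₂ ∪ bad₃, ?_, fun j hj => ?_⟩
  · have hc : ((bad₁ ∪ bad₂ ∪ bad₃).card : ℝ) ≤ bad₁.card + bad₂.card + bad₃.card := by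
      have := (Finset.card_union_le (bad₁ ∪ bad₂) bad₃).trans
        (Nat.add_le_add_right (Finset.card_union_le bad₁ bad₂) _)
      exact_mod_cast this
    have hnm : (1 : ℝ) ≤ S.n * S.m := by exact_mod_cast Nat.mul_pos S.n_pos S.m_pos
    have hK : (0 : ℝ) ≤ κ.K := by positivity
    have ho : S.overlap * S.d = (S.n * S.m : ℝ) ^ 2 := by
      unfold overlap; field_simp
    have hsq : (S.n * S.m : ℝ) ≤ (S.n * S.m : ℝ) ^ 2 := by nlinarith
    have hK2 : (κ.K : ℝ) ≤ κ.K * (S.n * S.m : ℝ) ^ 2 :=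
      le_mul_of_one_le_right hK (one_le_pow₀ hnm)
    rw [div_le_iff₀ hd, errorBound, add_mul, mul_assoc, ho]
    linarith
  · simp only [Finset.mem_union, not_or, bad₁, bad₂, bad₃, Finset.mem_filter, Finset.mem_univ,
      true_and, not_lt, not_le, Finset.mem_image, not_exists] at hj
    rw [act_iterate_eq_of_inner_eq_zero ω (inner_input_v hj.1.1 hj.1.2) t, abs_mul, abs_of_nonneg hσ]
    refine lt_of_le_of_lt ?_ hj.2
    gcongr
    exact abs_real_inner_le_norm _ _

/-- A functional on the coordinate space that has a margin on the class `c` gives an accurate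
classifier, provided that it factors through the embedding with a controlled norm. -/
lemma errorBound_le_subclassAccuracy {ω : S.Sample} (hI : S.GoodInit ω.1 (S.iterate ω 0)) {t : ℕ}
    {g : Vec S.d → Vec S.p} {e l : EuclideanSpace ℝ (Coord κ)}
    (hg : ∀ x, g x = (S.iterate ω t).act (Param.padZero S.d x + synthesis (S.frame ω.1) e))
    {β : Vec S.p}
    (hβ : ∀ h, ⟪β, (S.iterate ω t).act (synthesis (S.frame ω.1) h)⟫ = ⟪l, h⟫)
    (hβ' : ‖β‖ ≤ κ.functionalBound / (S.scale / 4)) {c : ℤˣ}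
    (hl : ∀ a : Attr κ.K, a.y = c → κ.margin ≤ ((a.ysub : ℤ) : ℝ) * ⟪l, κ.signalCoord a + e⟫) :
    1 - S.errorBound ≤ S.subclassAccuracy g β c := by
  obtain ⟨bad, hbad, hgood⟩ := exists_bad_noise hI t hβ'
  refine le_trans (by linarith) (S.one_sub_le_subclassAccuracy bad fun a ha j hj => ?_)
  have h1 : ⟪β, g (S.dataPoint a j)⟫ = ⟪l, κ.signalCoord a + e⟫
      + S.σξ * ⟪β, (S.iterate ω t).act (Param.padZero S.d (S.v j))⟫ := by
    rw [hg, dataPoint, ← hβ]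
    simp only [map_add, map_smul, synthesis_signalCoord, inner_add_right, real_inner_smul_right]
    ring
  have h2 := hl a ha
  have h3 := hgood j hj
  set z := S.σξ * ⟪β, (S.iterate ω t).act (Param.padZero S.d (S.v j))⟫
  have h4 : |((a.ysub : ℤ) : ℝ) * z| < κ.margin := by rwa [abs_mul, Constants.abs_units, one_mul]
  rw [h1, mul_add]
  linarith [(abs_lt.mp h4).1]

/-- If the embedding is bounded below on the span of the frame then the subclasses are linearly
separable. -/
lemma separates_of_antilipschitz {ω : S.Sample} (hI : S.GoodInit ω.1 (S.iterate ω 0)) {t : ℕ}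
    (ht : ∀ h, S.scale / 4 * ‖h‖ ≤ ‖(S.iterate ω t).act (synthesis (S.frame ω.1) h)‖) {ε : ℝ}
    (hε : S.errorBound ≤ ε) : S.Separates (S.iterate ω t) ε := by
  have hs : 0 < S.scale / 4 := by linarith [S.scale_pos]
  have hφ := κ.φ_pos κ.cls
  have hM := κ.margin_le
  have hfeat : ∀ k, ‖κ.featVec k‖ = 1 := fun k => by simp
  have hbias : ‖κ.biasCoord‖ = 1 := by simp
  obtain ⟨hB1, hB2, hB3⟩ := κ.functionalBound_ge
  have key : ∀ l, ‖l‖ ≤ κ.functionalBound → ∃ β : Vec S.p,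
      (∀ h, ⟪β, (S.iterate ω t).act (synthesis (S.frame ω.1) h)⟫ = ⟪l, h⟫) ∧
      ‖β‖ ≤ κ.functionalBound / (S.scale / 4) := by
    intro l hl
    obtain ⟨β, h1, h2⟩ := exists_inner_eq_of_antilipschitz
      ((S.iterate ω t).act.comp (synthesis (S.frame ω.1))) hs ht l
    exact ⟨β, h1, h2.trans (by gcongr)⟩
  have hlin : ∀ x, (S.iterate ω t).linear x
      = (S.iterate ω t).act (Param.padZero S.d x + synthesis (S.frame ω.1) 0) := by
    intro x; rw [Param.linear_eq_act, map_zero, add_zero]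
  have hmod : ∀ x, (S.iterate ω t).model x
      = (S.iterate ω t).act (Param.padZero S.d x + synthesis (S.frame ω.1) κ.biasCoord) := by
    intro x; rw [Param.model_eq_act, synthesis_single]; rfl
  have hu : ∀ c : ℤˣ, ((c : ℤ) : ℝ) * ((c : ℤ) : ℝ) = 1 := Constants.units_mul_self
  refine ⟨?_, fun c => ?_, fun hμφ => ?_⟩
  -- With the bias available, `v₂ - μ b` has the value `y_sub φ₂` on every noiseless input.
  · obtain ⟨β, h1, h2⟩ := key (κ.featVec κ.sub - κ.μ • κ.biasCoord) (by
      refine (norm_sub_le _ _).trans ?_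
      rw [norm_smul, hfeat, hbias, Real.norm_eq_abs, mul_one]
      exact hB1)
    refine ⟨β, fun c => le_trans (by linarith)
      (errorBound_le_subclassAccuracy hI hmod h1 h2 fun a _ => ?_)⟩
    have e1 : ⟪κ.featVec κ.sub, κ.biasCoord⟫ = 0 := by simp [inner_single_single]
    have e2 : ⟪κ.biasCoord, κ.biasCoord⟫ = 1 := by simp
    rw [inner_sub_left, inner_add_right, inner_add_right, real_inner_smul_left,
      real_inner_smul_left, κ.inner_featVec_sub_signalCoord, κ.inner_biasCoord_signalCoord, e1, e2]
    linear_combination hM - κ.φ κ.sub * hu a.ysub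
  -- Within the class `c` the coordinate along `v₁` is the constant `c φ₁`, so a multiple of it
  -- replaces the bias in removing `μ`.
  · obtain ⟨β, h1, h2⟩ := key (κ.featVec κ.sub
      - (((c : ℤ) : ℝ) * (κ.μ / κ.φ κ.cls)) • κ.featVec κ.cls) (by
      refine (norm_sub_le _ _).trans ?_
      rw [norm_smul, hfeat, hfeat, Real.norm_eq_abs, abs_mul, Constants.abs_units, abs_div,
        abs_of_pos hφ, mul_one, one_mul]
      exact hB2)
    refine ⟨β, le_trans (by linarith)
      (errorBound_le_subclassAccuracy hI hlin h1 h2 fun a ha => ?_)⟩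
    rw [add_zero, inner_sub_left, real_inner_smul_left, κ.inner_featVec_sub_signalCoord,
      κ.inner_featVec_cls_signalCoord, ha]
    have e : ((c : ℤ) : ℝ) * (κ.μ / κ.φ κ.cls) * (((c : ℤ) : ℝ) * κ.φ κ.cls) = κ.μ := by
      have : κ.μ / κ.φ κ.cls * κ.φ κ.cls = κ.μ := div_mul_cancel₀ _ hφ.ne'
      linear_combination ((c : ℤ) : ℝ) * ((c : ℤ) : ℝ) * this + κ.μ * hu c
    rw [e]
    linear_combination hM - κ.φ κ.sub * hu a.ysub
  -- Without any correction the value is `y_sub φ₂ + μ`, whose sign is that of `y_sub` with margin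
  -- `φ₂ - |μ|`.
  · obtain ⟨β, h1, h2⟩ := key (κ.featVec κ.sub) (by rw [hfeat]; exact hB3)
    refine ⟨β, fun c => le_trans (by linarith)
      (errorBound_le_subclassAccuracy hI hlin h1 h2 fun a _ => ?_)⟩
    rw [add_zero, κ.inner_featVec_sub_signalCoord, Constants.margin, if_pos hμφ]
    have e : -|κ.μ| ≤ ((a.ysub : ℤ) : ℝ) * κ.μ := by
      have := neg_abs_le (((a.ysub : ℤ) : ℝ) * κ.μ)
      rwa [abs_mul, Constants.abs_units, one_mul] at this
    linear_combination e - κ.φ κ.sub * hu a.ysub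

end Problem

/-! ### Choice of the constants and conclusion. -/

namespace Constants

variable (κ : Constants)

/-- The constant that controls the nonlinear part of the dynamics. -/
def nonlinBound : ℝ :=
  7 * κ.inputBound ^ 2 * (36 * (4 * κ.η) * (κ.inputBound ^ 2 + 1)) * (1 + 1 / (2 * (4 * κ.η)))

/-- A lower bound for the coefficient of the leading direction in the subclass feature. -/
def overlapBound : ℝ := |κ.μ| / κ.inputBound ^ 2

/-- The size of the embedding at which the linear regime is left. -/
def exitScale : ℝ := min 1 (min (1 / 4) (κ.overlapBound / 8) / κ.nonlinBound)

/-- The strength with which the subclass feature is learned. -/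
def featureStrength : ℝ :=
  κ.overlapBound * κ.exitScale / (16 * (1 + 4 * κ.η * κ.inputBound ^ 2))

lemma inputBound_pos : 0 < κ.inputBound := by linarith [κ.inputBound_ge]

lemma nonlinBound_pos : 0 < κ.nonlinBound := by
  have := κ.inputBound_pos
  have := κ.η_pos
  unfold nonlinBound; positivity

variable {κ}

lemma overlapBound_pos (hμ : κ.μ ≠ 0) : 0 < κ.overlapBound := by
  have := κ.inputBound_pos
  have := abs_pos.mpr hμ
  unfold overlapBound; positivity

lemma exitScale_pos (hμ : κ.μ ≠ 0) : 0 < κ.exitScale := by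
  have := κ.nonlinBound_pos
  have := overlapBound_pos hμ
  unfold exitScale; positivity

lemma featureStrength_pos (hμ : κ.μ ≠ 0) : 0 < κ.featureStrength := by
  have := κ.inputBound_pos
  have := κ.η_pos
  have := overlapBound_pos hμ
  have := exitScale_pos hμ
  unfold featureStrength; positivity

lemma exitScale_le_one : κ.exitScale ≤ 1 := min_le_left _ _

/-- The bound `1 / 4` keeps half of the growth along `u`; the bound `overlapBound / 8` keeps the
orthogonal part of `v₂` below half of its leading part. -/
lemma nonlinBound_mul_exitScale_sq_le (hμ : κ.μ ≠ 0) :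
    κ.nonlinBound * κ.exitScale ^ 2 ≤ min (1 / 4) (κ.overlapBound / 8) := by
  have h1 := κ.nonlinBound_pos
  have h2 := exitScale_pos hμ
  have h3 : κ.exitScale ≤ min (1 / 4) (κ.overlapBound / 8) / κ.nonlinBound := min_le_right _ _
  have h4 : κ.exitScale ^ 2 ≤ κ.exitScale := by
    have := exitScale_le_one (κ := κ)
    nlinarith
  rw [le_div_iff₀' h1] at h3
  exact (mul_le_mul_of_nonneg_left h4 h1.le).trans h3

end Constants

namespace Problem

variable {κ : Constants} {S : Problem κ}

/-- If the noise and the initialization are good then the subclass feature is learned early. -/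
lemma GoodNoise.learnsSubclassEarly (hμ : κ.μ ≠ 0) (hgap : κ.φ κ.cls ^ 2 < 1 + κ.μ ^ 2)
    (hσ : S.σξ ≤ 1) (hs : S.scale ≤ κ.exitScale) (hs' : 3 * S.scale ≤ κ.featureStrength)
    {ω : S.Sample} (hξ : S.GoodNoise ω.1) (hI : S.GoodInit ω.1 (S.iterate ω 0)) {ε : ℝ}
    (hε : S.errorBound ≤ ε) (hε' : 3 / 2 * S.scale ≤ ε) :
    S.LearnsSubclassEarly κ.featureStrength (1 / Real.log (1 + 4 * κ.η)) ε ω := by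
  have hη := κ.η_pos
  have hQ := κ.inputBound_ge
  have hu1 := S.one_le_norm_leading
  have huQ := S.norm_leading_le hσ
  have hμ' := abs_pos.mpr hμ
  have hs0 := S.scale_pos
  have hstrength : 0 < 7 * κ.inputBound ^ 2 * (36 * (4 * κ.η) * (κ.inputBound ^ 2 + 1)) := by
    have := κ.inputBound_pos
    positivity
  set T : ℕ → EuclideanSpace ℝ (Coord κ) →L[ℝ] Vec S.p :=
    fun t => (S.iterate ω t).act.comp (synthesis (S.frame ω.1)) with hT
  have hv : ∀ t, (S.iterate ω t).linear S.v₂ = T t (κ.featVec κ.sub) := by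
    intro t
    rw [Param.linear_eq_act, hT, ContinuousLinearMap.comp_apply, synthesis_single]
    rfl
  have hc : ReducedDynamics.Controlled (4 * κ.η) S.σξ κ.inputBound S.scale κ.nonlinBound
      S.meanCoord S.leading S.second T
      (fun t α => (S.iterate ω t).act (S.centredNoise ω.1 α)) :=
    { dyn := hξ.reducedDynamics
      a_pos := by positivity
      σ_nonneg := S.σξ_nonneg
      σ_le_one := hσ
      s_pos := hs0
      one_le_Q := by linarith
      norm_q_le := S.norm_meanCoord_le hσ
      inner_u_r := S.inner_leading_second
      norm_r_le := S.norm_second_le hgap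
      one_le_norm_u := hu1
      -- The factor `1 + 1 / (2 a)` in `nonlinBound`, with `a = 4 η`, is at least `1`, and so is its
      -- product `2 a + 1` with `2 a`; this serves `L_ge` and `L_mul_ge` at once.
      L_ge := by
        refine le_mul_of_one_le_right hstrength.le ?_
        have : 0 ≤ 1 / (2 * (4 * κ.η)) := by positivity
        linarith
      L_mul_ge := by
        rw [Constants.nonlinBound, mul_assoc _ (1 + _) (2 * _)]
        refine le_mul_of_one_le_right hstrength.le ?_
        rw [add_mul, one_mul, div_mul_cancel₀ _ (by positivity)]
        linarith
      opNorm_zero_le := by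
        refine ContinuousLinearMap.opNorm_le_bound _ (by positivity) fun h => ?_
        refine (hI.upper h).trans ?_
        gcongr
        linarith
      meanSq_zero_le := hI.noise
      norm_zero_ge := hI.lower }
  have hLc := Constants.nonlinBound_mul_exitScale_sq_le hμ
  have hu2 : ‖S.leading‖ ^ 2 ≤ κ.inputBound ^ 2 := by gcongr
  -- Applied to the orthogonal decomposition of `v₂` into its component along `u` and
  -- `subRemainder`. The latter is also orthogonal to `r`, because `v₂` is.
  obtain ⟨t, ht1, ht2, ht3⟩ := hc.exists_time (κ := κ.μ / ‖S.leading‖ ^ 2)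
    (κ₀ := κ.overlapBound) (c₀ := κ.exitScale) (Λ := 1 + 4 * κ.η * κ.inputBound ^ 2)
    (k := S.subRemainder) (Constants.exitScale_pos hμ) Constants.exitScale_le_one
    (hLc.trans (min_le_left _ _)) (hLc.trans (min_le_right _ _)) (Constants.overlapBound_pos hμ)
    (by
      rw [abs_div, abs_of_nonneg (sq_nonneg ‖S.leading‖)]
      unfold Constants.overlapBound
      gcongr)
    (by gcongr) hs hs' S.norm_subRemainder_le S.inner_leading_subRemainder
    S.inner_second_subRemainder
  have hfeat : (κ.μ / ‖S.leading‖ ^ 2) • S.leading + S.subRemainder = κ.featVec κ.sub := by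
    rw [subRemainder, add_sub_cancel]
  rw [hfeat] at ht2
  refine ⟨?_, t, ?_, ?_, separates_of_antilipschitz hI ht3 hε⟩
  · rw [hv]
    refine le_trans ?_ hε'
    have := hI.upper (κ.featVec κ.sub)
    rwa [PiLp.norm_single, norm_one, mul_one] at this
  · have hlog : 0 < Real.log (1 + 4 * κ.η) := Real.log_pos (by linarith)
    -- As `‖u‖ ≥ 1`, the growth rate is at least `1 + 4 η`, so the constant in the time bound does
    -- not depend on the problem.
    have hle : Real.log (1 + 4 * κ.η) ≤ Real.log (1 + 4 * κ.η * ‖S.leading‖ ^ 2) := by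
      refine Real.log_le_log (by linarith) ?_
      have : 4 * κ.η ≤ 4 * κ.η * ‖S.leading‖ ^ 2 :=
        le_mul_of_one_le_right (by positivity) (one_le_pow₀ hu1)
      linarith
    have hscale : 1 / S.σ₀ * √((S.d : ℝ) / (S.p : ℝ)) = 1 / S.scale := by
      rw [scale, one_div, one_div, mul_inv, ← Real.sqrt_inv, inv_div]
    rw [hscale, one_div_mul_eq_div, le_div_iff₀ hlog]
    exact (mul_le_mul_of_nonneg_left hle (Nat.cast_nonneg t)).trans ht1
  · rw [hv]
    exact ht2

instance : IsProbabilityMeasure S.law := by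
  have : S.law = S.noiseLaw.prod (initLaw S.p S.d S.initVar) := rfl
  rw [this]
  infer_instance

lemma measureReal_not_learnsSubclassEarly (hμ : κ.μ ≠ 0) (hgap : κ.φ κ.cls ^ 2 < 1 + κ.μ ^ 2)
    (hσ : S.σξ ≤ 1) (hs : S.scale ≤ κ.exitScale) (hs' : 3 * S.scale ≤ κ.featureStrength) {ε : ℝ}
    (hε : S.errorBound ≤ ε) (hε' : 3 / 2 * S.scale ≤ ε) :
    S.law.real
      {ω | ¬ S.LearnsSubclassEarly κ.featureStrength (1 / Real.log (1 + 4 * κ.η)) ε ω}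
      ≤ (κ.K + 1) * S.overlap + κ.numEvents * κ.rate ^ S.p := by
  refine le_trans (measureReal_mono fun ω hω => ?_) S.measureReal_not_good
  rw [Set.mem_ofPred_eq] at hω ⊢
  exact fun h => hω (h.1.learnsSubclassEarly hμ hgap hσ hs hs' h.2 hε hε')

end Problem

/-- Exponential decay beats every polynomial. -/
lemma exists_geometric_le_div_pow {r : ℝ} (hr : 0 ≤ r) (hr' : r < 1) (q : ℕ) :
    ∃ B : ℝ, 0 ≤ B ∧ ∀ p : ℕ, 0 < p → r ^ p ≤ B * (1 / (p : ℝ) ^ q) := by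
  have h := tendsto_pow_const_mul_const_pow_of_abs_lt_one q
    (show |r| < 1 by rwa [abs_of_nonneg hr])
  obtain ⟨B, hB⟩ := h.bddAbove_range
  refine ⟨B, le_trans (by positivity) (hB ⟨0, rfl⟩), fun p hp => ?_⟩
  have hp' : (0 : ℝ) < (p : ℝ) ^ q := by positivity
  rw [mul_one_div, le_div_iff₀ hp', mul_comm]
  exact hB ⟨p, rfl⟩

end

theorem theorem4p5 (κ : Constants) (hμ : κ.μ ≠ 0) (hgap : κ.φ κ.cls ^ 2 < 1 + κ.μ ^ 2) :
    ∃ c > (0 : ℝ), ∃ A > (0 : ℝ), ∃ C : ℕ → ℝ, ∀ S : ℕ → Problem κ,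
      Tendsto (fun N => (S N).σ₀ * √(((S N).p : ℝ) / ((S N).d : ℝ))) atTop (𝓝 0) →
      Tendsto (fun N => (S N).σξ) atTop (𝓝 0) →
      Tendsto (fun N => ((S N).m : ℝ) ^ 2 * ((S N).n : ℝ) ^ 2 / ((S N).d : ℝ)) atTop (𝓝 0) →
      ∃ ε : ℕ → ℝ, Tendsto ε atTop (𝓝 0) ∧
        (∀ q : ℕ, ∀ᶠ N in atTop,
          (S N).law.real {ω | ¬ (S N).LearnsSubclassEarly c A (ε N) ω} ≤
            C q * (((S N).m : ℝ) ^ 2 * ((S N).n : ℝ) ^ 2 / ((S N).d : ℝ)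
              + 1 / ((S N).p : ℝ) ^ q)) ∧
        (Tendsto (fun N => (S N).p) atTop atTop →
          Tendsto (fun N => (S N).law.real {ω | ¬ (S N).LearnsSubclassEarly c A (ε N) ω})
            atTop (𝓝 0)) := by
  choose B hB0 hB using exists_geometric_le_div_pow κ.rate_pos.le κ.rate_lt_one
  have hE : 0 ≤ κ.numEvents := by unfold Constants.numEvents; positivity
  have hη := κ.η_pos
  refine ⟨κ.featureStrength, Constants.featureStrength_pos hμ, 1 / Real.log (1 + 4 * κ.η),
    one_div_pos.mpr (Real.log_pos (by linarith)), fun q => (κ.K + 1) + κ.numEvents * B q,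
    fun S hs hσ ho => ?_⟩
  change Tendsto (fun N => (S N).scale) atTop (𝓝 0) at hs
  change Tendsto (fun N => (S N).overlap) atTop (𝓝 0) at ho
  have herr : Tendsto (fun N => (S N).errorBound) atTop (𝓝 0) := by
    have := (ho.const_mul (κ.K + 1 : ℝ)).add
      ((((hσ.mul_const κ.functionalBound).div_const κ.margin).pow 2).const_mul 32)
    rw [mul_zero, zero_mul, zero_div, zero_pow two_ne_zero, mul_zero, add_zero] at this
    exact this
  have hbound : ∀ q : ℕ, ∀ᶠ N in atTop, (S N).law.real {ω | ¬ (S N).LearnsSubclassEarly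
      κ.featureStrength (1 / Real.log (1 + 4 * κ.η))
      ((S N).errorBound + 3 / 2 * (S N).scale) ω} ≤
        ((κ.K + 1) + κ.numEvents * B q) * ((S N).overlap + 1 / ((S N).p : ℝ) ^ q) := by
    intro q
    have h3 := hs.const_mul 3
    rw [mul_zero] at h3
    filter_upwards [hσ.eventually_le_const one_pos,
      hs.eventually_le_const (Constants.exitScale_pos hμ),
      h3.eventually_le_const (Constants.featureStrength_pos hμ)] with N h1 h2 h3
    have he : 0 ≤ (S N).errorBound := by
      have := (S N).overlap_nonneg
      unfold Problem.errorBound; positivity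
    refine (Problem.measureReal_not_learnsSubclassEarly hμ hgap h1 h2 h3
      (by linarith [(S N).scale_pos]) (by linarith)).trans ?_
    have hp := mul_le_mul_of_nonneg_left
      (hB q (S N).p (by have := (S N).three_le_p; omega)) hE
    have h4 : 0 ≤ κ.numEvents * B q * (S N).overlap :=
      mul_nonneg (mul_nonneg hE (hB0 q)) (S N).overlap_nonneg
    have h5 : 0 ≤ (κ.K + 1 : ℝ) * (1 / ((S N).p : ℝ) ^ q) := by positivity
    linarith
  refine ⟨fun N => (S N).errorBound + 3 / 2 * (S N).scale, ?_, hbound, fun hp => ?_⟩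
  · simpa using herr.add (hs.const_mul (3 / 2))
  -- Any positive exponent would do; `q = 1` is used.
  · have hp' : Tendsto (fun N => 1 / ((S N).p : ℝ) ^ 1) atTop (𝓝 0) := by
      simp only [pow_one, one_div]
      exact (tendsto_natCast_atTop_atTop.comp hp).inv_tendsto_atTop
    have hlim := (ho.add hp').const_mul ((κ.K + 1) + κ.numEvents * B 1)
    rw [add_zero, mul_zero] at hlim
    exact tendsto_of_tendsto_of_tendsto_of_le_of_le' tendsto_const_nhds hlim
      (Eventually.of_forall fun _ => measureReal_nonneg) (hbound 1)
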